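/- **Setting.** A tgd over a relational signature $\mathcal R$ is a formula $\forall \mathbf X\forall\mathbf Y\,(\Phi(\mathbf X,\mathbf Y)\to\exists \mathbf Z\,\Psi(\mathbf X,\mathbf Z))$ in which the body $\Phi$ is a conjunction of atoms, the head $\Psi$ is a single atom (all without constants), and $\mathbf Z$ contains at most one variable. For a database $D$, a finite set $\Sigma$ of tgds and a Boolean conjunctive query $q$ over $\mathcal R$ (constants are allowed in $q$), $(D,\Sigma)\models q$ means that $q$ holds in every (possibly infinite) instance $B\supseteq D$ that satisfies $\Sigma$. The sizes $|\Sigma|,|q|,|P|$ count symbol occurrences. *Sticky sets.* In each tgd of $\Sigma$ mark the body variables that do not occur in its head; then, exhaustively, whenever a marked variable occurs in some body at a position $\pi$ (predicate symbol and argument index), mark in each tgd of $\Sigma$ the body variables that occur in its head at $\pi$. $\Sigma$ is *sticky* if no marked variable occurs more than once in a body. *Sticky-join sets.* Generate bodies with marked variables as follows. The body of each tgd of $\Sigma$, with the variables that do not occur in its head marked, is generated. If $a$ is an atom of a generated marked body, and the head of a tgd $\sigma\in\Sigma$ (with variables renamed apart) unifies with $a$ by a most general unifier $\theta$ that does not identify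 an existential variable of $\sigma$ with another variable of the head, then $\theta(\mathrm{body}(\sigma))$ is generated, where a variable $y$ is marked iff every variable $x$ of $a$ with $\theta(x)=y$ is marked (in particular, if there is no such $x$). $\Sigma$ is *sticky-join* if no marked variable of a generated body occurs in two distinct atoms of it. *Databases.* A (non-numerical) database has two distinct elements $0$ and $1$ in its domain, given by unary predicates $Zero=\{0\}$ and $One=\{1\}$, and a binary predicate $Neq$ that is the inequality relation on its domain. The $N$-numerical extension $D_N$ of a database $D$ arises by adding the numbers $0,\dots,N$ as new elements to the domain, with $Zero=\{0\}$, $One=\{1\}$, $Neq$ for inequality on the extended domain, $Num=\{1,\dots,N\}$, and the successor relation $Succ$ and the order $<$ on $\{0,\dots,N\}$. *Programs.* A nonrecursive Datalog program is a finite set of safe, negation-free Datalog rules whose intensional predicates have an acyclic dependency graph; $D\models P$ means that the propositional predicate $goal$ is derivable. Its arity is the maximum arity of its intensional predicates. Apart from these, a rewriting of $(\Sigma,q)$ may use only the predicates that occur in $\Sigma$ or $q$ and the built-in ones, and its only constants are those of $q$. **Theorem.** For each fixed finite signature $\mathcal R$ there are polynomials $\gamma$, $s$ and a constant $k$ such that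 for every finite set $\Sigma$ of tgds over $\mathcal R$ that is sticky or sticky-join, and every Boolean conjunctive query $q$ over $\mathcal R$, with $m=|\Sigma|+|q|$ and with $a$ the maximum arity of a predicate symbol occurring in $\Sigma$: (a) there is a nonrecursive Datalog program $P$ of size at most $s(m)$ and of arity at most $\max(a+1,3)$ such that for all $N\ge\gamma(m)$ and all databases $D$: $(D,\Sigma)\models q$ if and only if $D_N\models P$; (b) there is a nonrecursive Datalog program $P$ of size at most $s(m)$ and of arity at most $k\cdot\max(a+1,3)\cdot\lfloor\log_2\gamma(m)\rfloor$ such that for all (non-numerical) databases $D$: $(D,\Sigma)\models q$ if and only if $D\models P$. -/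

import Mathlib

namespace Onto

/-! ## Signatures and atoms -/

/-- A relational signature: predicate symbols with their arities. -/
structure Signature where
  Pred : Type
  arity : Pred → ℕ

/-- The disjoint union of two signatures. -/
def Signature.sum (S S' : Signature) : Signature where
  Pred := S.Pred ⊕ S'.Pred
  arity := Sum.elim S.arity S'.arity

/-- An atom over the signature `S` with arguments from `T`. Here `T` is `ℕ` (variables only),
`Term C` (variables and constants), or a set of values; in the last case the atom is a fact. -/
structure Atom (S : Signature) (T : Type) where
  pred : S.Pred
  args : Fin (S.arity pred) → T

namespace Atom

variable {S S' : Signature} {T T' : Type}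

def map (f : T → T') (a : Atom S T) : Atom S T' := ⟨a.pred, fun i => f (a.args i)⟩

/-- The arguments of an atom, as a set. For `T = ℕ` these are its variables. -/
def vars (a : Atom S T) : Set T := Set.range a.args

/-- The term `t` occurs in `a` at the position `π` (a predicate symbol and an argument index). -/
def HasAt (a : Atom S T) (π : S.Pred × ℕ) (t : T) : Prop :=
  a.pred = π.1 ∧ ∃ h : π.2 < S.arity a.pred, a.args ⟨π.2, h⟩ = t

/-- The number of symbols of an atom. -/
def size (a : Atom S T) : ℕ := S.arity a.pred + 1

def inl (a : Atom S T) : Atom (S.sum S') T := ⟨Sum.inl a.pred, a.args⟩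

def inr (a : Atom S' T) : Atom (S.sum S') T := ⟨Sum.inr a.pred, a.args⟩

end Atom

/-- The terms of queries and Datalog rules: variables and constants. -/
inductive Term (C : Type) where
  | var (x : ℕ)
  | const (c : C)

/-- The value of a term, for an interpretation `ι` of the constants and `ν` of the variables. -/
def Term.eval {C V : Type} (ι : C → V) (ν : ℕ → V) : Term C → V
  | .var x => ν x
  | .const c => ι c

/-! ## Tuple-generating dependencies, queries, certain answers -/

/-- The variables that occur in a conjunction of atoms. -/
def conjVars {S : Signature} (B : List (Atom S ℕ)) : Set ℕ := {x | ∃ a ∈ B, x ∈ a.vars}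

/-- A tgd with a single head atom and at most one existentially quantified variable. The
existential variables are those variables of the head that do not occur in the body. -/
structure TGD (S : Signature) where
  body : List (Atom S ℕ)
  head : Atom S ℕ
  exists_unique : ∀ x ∈ head.vars, ∀ y ∈ head.vars,
    x ∉ conjVars body → y ∉ conjVars body → x = y

namespace TGD

variable {S : Signature}

def size (σ : TGD S) : ℕ := σ.head.size + (σ.body.map Atom.size).sum

/-- All variables of the tgd. -/
def vars (σ : TGD S) : Set ℕ := {x | x ∈ σ.head.vars ∨ x ∈ conjVars σ.body}

/-- The maximum arity of the predicate symbols of the tgd. -/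
def maxArity (σ : TGD S) : ℕ :=
  ((σ.head :: σ.body).map fun a => S.arity a.pred).foldr max 0

/-- The predicate symbols of the tgd. -/
def preds (σ : TGD S) : Set S.Pred := {p | ∃ a ∈ σ.head :: σ.body, a.pred = p}

/-- The instance `B` satisfies the tgd: every homomorphism from the body to `B` has an
extension that maps the head to `B`. -/
def Sat {U : Type} (B : Set (Atom S U)) (σ : TGD S) : Prop :=
  ∀ h : ℕ → U, (∀ a ∈ σ.body, a.map h ∈ B) →
    ∃ h' : ℕ → U, (∀ x ∈ conjVars σ.body, h' x = h x) ∧ σ.head.map h' ∈ B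

end TGD

/-- The size of a finite set of tgds. -/
def tgdsSize {S : Signature} (Sg : Finset (TGD S)) : ℕ := ∑ σ ∈ Sg, σ.size

/-- The maximum arity of the predicate symbols that occur in a finite set of tgds. -/
def tgdsArity {S : Signature} (Sg : Finset (TGD S)) : ℕ := Sg.sup TGD.maxArity

/-- The predicate symbols that occur in a finite set of tgds. -/
def tgdsPreds {S : Signature} (Sg : Finset (TGD S)) : Set S.Pred := {p | ∃ σ ∈ Sg, p ∈ σ.preds}

/-- A Boolean conjunctive query with constants from `C`, as the list of its atoms. -/
abbrev BCQ (S : Signature) (C : Type) := List (Atom S (Term C))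

namespace BCQ

variable {S : Signature} {C : Type}

def size (q : BCQ S C) : ℕ := (List.map Atom.size q).sum

def preds (q : BCQ S C) : Set S.Pred := {p | ∃ a ∈ q, a.pred = p}

def consts (q : BCQ S C) : Set C := {c | ∃ a ∈ q, Term.const c ∈ a.vars}

/-- The query holds in the instance `B`, in which the constants are interpreted by `ι`. -/
def Holds {U : Type} (ι : C → U) (q : BCQ S C) (B : Set (Atom S U)) : Prop :=
  ∃ h : ℕ → U, ∀ a ∈ q, a.map (Term.eval ι h) ∈ B

end BCQ

/-- `D, Σ ⊨ q`: the query holds in every (possibly infinite) instance `B`, over an arbitrary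
set of values that extends the set of constants, which contains `D` and satisfies all tgds. -/
def Entails {S : Signature} {C : Type} (D : Set (Atom S C)) (Sg : Finset (TGD S))
    (q : BCQ S C) : Prop :=
  ∀ (U : Type) [Nonempty U] (ι : C → U), Function.Injective ι →
    ∀ B : Set (Atom S U), (∀ a ∈ D, a.map ι ∈ B) → (∀ σ ∈ Sg, σ.Sat B) → q.Holds ι B

/-! ## Sticky sets of tgds -/

/-- The sticky marking of the body variables of the tgds. Initially, the body variables that do
not occur in the head are marked. If a marked variable occurs in the body of a tgd at a position
`π`, then in each tgd the body variables that occur in the head at `π` are marked. -/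
inductive StickyMarked {S : Signature} (Sg : Finset (TGD S)) : TGD S → ℕ → Prop
  | init {σ : TGD S} {x : ℕ} (hσ : σ ∈ Sg) (hx : x ∈ conjVars σ.body) (hh : x ∉ σ.head.vars) :
      StickyMarked Sg σ x
  | propagate {σ σ' : TGD S} {x y : ℕ} {a : Atom S ℕ} {π : S.Pred × ℕ}
      (hm : StickyMarked Sg σ x) (ha : a ∈ σ.body) (hx : a.HasAt π x)
      (hσ' : σ' ∈ Sg) (hy : σ'.head.HasAt π y) (hb : y ∈ conjVars σ'.body) :
      StickyMarked Sg σ' y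

/-- A set of tgds is sticky if no marked variable occurs more than once in a body. -/
def Sticky {S : Signature} (Sg : Finset (TGD S)) : Prop :=
  ∀ σ ∈ Sg, ∀ x, StickyMarked Sg σ x → ∀ a ∈ σ.body, ∀ b ∈ σ.body, ∀ π π' : S.Pred × ℕ,
    a.HasAt π x → b.HasAt π' x → a = b ∧ π = π'

/-! ## Sticky-join sets of tgds -/

/-- `(α, β)` is a most general unifier of the atom `a` and the head of `σ`. The variables of `a`
and those of `σ` are taken apart: `α` acts on the former and `β` on the latter. -/
structure IsMGU {S : Signature} (a : Atom S ℕ) (σ : TGD S) (α β : ℕ → ℕ) : Prop where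
  unifies : a.map α = σ.head.map β
  general : ∀ α' β' : ℕ → ℕ, a.map α' = σ.head.map β' → ∃ γ : ℕ → ℕ,
    (∀ x ∈ a.vars, α' x = γ (α x)) ∧ (∀ x ∈ σ.vars, β' x = γ (β x))

/-- The sticky-join marking. It produces instances of bodies of tgds with a set of marked
variables. Initially, in the body of each tgd the variables that do not occur in the head are
marked. If `a` is an atom of a marked body already obtained, then each tgd `σ` whose head unifies
with `a`, without an existential variable being identified with another variable of the head,
contributes its body under the most general unifier. There a variable is marked if each variable
of `a` that it was unified with is marked (in particular, if it does not occur in the head). -/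
inductive StickyJoinMarked {S : Signature} (Sg : Finset (TGD S)) :
    List (Atom S ℕ) → Set ℕ → Prop
  | init {σ : TGD S} (hσ : σ ∈ Sg) :
      StickyJoinMarked Sg σ.body {x | x ∈ conjVars σ.body ∧ x ∉ σ.head.vars}
  | propagate {B : List (Atom S ℕ)} {M : Set ℕ} {a : Atom S ℕ} {σ : TGD S} {α β : ℕ → ℕ}
      (hB : StickyJoinMarked Sg B M) (ha : a ∈ B) (hσ : σ ∈ Sg) (hu : IsMGU a σ α β)
      (hz : ∀ z ∈ σ.head.vars, z ∉ conjVars σ.body → ∀ y ∈ σ.head.vars, y ≠ z → β y ≠ β z) :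
      StickyJoinMarked Sg (σ.body.map (Atom.map β))
        {y | y ∈ conjVars (σ.body.map (Atom.map β)) ∧ ∀ x ∈ a.vars, α x = y → x ∈ M}

/-- A set of tgds is sticky-join if no marked variable occurs in two distinct atoms of a body. -/
def StickyJoin {S : Signature} (Sg : Finset (TGD S)) : Prop :=
  ∀ (B : List (Atom S ℕ)) (M : Set ℕ), StickyJoinMarked Sg B M → ∀ x ∈ M, ∀ a ∈ B, ∀ b ∈ B,
    x ∈ a.vars → x ∈ b.vars → a = b

/-! ## Databases -/

/-- A database over the signature `S`: its facts, and its domain, which contains all values that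
occur in the facts. -/
structure Database (S : Signature) (C : Type) where
  facts : Set (Atom S C)
  dom : Set C
  args_mem : ∀ a ∈ facts, ∀ c ∈ a.vars, c ∈ dom

/-- The built-in predicates of each database. -/
inductive BoolSym where
  | zero | one | neq

def boolSig : Signature where
  Pred := BoolSym
  arity
    | .zero => 1
    | .one => 1
    | .neq => 2

/-- The built-in predicates of numerical databases. -/
inductive NumSym where
  | zero | one | neq | num | succ | lt

def numSig : Signature where
  Pred := NumSym
  arity
    | .zero => 1
    | .one => 1
    | .neq => 2
    | .num => 1
    | .succ => 2
    | .lt => 2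

namespace Database

variable {S : Signature} {C : Type}

/-- The facts of the database `D` together with those of the built-in predicates, where `z` and
`o` are the two distinguished constants `0` and `1`. -/
inductive Plain (D : Database S C) (z o : C) : Atom (S.sum boolSig) C → Prop
  | rel {a : Atom S C} (ha : a ∈ D.facts) : Plain D z o a.inl
  | zero : Plain D z o ⟨Sum.inr BoolSym.zero, ![z]⟩
  | one : Plain D z o ⟨Sum.inr BoolSym.one, ![o]⟩
  | neq {c d : C} (hc : c ∈ D.dom) (hd : d ∈ D.dom) (h : c ≠ d) :
      Plain D z o ⟨Sum.inr BoolSym.neq, ![c, d]⟩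

/-- `D` together with its built-in predicates, as a set of facts. -/
def plain (D : Database S C) (z o : C) : Set (Atom (S.sum boolSig) C) := {a | D.Plain z o a}

/-- The domain of the `N`-numerical extension: the old domain and the numbers `0, …, N`. -/
def numDom (D : Database S C) (N : ℕ) : Set (C ⊕ ℕ) :=
  {v | (∃ c ∈ D.dom, v = Sum.inl c) ∨ ∃ n ≤ N, v = Sum.inr n}

/-- The facts of the `N`-numerical extension of `D`. Its distinguished constants `0` and `1` are
the numbers `0` and `1`. -/
inductive Numerical (D : Database S C) (N : ℕ) : Atom (S.sum numSig) (C ⊕ ℕ) → Prop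
  | rel {a : Atom S C} (ha : a ∈ D.facts) : Numerical D N (a.map Sum.inl).inl
  | zero : Numerical D N ⟨Sum.inr NumSym.zero, ![Sum.inr 0]⟩
  | one (h : 1 ≤ N) : Numerical D N ⟨Sum.inr NumSym.one, ![Sum.inr 1]⟩
  | neq {v w : C ⊕ ℕ} (hv : v ∈ D.numDom N) (hw : w ∈ D.numDom N) (h : v ≠ w) :
      Numerical D N ⟨Sum.inr NumSym.neq, ![v, w]⟩
  | num {n : ℕ} (h : 1 ≤ n) (h' : n ≤ N) : Numerical D N ⟨Sum.inr NumSym.num, ![Sum.inr n]⟩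
  | succ {n : ℕ} (h : n + 1 ≤ N) :
      Numerical D N ⟨Sum.inr NumSym.succ, ![Sum.inr n, Sum.inr (n + 1)]⟩
  | lt {k n : ℕ} (h : k < n) (h' : n ≤ N) :
      Numerical D N ⟨Sum.inr NumSym.lt, ![Sum.inr k, Sum.inr n]⟩

/-- The `N`-numerical extension of `D`, as a set of facts. -/
def numerical (D : Database S C) (N : ℕ) : Set (Atom (S.sum numSig) (C ⊕ ℕ)) :=
  {a | D.Numerical N a}

end Database

/-! ## Nonrecursive Datalog -/

/-- The intensional predicate symbols of Datalog programs: pairs of a name and an arity. -/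
def idbSig : Signature where
  Pred := ℕ × ℕ
  arity p := p.2

/-- A Datalog rule with extensional signature `E` and constants from `C`. -/
structure Rule (E : Signature) (C : Type) where
  head : Atom idbSig (Term C)
  body : List (Atom (E.sum idbSig) (Term C))

namespace Rule

variable {E : Signature} {C : Type}

def size (r : Rule E C) : ℕ := r.head.size + (r.body.map Atom.size).sum

/-- Each variable of the head occurs in the body. -/
def Safe (r : Rule E C) : Prop :=
  ∀ x : ℕ, Term.var x ∈ r.head.vars → ∃ b ∈ r.body, Term.var x ∈ b.vars

end Rule

/-- A Datalog program. -/
abbrev Program (E : Signature) (C : Type) := List (Rule E C)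

namespace Program

variable {E : Signature} {C : Type}

def size (P : Program E C) : ℕ := (List.map Rule.size P).sum

/-- The intensional predicate symbols that occur in the program. -/
def idbPreds (P : Program E C) : Set (ℕ × ℕ) :=
  {p | ∃ r ∈ P, r.head.pred = p ∨ ∃ b ∈ r.body, b.pred = Sum.inr p}

/-- The extensional predicate symbols that occur in the program. -/
def edbPreds (P : Program E C) : Set E.Pred :=
  {p | ∃ r ∈ P, ∃ b ∈ r.body, b.pred = Sum.inl p}

/-- The arity of the program, that is, of its intensional predicates, is at most `k`. -/
def ArityLE (P : Program E C) (k : ℕ) : Prop := ∀ p ∈ P.idbPreds, idbSig.arity p ≤ k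

def consts (P : Program E C) : Set C :=
  {c | ∃ r ∈ P, Term.const c ∈ r.head.vars ∨ ∃ b ∈ r.body, Term.const c ∈ b.vars}

def Safe (P : Program E C) : Prop := ∀ r ∈ P, r.Safe

/-- `p` depends directly on `p'`: a rule for `p` uses `p'` in its body. -/
def DependsOn (P : Program E C) (p p' : ℕ × ℕ) : Prop :=
  ∃ r ∈ P, r.head.pred = p ∧ ∃ b ∈ r.body, b.pred = Sum.inr p'

/-- The dependency graph of the intensional predicates has no cycle. -/
def Nonrecursive (P : Program E C) : Prop := ∀ p, ¬ Relation.TransGen P.DependsOn p p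

/-- The facts that are derivable from the program and the set `I` of extensional facts, whose
values are from `V`; the constants of the program are interpreted by `ι`. -/
inductive Derives {V : Type} (P : Program E C) (ι : C → V) (I : Set (Atom E V)) :
    Atom (E.sum idbSig) V → Prop
  | edb {a : Atom E V} (ha : a ∈ I) : Derives P ι I a.inl
  | rule {r : Rule E C} (hr : r ∈ P) (ν : ℕ → V)
      (hb : ∀ b ∈ r.body, Derives P ι I (b.map (Term.eval ι ν))) :
      Derives P ι I (r.head.map (Term.eval ι ν)).inr

/-- The propositional goal predicate, named `0`. -/
def goal (V : Type) : Atom idbSig V := ⟨(0, 0), Fin.elim0⟩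

/-- `I ⊨ P`: the goal is derivable. -/
def Holds {V : Type} (P : Program E C) (ι : C → V) (I : Set (Atom E V)) : Prop :=
  P.Derives ι I (goal V).inr

end Program

/-- The syntactic requirements on a rewriting `P` of the query `q` under the tgds `Sg`: it is a
safe nonrecursive Datalog program that uses no constants other than those of `q`, and, besides
its intensional and the built-in predicates (of the signature `K`), only predicates that occur
in `Sg` or `q`. -/
structure IsNonrecDatalog {S K : Signature} {C : Type} (Sg : Finset (TGD S)) (q : BCQ S C)
    (P : Program (S.sum K) C) : Prop where
  safe : P.Safe
  nonrecursive : P.Nonrecursive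
  consts_subset : P.consts ⊆ q.consts
  preds_subset : ∀ p : S.Pred, Sum.inl p ∈ P.edbPreds → p ∈ tgdsPreds Sg ∪ q.preds

end Onto

open Onto

/-!
Why the theorem holds. By `Sticky.stickyJoin` only sticky-join sets have to be considered. An
entailed query `q` holds in the oblivious chase (`Entails.holds_chase`). Fix a homomorphism from `q`
to the chase and let `T` be the set of the values it takes. Two chase atoms have the same type if
they have the same predicate, the same values from `T` at the same positions, and the same
equalities between positions; for a fixed signature there are polynomially many types. The image of
the query can be derived with at most one atom for each type. To see this, each atom is derived anew
from the representatives of the types of the atoms it was derived from (`compress`). This preserves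
the values from `T`; it might however break equalities between values of different body atoms, which
are needed to apply a tgd. Such equalities are controlled by the marked bodies: an atom in the
derivation of the query is an instance of an atom of a marked body in which the variables that are
not marked take values from `T` (`Context`, `Context.exists_bodyView`). A marked variable occurs in
only one atom of the body, so an equality between values outside `T` is always one within a single
atom, and there it is demanded by the context, which depends on the type only (`compressSpec`). Thus
an entailed query has a derivation with polynomially many places, a place being a round and a
predicate (`Entails.exists_isDerivation`). Conversely, a query with a derivation is entailed
(`IsDerivation.holds`).

Such derivations are described by a positive quantifier-free formula of polynomial size, all of
whose variables are existentially quantified (`derivationForm`). Nulls are named after the places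
where they arise. A value is encoded as a tuple over the domain of the database with one component
for database elements and one bit for each place. In nonrecursive Datalog, a positive formula
becomes the body of one rule for the goal (`PosForm.program`). The formula may be large, and
disjunction is not available in a body, so each subformula receives a variable, its bit, whose value
is `1` only if the subformula is true; the connectives and the equations become intensional
predicates on bits and values, of arity at most `3`, and an atom `P(x)` of the formula becomes an
intensional predicate with the bit as an additional argument. This is where the arity `max (a + 1)
3` comes from. Only the predicates `zero`, `one` and `neq` are used, so the same program works over
plain databases and over numerical ones, and the polynomial `γ` can be taken to be constant.
-/

namespace Onto

/-! ### Atoms by position -/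

namespace Atom

variable {S : Signature} {T T' : Type}

/-- The argument of an atom at index `k`, or `none` if `k` is not below the arity. Indexing by
natural numbers avoids transports between the argument types of atoms with equal predicates. -/
def get (a : Atom S T) (k : ℕ) : Option T :=
  if h : k < S.arity a.pred then some (a.args ⟨k, h⟩) else none

theorem get_fin (a : Atom S T) (k : Fin (S.arity a.pred)) : a.get k = some (a.args k) := by
  simp [get]

theorem get_eq_some_iff {a : Atom S T} {k : ℕ} {t : T} :
    a.get k = some t ↔ ∃ h : k < S.arity a.pred, a.args ⟨k, h⟩ = t := by
  unfold get; split_ifs with h <;> simp [h]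

theorem lt_of_get {a : Atom S T} {k : ℕ} {t : T} (h : a.get k = some t) :
    k < S.arity a.pred := (get_eq_some_iff.1 h).1

theorem exists_get (a : Atom S T) {k : ℕ} (h : k < S.arity a.pred) : ∃ t, a.get k = some t :=
  ⟨_, get_eq_some_iff.2 ⟨h, rfl⟩⟩

theorem mem_vars_iff {a : Atom S T} {t : T} : t ∈ a.vars ↔ ∃ k, a.get k = some t := by
  constructor
  · rintro ⟨k, rfl⟩; exact ⟨k, a.get_fin k⟩
  · rintro ⟨k, hk⟩; obtain ⟨h, rfl⟩ := get_eq_some_iff.1 hk; exact ⟨_, rfl⟩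

theorem mem_vars_of_get {a : Atom S T} {k : ℕ} {t : T} (h : a.get k = some t) : t ∈ a.vars :=
  mem_vars_iff.2 ⟨k, h⟩

theorem hasAt_iff {a : Atom S T} {π : S.Pred × ℕ} {t : T} :
    a.HasAt π t ↔ a.pred = π.1 ∧ a.get π.2 = some t := by
  rw [HasAt, get_eq_some_iff]

@[simp] theorem map_pred (f : T → T') (a : Atom S T) : (a.map f).pred = a.pred := rfl

theorem pred_eq_of_map_eq {T'' : Type} {f : T → T''} {g : T' → T''} {a : Atom S T}
    {b : Atom S T'} (h : a.map f = b.map g) : a.pred = b.pred := by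
  simpa using congrArg Atom.pred h

theorem get_map (f : T → T') (a : Atom S T) (k : ℕ) : (a.map f).get k = (a.get k).map f := by
  by_cases h : k < S.arity a.pred <;> simp [get, map, h]

theorem get_map_some {f : T → T'} {a : Atom S T} {k : ℕ} {t : T} (h : a.get k = some t) :
    (a.map f).get k = some (f t) := by simp [get_map, h]

theorem get_map_eq_some {f : T → T'} {a : Atom S T} {k : ℕ} {u : T'}
    (h : (a.map f).get k = some u) : ∃ t, a.get k = some t ∧ f t = u := by
  simpa [get_map] using h

theorem ext_get {a b : Atom S T} (hp : a.pred = b.pred) (h : ∀ k, a.get k = b.get k) : a = b := by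
  obtain ⟨p, f⟩ := a
  obtain ⟨p', g⟩ := b
  obtain rfl : p = p' := hp
  congr 1
  funext k
  have := h k
  simpa [get] using this

theorem ext_some {a b : Atom S T} (hp : a.pred = b.pred)
    (h : ∀ k t, a.get k = some t → b.get k = some t) : a = b := by
  refine ext_get hp fun k => ?_
  by_cases hk : k < S.arity a.pred
  · obtain ⟨t, ht⟩ := a.exists_get hk
    rw [ht, h k t ht]
  · have hk' : ¬ k < S.arity b.pred := hp ▸ hk
    simp [get, hk, hk']

theorem map_id' (a : Atom S T) : a.map id = a := rfl

theorem map_map {T'' : Type} (f : T → T') (g : T' → T'') (a : Atom S T) :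
    (a.map f).map g = a.map (fun x => g (f x)) := rfl

theorem map_congr {f g : T → T'} {a : Atom S T} (h : ∀ x ∈ a.vars, f x = g x) :
    a.map f = a.map g := by
  unfold map; congr 1; funext k; exact h _ ⟨k, rfl⟩

theorem mem_vars_map {f : T → T'} {a : Atom S T} {u : T'} :
    u ∈ (a.map f).vars ↔ ∃ x ∈ a.vars, f x = u := by
  constructor
  · rintro ⟨k, rfl⟩; exact ⟨_, ⟨k, rfl⟩, rfl⟩
  · rintro ⟨_, ⟨k, rfl⟩, rfl⟩; exact ⟨k, rfl⟩

/-- An atom is an instance of each atom with the same predicate and no further equalities. -/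
theorem exists_map_eq [Nonempty T'] {a : Atom S T} {c : Atom S T'} (hp : a.pred = c.pred)
    (h : ∀ i j x, a.get i = some x → a.get j = some x → c.get i = c.get j) :
    ∃ γ : T → T', a.map γ = c := by
  classical
  have : ∀ x : T, ∃ u : T', ∀ i, a.get i = some x → c.get i = some u := by
    intro x
    by_cases hx : ∃ i, a.get i = some x
    · obtain ⟨i, hi⟩ := hx
      obtain ⟨u, hu⟩ := c.exists_get (k := i) (hp ▸ lt_of_get hi)
      exact ⟨u, fun j hj => by rw [h j i x hj hi, hu]⟩
    · exact ⟨Classical.arbitrary _, fun i hi => (hx ⟨i, hi⟩).elim⟩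
  choose γ hγ using this
  refine ⟨γ, ext_some (by simpa using hp) fun k t hk => ?_⟩
  obtain ⟨x, hx, rfl⟩ := get_map_eq_some hk
  exact hγ x k hx

end Atom

theorem mem_conjVars_map {S : Signature} {B : List (Atom S ℕ)} {β : ℕ → ℕ} {y : ℕ} :
    y ∈ conjVars (B.map (Atom.map β)) ↔ ∃ x ∈ conjVars B, β x = y := by
  constructor
  · rintro ⟨a, ha, hy⟩
    obtain ⟨b, hb, rfl⟩ := List.mem_map.1 ha
    obtain ⟨x, hx, rfl⟩ := Atom.mem_vars_map.1 hy
    exact ⟨x, ⟨b, hb, hx⟩, rfl⟩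
  · rintro ⟨x, ⟨b, hb, hx⟩, rfl⟩
    exact ⟨_, List.mem_map.2 ⟨b, hb, rfl⟩, Atom.mem_vars_map.2 ⟨x, hx, rfl⟩⟩

/-! ### Sticky sets are sticky-join -/

/-- Two variables of a body that a most general unifier identifies, to a variable all of whose
counterparts in the atom `a` occur only once in `a`, are equal: mapping one of them to `0` and all
other variables to `1` extends to a unifier. -/
theorem IsMGU.eq_of_occurs_once {S : Signature} {a : Atom S ℕ} {σ : TGD S} {α β : ℕ → ℕ}
    (hu : IsMGU a σ α β) {y : ℕ}
    (hy : ∀ x, α x = y → ∀ i j, a.get i = some x → a.get j = some x → i = j)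
    {x₁ x₂ : ℕ} (h₁ : x₁ ∈ conjVars σ.body) (h₂ : x₂ ∈ conjVars σ.body)
    (e₁ : β x₁ = y) (e₂ : β x₂ = y) : x₁ = x₂ := by
  classical
  by_contra hne
  have hget : ∀ i x w, a.get i = some x → σ.head.get i = some w → α x = β w := by
    intro i x w hx hw
    have h1 := Atom.get_map_some (f := α) hx
    rw [hu.unifies, Atom.get_map_some hw] at h1
    exact (Option.some.inj h1).symm
  let β' : ℕ → ℕ := fun x => if x = x₁ then 0 else 1
  let α' : ℕ → ℕ := fun x => if ∃ i, a.get i = some x ∧ σ.head.get i = some x₁ then 0 else 1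
  have hunif : a.map α' = σ.head.map β' := by
    have hp : a.pred = σ.head.pred := Atom.pred_eq_of_map_eq hu.unifies
    refine Atom.ext_some hp fun k t hk => ?_
    obtain ⟨x, hx, rfl⟩ := Atom.get_map_eq_some hk
    obtain ⟨w, hw⟩ := σ.head.exists_get (k := k) (hp ▸ Atom.lt_of_get hx)
    rw [Atom.get_map_some hw]
    congr 1
    by_cases hw1 : w = x₁
    · subst hw1
      simp only [β', α', if_true]
      rw [if_pos ⟨k, hx, hw⟩]
    · simp only [β', α', if_neg hw1]
      rw [if_neg]
      rintro ⟨j, hj, hj'⟩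
      have hαx : α x = y := by rw [hget j x x₁ hj hj', e₁]
      have : k = j := hy x hαx k j hx hj
      subst this
      rw [hw] at hj'
      exact hw1 (Option.some.inj hj')
  obtain ⟨γ, -, hγ⟩ := hu.general α' β' hunif
  have g1 := hγ x₁ (Or.inr h₁)
  have g2 := hγ x₂ (Or.inr h₂)
  rw [e₁] at g1
  rw [e₂, ← g1] at g2
  simp [β', Ne.symm hne] at g2

/-- Each marked body generated from a sticky set is an instance of the body of a tgd in which each
marked variable stems from exactly one variable, and that variable carries the sticky marking. -/
theorem StickyJoinMarked.exists_stickyMarked {S : Signature} {Sg : Finset (TGD S)}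
    (hs : Sticky Sg) {B : List (Atom S ℕ)} {M : Set ℕ} (h : StickyJoinMarked Sg B M) :
    ∃ σ ∈ Sg, ∃ β : ℕ → ℕ, B = σ.body.map (Atom.map β) ∧ ∀ y ∈ M,
      ∀ x ∈ conjVars σ.body, β x = y → StickyMarked Sg σ x ∧
        ∀ x' ∈ conjVars σ.body, β x' = y → x = x' := by
  induction h with
  | @init σ hσ =>
    refine ⟨σ, hσ, id, ?_, ?_⟩
    · symm; exact List.map_id _
    · rintro y ⟨-, hy⟩ x hx rfl
      exact ⟨.init hσ hx hy, fun x' _ h' => h'.symm⟩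
  | @propagate B M a σ' α β' hB ha hσ' hu hz ih =>
    obtain ⟨σ, hσ, β, rfl, hM⟩ := ih
    obtain ⟨a₀, ha₀, rfl⟩ := List.mem_map.1 ha
    -- a marked variable occurs only once in the atom that is resolved upon
    have honce : ∀ x ∈ M, ∀ i j, (a₀.map β).get i = some x → (a₀.map β).get j = some x →
        i = j := by
      intro x hx i j hi hj
      obtain ⟨u, hu, e⟩ := Atom.get_map_eq_some hi
      obtain ⟨v, hv, e'⟩ := Atom.get_map_eq_some hj
      obtain ⟨hm, huniq⟩ := hM x hx u ⟨a₀, ha₀, Atom.mem_vars_of_get hu⟩ e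
      obtain rfl := huniq v ⟨a₀, ha₀, Atom.mem_vars_of_get hv⟩ e'
      have := (hs σ hσ u hm a₀ ha₀ a₀ ha₀ (a₀.pred, i) (a₀.pred, j)
        (Atom.hasAt_iff.2 ⟨rfl, hu⟩) (Atom.hasAt_iff.2 ⟨rfl, hv⟩)).2
      exact congrArg Prod.snd this
    refine ⟨σ', hσ', β', rfl, ?_⟩
    rintro y ⟨-, hy⟩ x hx rfl
    refine ⟨?_, fun x' hx' e' => ?_⟩
    · by_cases hh : x ∈ σ'.head.vars
      · obtain ⟨i, hi⟩ := Atom.mem_vars_iff.1 hh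
        have hp : a₀.pred = σ'.head.pred :=
          Atom.pred_eq_of_map_eq (a := a₀.map β) hu.unifies
        obtain ⟨u, hu'⟩ := a₀.exists_get (k := i) (hp ▸ Atom.lt_of_get hi)
        have h1 := Atom.get_map_some (f := α) (Atom.get_map_some (f := β) hu')
        rw [hu.unifies, Atom.get_map_some hi] at h1
        have hαu : α (β u) = β' x := (Option.some.inj h1).symm
        have hmem : β u ∈ M :=
          hy (β u) (Atom.mem_vars_of_get (Atom.get_map_some hu')) hαu
        have hmk := (hM _ hmem u ⟨a₀, ha₀, Atom.mem_vars_of_get hu'⟩ rfl).1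
        exact .propagate (π := (a₀.pred, i)) hmk ha₀ (Atom.hasAt_iff.2 ⟨rfl, hu'⟩) hσ'
          (Atom.hasAt_iff.2 ⟨hp.symm, hi⟩) hx
      · exact .init hσ' hx hh
    · refine hu.eq_of_occurs_once (fun w hw i j hi hj => ?_) hx hx' rfl e'
      exact honce w (hy w (Atom.mem_vars_of_get hi) hw) i j hi hj

theorem Sticky.stickyJoin {S : Signature} {Sg : Finset (TGD S)} (hs : Sticky Sg) :
    StickyJoin Sg := by
  intro B M h y hy a ha b hb hya hyb
  obtain ⟨σ, hσ, β, rfl, hM⟩ := h.exists_stickyMarked hs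
  obtain ⟨a₀, ha₀, rfl⟩ := List.mem_map.1 ha
  obtain ⟨b₀, hb₀, rfl⟩ := List.mem_map.1 hb
  obtain ⟨x, hx, e⟩ := Atom.mem_vars_map.1 hya
  obtain ⟨x', hx', e'⟩ := Atom.mem_vars_map.1 hyb
  obtain ⟨hm, huniq⟩ := hM y hy x ⟨a₀, ha₀, hx⟩ e
  obtain rfl := huniq x' ⟨b₀, hb₀, hx'⟩ e'
  obtain ⟨i, hi⟩ := Atom.mem_vars_iff.1 hx
  obtain ⟨j, hj⟩ := Atom.mem_vars_iff.1 hx'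
  rw [(hs σ hσ x hm a₀ ha₀ b₀ hb₀ (a₀.pred, i) (b₀.pred, j) (Atom.hasAt_iff.2 ⟨rfl, hi⟩)
    (Atom.hasAt_iff.2 ⟨rfl, hj⟩)).1]

/-! ### Most general unifiers -/

/-- An atom and the head of a tgd that have a common instance have a most general unifier: the
variables of both, modulo the equivalence relation generated by the coincidences of positions. -/
theorem exists_isMGU {S : Signature} {a : Atom S ℕ} {σ : TGD S} {U : Type} {f g : ℕ → U}
    (h : a.map f = σ.head.map g) : ∃ α β : ℕ → ℕ, IsMGU a σ α β ∧
      ∃ γ : ℕ → U, (∀ x, f x = γ (α x)) ∧ ∀ x, g x = γ (β x) := by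
  classical
  have hp : a.pred = σ.head.pred := Atom.pred_eq_of_map_eq h
  let r : ℕ ⊕ ℕ → ℕ ⊕ ℕ → Prop := fun u v =>
    ∃ k x w, a.get k = some x ∧ σ.head.get k = some w ∧ u = Sum.inl x ∧ v = Sum.inr w
  have : Countable (Quot r) := Quot.mk_surjective.countable
  obtain ⟨ε, hε⟩ := exists_injective_nat (Quot r)
  let α : ℕ → ℕ := fun x => ε (Quot.mk r (Sum.inl x))
  let β : ℕ → ℕ := fun x => ε (Quot.mk r (Sum.inr x))
  have key : ∀ (U : Type) (f g : ℕ → U), a.map f = σ.head.map g →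
      ∃ γ : ℕ → U, (∀ x, f x = γ (α x)) ∧ ∀ x, g x = γ (β x) := by
    intro U f g h
    have : Nonempty U := ⟨f 0⟩
    let G : Quot r → U := Quot.lift (Sum.elim f g) (by
      rintro _ _ ⟨k, x, w, hx, hw, rfl, rfl⟩
      have h1 := Atom.get_map_some (f := f) hx
      rw [h, Atom.get_map_some hw] at h1
      exact (Option.some.inj h1).symm)
    refine ⟨fun n => G (Function.invFun ε n), fun x => ?_, fun x => ?_⟩
    · have : Nonempty (Quot r) := ⟨Quot.mk r (Sum.inl 0)⟩
      simp only [α]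
      rw [Function.leftInverse_invFun hε]; rfl
    · have : Nonempty (Quot r) := ⟨Quot.mk r (Sum.inl 0)⟩
      simp only [β]
      rw [Function.leftInverse_invFun hε]; rfl
  refine ⟨α, β, ⟨?_, ?_⟩, key U f g h⟩
  · refine Atom.ext_some hp fun k t hk => ?_
    obtain ⟨x, hx, rfl⟩ := Atom.get_map_eq_some hk
    obtain ⟨w, hw⟩ := σ.head.exists_get (k := k) (hp ▸ Atom.lt_of_get hx)
    rw [Atom.get_map_some hw]
    congr 1
    exact congrArg ε (Quot.sound ⟨k, x, w, hx, hw, rfl, rfl⟩).symm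
  · intro α' β' h'
    obtain ⟨γ, h1, h2⟩ := key ℕ α' β' h'
    exact ⟨γ, fun x _ => h1 x, fun x _ => h2 x⟩


/-! ### The oblivious chase -/

/-- The values of the chase: constants, and for each tgd and each assignment of its variables a
labelled null. The value `bot` makes the type nonempty when there are no constants. -/
inductive ChaseVal (S : Signature) (C : Type) where
  | base (c : C)
  | bot
  | null (σ : TGD S) (h : ℕ → ChaseVal S C)

instance (S : Signature) (C : Type) : Nonempty (ChaseVal S C) := ⟨.bot⟩

namespace ChaseVal

variable {S : Signature} {C : Type}

/-- A null is not among the values it is made from, by well-foundedness. -/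
theorem null_ne (v : ChaseVal S C) : ∀ (σ : TGD S) (h : ℕ → ChaseVal S C) (x : ℕ),
    v = null σ h → h x ≠ v := by
  induction v with
  | base c => intro σ h x e; cases e
  | bot => intro σ h x e; cases e
  | null σ' h' ih =>
    intro σ h x e he
    cases e
    exact ih x _ _ x he rfl

end ChaseVal

namespace TGD

variable {S : Signature} {C : Type}

open Classical in
/-- The assignment of the chase step of `σ` at `h`: the existential variable is mapped to the null
of this step. -/
noncomputable def fire (σ : TGD S) (h : ℕ → ChaseVal S C) (x : ℕ) : ChaseVal S C :=
  if x ∈ conjVars σ.body then h x else .null σ h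

theorem fire_of_mem {σ : TGD S} {h : ℕ → ChaseVal S C} {x : ℕ} (hx : x ∈ conjVars σ.body) :
    σ.fire h x = h x := if_pos hx

theorem fire_of_notMem {σ : TGD S} {h : ℕ → ChaseVal S C} {x : ℕ} (hx : x ∉ conjVars σ.body) :
    σ.fire h x = .null σ h := if_neg hx

end TGD

section Chase

variable {S : Signature} {C : Type}

/-- The atoms obtained in at most `n` rounds of the chase. -/
inductive ChaseAt (D : Set (Atom S C)) (Sg : Finset (TGD S)) :
    ℕ → Atom S (ChaseVal S C) → Prop
  | fact {a : Atom S C} (n : ℕ) (ha : a ∈ D) : ChaseAt D Sg n (a.map .base)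
  | step {σ : TGD S} {h : ℕ → ChaseVal S C} {n : ℕ} (hσ : σ ∈ Sg)
      (hb : ∀ b ∈ σ.body, ChaseAt D Sg n (b.map h)) : ChaseAt D Sg (n + 1) (σ.head.map (σ.fire h))

theorem ChaseAt.mono {D : Set (Atom S C)} {Sg : Finset (TGD S)} {n : ℕ}
    {c : Atom S (ChaseVal S C)} (h : ChaseAt D Sg n c) : ∀ {k : ℕ}, n ≤ k → ChaseAt D Sg k c := by
  induction h with
  | fact n ha => intro k _; exact .fact k ha
  | @step σ h n hσ hb ih =>
    intro k hk
    obtain ⟨k, rfl⟩ : ∃ l, k = l + 1 := ⟨k - 1, by omega⟩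
    exact .step hσ fun b hb => ih b hb (by omega)

/-- The chase of `D` with `Sg`. -/
def chase (D : Set (Atom S C)) (Sg : Finset (TGD S)) : Set (Atom S (ChaseVal S C)) :=
  {c | ∃ n, ChaseAt D Sg n c}

variable {D : Set (Atom S C)} {Sg : Finset (TGD S)}

open Classical in
/-- The first round of the chase in which an atom is present. -/
noncomputable def chaseRank (D : Set (Atom S C)) (Sg : Finset (TGD S))
    (c : Atom S (ChaseVal S C)) : ℕ := sInf {n | ChaseAt D Sg n c}

theorem chase_step {σ : TGD S} {h : ℕ → ChaseVal S C} (hσ : σ ∈ Sg)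
    (hb : ∀ b ∈ σ.body, b.map h ∈ chase D Sg) : σ.head.map (σ.fire h) ∈ chase D Sg := by
  have : ∃ n, ∀ b ∈ σ.body, ChaseAt D Sg n (b.map h) := by
    generalize σ.body = l at hb
    induction l with
    | nil => exact ⟨0, by simp⟩
    | cons b l ih =>
      obtain ⟨n, hn⟩ := ih fun b' hb' => hb b' (List.mem_cons_of_mem _ hb')
      obtain ⟨k, hk⟩ := hb b List.mem_cons_self
      refine ⟨max n k, fun b' hb' => ?_⟩
      rcases List.mem_cons.1 hb' with rfl | hb'
      · exact hk.mono (le_max_right _ _)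
      · exact (hn b' hb').mono (le_max_left _ _)
  obtain ⟨n, hn⟩ := this
  exact ⟨n + 1, .step hσ hn⟩

/-- `c` arises by firing `σ` at `h` on atoms of smaller rank. -/
structure FiredBy (D : Set (Atom S C)) (Sg : Finset (TGD S)) (c : Atom S (ChaseVal S C))
    (σ : TGD S) (h : ℕ → ChaseVal S C) : Prop where
  mem : σ ∈ Sg
  eq : c = σ.head.map (σ.fire h)
  body : ∀ b ∈ σ.body, b.map h ∈ chase D Sg ∧ chaseRank D Sg (b.map h) < chaseRank D Sg c

theorem exists_fact_or_firedBy {c : Atom S (ChaseVal S C)} (hc : c ∈ chase D Sg) :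
    (∃ a ∈ D, c = a.map .base) ∨ ∃ σ h, FiredBy D Sg c σ h := by
  have hr : ChaseAt D Sg (chaseRank D Sg c) c := Nat.sInf_mem hc
  generalize hn : chaseRank D Sg c = n at hr
  cases hr with
  | fact _ ha => exact Or.inl ⟨_, ha, rfl⟩
  | @step σ h k hσ hb =>
    refine Or.inr ⟨σ, h, hσ, rfl, fun b hb' => ⟨⟨k, hb b hb'⟩, ?_⟩⟩
    rw [hn]
    exact Nat.lt_succ_of_le (Nat.sInf_le (hb b hb'))

theorem chase_sat {σ : TGD S} (hσ : σ ∈ Sg) : σ.Sat (chase D Sg) := fun h hb =>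
  ⟨σ.fire h, fun _ hx => TGD.fire_of_mem hx, chase_step hσ hb⟩

theorem exists_fact_of_base_mem {a : Atom S (ChaseVal S C)} (ha : a ∈ chase D Sg) {c : C}
    (hc : .base c ∈ a.vars) : ∃ f ∈ D, c ∈ f.vars := by
  obtain ⟨n, hn⟩ := ha
  induction hn with
  | fact n ha =>
    obtain ⟨x, hx, e⟩ := Atom.mem_vars_map.1 hc
    cases e
    exact ⟨_, ha, hx⟩
  | @step σ h n hσ hb ih =>
    obtain ⟨x, -, e⟩ := Atom.mem_vars_map.1 hc
    by_cases hx : x ∈ conjVars σ.body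
    · rw [TGD.fire_of_mem hx] at e
      obtain ⟨b, hb', hxb⟩ := hx
      exact ih b hb' (Atom.mem_vars_map.2 ⟨x, hxb, e⟩)
    · rw [TGD.fire_of_notMem hx] at e
      cases e

theorem exists_fact_of_pred_notMem {c : Atom S (ChaseVal S C)} (hc : c ∈ chase D Sg)
    (hp : c.pred ∉ tgdsPreds Sg) : ∃ a ∈ D, c = a.map .base := by
  rcases exists_fact_or_firedBy hc with h | ⟨σ, h, hf⟩
  · exact h
  · exact (hp ⟨σ, hf.mem, σ.head, List.mem_cons_self, by rw [hf.eq]; rfl⟩).elim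

/-- An entailed query holds in the chase. -/
theorem Entails.holds_chase {q : BCQ S C} (h : Entails D Sg q) :
    q.Holds ChaseVal.base (chase D Sg) :=
  h (ChaseVal S C) ChaseVal.base (fun _ _ e => by cases e; rfl) _
    (fun _ ha => ⟨0, .fact 0 ha⟩) (fun _ hσ => chase_sat hσ)

end Chase

/-! ### Types of atoms and representatives -/

section Types

variable {S : Signature} {V : Type}

open Classical in
/-- The type of an atom relative to a set `T` of values: its predicate, the values from `T` with
their positions, and the equalities between positions. All arities are at most `w`. -/
noncomputable def atomType (T : Set V) (w : ℕ) (c : Atom S V) :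
    S.Pred × (Fin w → Option T) × (Fin w → Fin w → Prop) :=
  (c.pred, fun i => (c.get i).bind fun v => if h : v ∈ T then some ⟨v, h⟩ else none,
    fun i j => c.get i = c.get j)

variable {T : Set V} {w : ℕ} {c c' : Atom S V}

theorem get_eq_some_of_atomType_eq (hw : ∀ p, S.arity p ≤ w)
    (h : atomType T w c = atomType T w c') {i : ℕ} {v : V} (hv : v ∈ T)
    (hi : c.get i = some v) : c'.get i = some v := by
  have hiw : i < w := (Atom.lt_of_get hi).trans_le (hw _)
  have h2 := congrFun (congrArg (fun k => k.2.1) h) ⟨i, hiw⟩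
  simp only [atomType, hi, Option.bind_some, dif_pos hv] at h2
  obtain ⟨u, hu, e⟩ := Option.bind_eq_some_iff.1 h2.symm
  split_ifs at e with hT
  rw [hu]
  simpa using e

theorem get_eq_get_of_atomType_eq (hw : ∀ p, S.arity p ≤ w)
    (h : atomType T w c = atomType T w c') {i j : ℕ} {v : V}
    (hi : c.get i = some v) (hj : c.get j = some v) : c'.get i = c'.get j := by
  have hiw : i < w := (Atom.lt_of_get hi).trans_le (hw _)
  have hjw : j < w := (Atom.lt_of_get hj).trans_le (hw _)
  have h3 := congrFun (congrFun (congrArg (fun k => k.2.2) h) ⟨i, hiw⟩) ⟨j, hjw⟩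
  simp only [atomType, hi, hj] at h3
  simpa using h3

end Types

section Representatives

variable {S : Signature} {C : Type} {D : Set (Atom S C)} {Sg : Finset (TGD S)}
  {T : Set (ChaseVal S C)} {w : ℕ}

open Classical in
/-- A chase atom of minimal rank among those of type `k`, if there is one. -/
noncomputable def repOfType (D : Set (Atom S C)) (Sg : Finset (TGD S))
    (T : Set (ChaseVal S C)) (w : ℕ)
    (k : S.Pred × (Fin w → Option T) × (Fin w → Fin w → Prop)) : Atom S (ChaseVal S C) :=
  if h : {c | atomType T w c = k ∧ c ∈ chase D Sg}.Nonempty then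
    Function.argminOn (chaseRank D Sg) _ h
  else ⟨k.1, fun _ => .bot⟩

/-- The representative of an atom: a chase atom of the same type and of minimal rank. -/
noncomputable def rep (D : Set (Atom S C)) (Sg : Finset (TGD S)) (T : Set (ChaseVal S C)) (w : ℕ)
    (c : Atom S (ChaseVal S C)) : Atom S (ChaseVal S C) :=
  repOfType D Sg T w (atomType T w c)

variable {c : Atom S (ChaseVal S C)}

theorem rep_mem (hc : c ∈ chase D Sg) :
    atomType T w (rep D Sg T w c) = atomType T w c ∧ rep D Sg T w c ∈ chase D Sg := by
  have h : {c' | atomType T w c' = atomType T w c ∧ c' ∈ chase D Sg}.Nonempty := ⟨c, rfl, hc⟩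
  unfold rep repOfType
  rw [dif_pos h]
  exact Function.argminOn_mem _ _ h

theorem rep_rank_le (hc : c ∈ chase D Sg) :
    chaseRank D Sg (rep D Sg T w c) ≤ chaseRank D Sg c := by
  have h : {c' | atomType T w c' = atomType T w c ∧ c' ∈ chase D Sg}.Nonempty := ⟨c, rfl, hc⟩
  unfold rep repOfType
  rw [dif_pos h]
  exact Function.argminOn_le (chaseRank D Sg) {c' | atomType T w c' = atomType T w c ∧
    c' ∈ chase D Sg} ⟨rfl, hc⟩

theorem rep_rep (hc : c ∈ chase D Sg) :
    rep D Sg T w (rep D Sg T w c) = rep D Sg T w c := by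
  change repOfType D Sg T w (atomType T w (rep D Sg T w c)) = _
  rw [(rep_mem hc).1]
  rfl

end Representatives

/-! ### Contexts: the constraints that descendants impose on an atom -/

section Contexts

variable {S : Signature} {C : Type} {D : Set (Atom S C)} {Sg : Finset (TGD S)}
  {T : Set (ChaseVal S C)} {w : ℕ}

/-- The atom `a` of a marked body is a context of the atom `c` if `c` is an instance of `a` in
which the variables that are not marked take values from `T`. -/
def Context (Sg : Finset (TGD S)) (T : Set (ChaseVal S C)) (a : Atom S ℕ)
    (c : Atom S (ChaseVal S C)) : Prop :=
  ∃ (B : List (Atom S ℕ)) (M : Set ℕ) (γ : ℕ → ChaseVal S C), StickyJoinMarked Sg B M ∧ a ∈ B ∧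
    a.map γ = c ∧ ∀ x ∈ a.vars, x ∉ M → γ x ∈ T

/-- An atom is relevant if it has a context or takes all its values from `T`. The atoms in the
derivation of an instance of the query are of this kind. -/
def Relevant (Sg : Finset (TGD S)) (T : Set (ChaseVal S C)) (c : Atom S (ChaseVal S C)) : Prop :=
  (∀ v ∈ c.vars, v ∈ T) ∨ ∃ a, Context Sg T a c

/-- The contexts of an atom depend only on its type. -/
theorem Context.of_atomType_eq (hw : ∀ p, S.arity p ≤ w) {a : Atom S ℕ}
    {c c' : Atom S (ChaseVal S C)} (h : Context Sg T a c) (e : atomType T w c = atomType T w c') :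
    Context Sg T a c' := by
  obtain ⟨B, M, γ, hB, ha, rfl, hM⟩ := h
  have hp : a.pred = c'.pred := congrArg Prod.fst e
  obtain ⟨γ', rfl⟩ := Atom.exists_map_eq (a := a) hp fun i j x hi hj =>
    get_eq_get_of_atomType_eq hw e (Atom.get_map_some hi) (Atom.get_map_some hj)
  refine ⟨B, M, γ', hB, ha, rfl, fun x hx hxM => ?_⟩
  obtain ⟨k, hk⟩ := Atom.mem_vars_iff.1 hx
  have hT := hM x hx hxM
  have := get_eq_some_of_atomType_eq hw e hT (Atom.get_map_some hk)
  rw [Atom.get_map_some hk] at this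
  rwa [Option.some.inj this]

theorem Relevant.of_atomType_eq (hw : ∀ p, S.arity p ≤ w)
    {c c' : Atom S (ChaseVal S C)} (h : Relevant Sg T c) (e : atomType T w c = atomType T w c') :
    Relevant Sg T c' := by
  rcases h with h | ⟨a, h⟩
  · left
    intro v hv
    obtain ⟨k, hk⟩ := Atom.mem_vars_iff.1 hv
    have hp : c.pred = c'.pred := congrArg Prod.fst e
    obtain ⟨u, hu⟩ := c.exists_get (k := k) (hp ▸ Atom.lt_of_get hk)
    have huT := h u (Atom.mem_vars_of_get hu)
    have := get_eq_some_of_atomType_eq hw e huT hu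
    rw [hk] at this
    rwa [Option.some.inj this]
  · exact Or.inr ⟨a, h.of_atomType_eq hw e⟩

/-- The body of `σ` under the assignment `h`, seen as an instance via `γ` of a marked body
`σ.body.map β` in which the variables that are not marked take values from `T`. -/
structure BodyView (Sg : Finset (TGD S)) (T : Set (ChaseVal S C)) (σ : TGD S)
    (h : ℕ → ChaseVal S C) (β : ℕ → ℕ) (γ : ℕ → ChaseVal S C) (M : Set ℕ) : Prop where
  marked : StickyJoinMarked Sg (σ.body.map (Atom.map β)) M
  comp : ∀ x ∈ conjVars σ.body, h x = γ (β x)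
  unmarked : ∀ x ∈ conjVars σ.body, β x ∉ M → h x ∈ T

theorem BodyView.context {σ : TGD S} {h : ℕ → ChaseVal S C} {β : ℕ → ℕ}
    {γ : ℕ → ChaseVal S C} {M : Set ℕ} (hv : BodyView Sg T σ h β γ M) {b : Atom S ℕ}
    (hb : b ∈ σ.body) : Context Sg T (b.map β) (b.map h) := by
  refine ⟨_, M, γ, hv.marked, List.mem_map.2 ⟨b, hb, rfl⟩, ?_, ?_⟩
  · rw [Atom.map_map]
    exact Atom.map_congr fun x hx => (hv.comp x ⟨b, hb, hx⟩).symm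
  · intro y hy hM
    obtain ⟨x, hx, rfl⟩ := Atom.mem_vars_map.1 hy
    rw [← hv.comp x ⟨b, hb, hx⟩]
    exact hv.unmarked x ⟨b, hb, hx⟩ hM

/-- The sticky-join property: a value outside `T` that a view repeats is repeated within one
atom. -/
theorem BodyView.map_eq (hs : StickyJoin Sg) {σ : TGD S} {h : ℕ → ChaseVal S C} {β : ℕ → ℕ}
    {γ : ℕ → ChaseVal S C} {M : Set ℕ} (hv : BodyView Sg T σ h β γ M) {b b' : Atom S ℕ}
    (hb : b ∈ σ.body) (hb' : b' ∈ σ.body) {x x' : ℕ} (hx : x ∈ b.vars) (hx' : x' ∈ b'.vars)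
    (e : β x = β x') (hT : h x ∉ T) : b.map β = b'.map β ∧ b.map h = b'.map h := by
  have hM : β x ∈ M := by
    by_contra hM
    exact hT (hv.unmarked x ⟨b, hb, hx⟩ hM)
  have h1 : b.map β = b'.map β := hs _ _ hv.marked _ hM _ (List.mem_map.2 ⟨b, hb, rfl⟩) _
    (List.mem_map.2 ⟨b', hb', rfl⟩) (Atom.mem_vars_map.2 ⟨x, hx, rfl⟩)
    (Atom.mem_vars_map.2 ⟨x', hx', e.symm⟩)
  refine ⟨h1, ?_⟩
  have h2 : ∀ b ∈ σ.body, b.map h = (b.map β).map γ := fun b hb =>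
    Atom.map_congr fun x hx => hv.comp x ⟨b, hb, hx⟩
  rw [h2 b hb, h2 b' hb', h1]

/-- A context of the atom derived by `σ` and `h` resolves to a view of the body. -/
theorem Context.exists_bodyView {σ : TGD S} (hσ : σ ∈ Sg) {h : ℕ → ChaseVal S C} {a : Atom S ℕ}
    (hc : Context Sg T a (σ.head.map (σ.fire h))) :
    ∃ α β γ M, BodyView Sg T σ h β γ M ∧ a.map α = σ.head.map β := by
  obtain ⟨B, M, γ₀, hB, ha, e, hM⟩ := hc
  obtain ⟨α, β, hu, γ, hα, hβ⟩ := exists_isMGU e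
  have hz : ∀ z ∈ σ.head.vars, z ∉ conjVars σ.body → ∀ y ∈ σ.head.vars, y ≠ z → β y ≠ β z := by
    intro z hz hzb y hy hyz hyβ
    have hyb : y ∈ conjVars σ.body := by
      by_contra hyb
      exact hyz (σ.exists_unique y hy z hz hyb hzb)
    have h1 : σ.fire h y = σ.fire h z := by rw [hβ, hβ, hyβ]
    rw [TGD.fire_of_mem hyb, TGD.fire_of_notMem hzb] at h1
    exact ChaseVal.null_ne _ σ h y rfl h1
  refine ⟨α, β, γ, _, ⟨.propagate hB ha hσ hu hz, ?_, ?_⟩, hu.unifies⟩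
  · intro x hx
    rw [← hβ, TGD.fire_of_mem hx]
  · intro x hx hxM
    have : ¬ ∀ u ∈ a.vars, α u = β x → u ∈ M := fun hh =>
      hxM ⟨mem_conjVars_map.2 ⟨x, hx, rfl⟩, hh⟩
    push Not at this
    obtain ⟨u, hu', hux, huM⟩ := this
    have := hM u hu' huM
    rwa [hα, hux, ← hβ, TGD.fire_of_mem hx] at this

theorem Relevant.exists_bodyView {σ : TGD S} (hσ : σ ∈ Sg) {h : ℕ → ChaseVal S C}
    (hr : Relevant Sg T (σ.head.map (σ.fire h))) : ∃ β γ M, BodyView Sg T σ h β γ M := by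
  rcases hr with hT | ⟨a, ha⟩
  · refine ⟨id, h, {x | x ∈ conjVars σ.body ∧ x ∉ σ.head.vars}, ?_, fun _ _ => rfl, ?_⟩
    · have : σ.body.map (Atom.map id) = σ.body := List.map_id _
      rw [this]
      exact .init hσ
    · intro x hx hM
      have hxh : x ∈ σ.head.vars := by
        by_contra hxh
        exact hM ⟨hx, hxh⟩
      have := hT _ (Atom.mem_vars_map.2 ⟨x, hxh, rfl⟩)
      rwa [TGD.fire_of_mem hx] at this
  · obtain ⟨-, β, γ, M, hv, -⟩ := ha.exists_bodyView hσ
    exact ⟨β, γ, M, hv⟩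

theorem Relevant.body {σ : TGD S} (hσ : σ ∈ Sg) {h : ℕ → ChaseVal S C}
    (hr : Relevant Sg T (σ.head.map (σ.fire h))) {b : Atom S ℕ} (hb : b ∈ σ.body) :
    Relevant Sg T (b.map h) := by
  obtain ⟨β, γ, M, hv⟩ := hr.exists_bodyView hσ
  exact Or.inr ⟨_, hv.context hb⟩

end Contexts

/-! ### Compressed derivations -/

section Compress

variable {S : Signature} {C : Type} {D : Set (Atom S C)} {Sg : Finset (TGD S)}
  {T : Set (ChaseVal S C)} {w : ℕ}

open Classical in
/-- The atom `c`, derived anew: the atoms from which it is derived are replaced with their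
representatives, derived anew in turn. The new values at the positions of `c` are compatible with
all contexts of `c`, by `compressSpec`. -/
noncomputable def compress (D : Set (Atom S C)) (Sg : Finset (TGD S)) (T : Set (ChaseVal S C))
    (w : ℕ) (c : Atom S (ChaseVal S C)) : Atom S (ChaseVal S C) :=
  if hd : ∃ p : TGD S × (ℕ → ChaseVal S C), FiredBy D Sg c p.1 p.2 then
    hd.choose.1.head.map fun x =>
      if hx : ∃ p : Atom S ℕ × ℕ, p.1 ∈ hd.choose.1.body ∧ p.1.get p.2 = some x ∧
          chaseRank D Sg (rep D Sg T w (p.1.map hd.choose.2)) < chaseRank D Sg c then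
        ((compress D Sg T w (rep D Sg T w (hx.choose.1.map hd.choose.2))).get
          hx.choose.2).getD .bot
      else hd.choose.1.fire hd.choose.2 x
  else c
termination_by chaseRank D Sg c
decreasing_by exact hx.choose_spec.2.2

open Classical in
/-- How a compressed atom is derived. -/
theorem compress_eq {c : Atom S (ChaseVal S C)} (hc : c ∈ chase D Sg) :
    (∃ a ∈ D, c = a.map .base ∧ compress D Sg T w c = c) ∨
    ∃ (σ : TGD S) (h h' : ℕ → ChaseVal S C), FiredBy D Sg c σ h ∧
      compress D Sg T w c =
        σ.head.map (fun x => if x ∈ conjVars σ.body then h' x else .null σ h) ∧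
      ∀ x ∈ conjVars σ.body, ∃ b ∈ σ.body, ∃ j, b.get j = some x ∧
        h' x = ((compress D Sg T w (rep D Sg T w (b.map h))).get j).getD .bot := by
  by_cases hd : ∃ p : TGD S × (ℕ → ChaseVal S C), FiredBy D Sg c p.1 p.2
  · right
    rw [compress, dif_pos hd]
    have hf := hd.choose_spec
    set σ := hd.choose.1
    set h := hd.choose.2
    have hex : ∀ x ∈ conjVars σ.body, ∃ p : Atom S ℕ × ℕ, p.1 ∈ σ.body ∧ p.1.get p.2 = some x ∧
        chaseRank D Sg (rep D Sg T w (p.1.map h)) < chaseRank D Sg c := by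
      rintro x ⟨b, hb, hx⟩
      obtain ⟨j, hj⟩ := Atom.mem_vars_iff.1 hx
      exact ⟨(b, j), hb, hj, (rep_rank_le (hf.body b hb).1).trans_lt (hf.body b hb).2⟩
    refine ⟨σ, h, fun x => if hx : ∃ p : Atom S ℕ × ℕ, p.1 ∈ σ.body ∧ p.1.get p.2 = some x ∧
          chaseRank D Sg (rep D Sg T w (p.1.map h)) < chaseRank D Sg c then
        ((compress D Sg T w (rep D Sg T w (hx.choose.1.map h))).get hx.choose.2).getD .bot
      else .bot, hf, Atom.map_congr fun x _ => ?_, fun x hx => ?_⟩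
    · by_cases hx : x ∈ conjVars σ.body
      · simp only [if_pos hx, dif_pos (hex x hx)]
      · rw [if_neg hx, dif_neg, TGD.fire_of_notMem hx]
        rintro ⟨p, hp, hpx, -⟩
        exact hx ⟨p.1, hp, Atom.mem_vars_of_get hpx⟩
    · have hp := (hex x hx).choose_spec
      refine ⟨_, hp.1, _, hp.2.1, ?_⟩
      simp only [dif_pos (hex x hx)]
  · left
    rcases exists_fact_or_firedBy hc with ⟨a, ha, e⟩ | ⟨σ, h, hf⟩
    · exact ⟨a, ha, e, by rw [compress, dif_neg hd]⟩
    · exact (hd ⟨(σ, h), hf⟩).elim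

/-- The values from `T` survive compression, and so do the equalities demanded by contexts. -/
structure CompressSpec (D : Set (Atom S C)) (Sg : Finset (TGD S)) (T : Set (ChaseVal S C))
    (w : ℕ) (c : Atom S (ChaseVal S C)) : Prop where
  pred : (compress D Sg T w c).pred = c.pred
  label : ∀ i, ∀ v ∈ T, c.get i = some v → (compress D Sg T w c).get i = some v
  context : ∀ a, Context Sg T a c → ∀ i j x, a.get i = some x → a.get j = some x →
    (compress D Sg T w c).get i = (compress D Sg T w c).get j

/-- Variables of a body that a view identifies receive equal values: if the common value is not
in `T`, then by the sticky-join property they stem from atoms with the same representative. -/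
theorem BodyView.get_compress_eq (hs : StickyJoin Sg) (hw : ∀ p, S.arity p ≤ w) {σ : TGD S}
    {h : ℕ → ChaseVal S C} {β : ℕ → ℕ} {γ : ℕ → ChaseVal S C} {M : Set ℕ}
    (hv : BodyView Sg T σ h β γ M) (hch : ∀ b ∈ σ.body, b.map h ∈ chase D Sg)
    (ih : ∀ b ∈ σ.body, CompressSpec D Sg T w (rep D Sg T w (b.map h)))
    {b b' : Atom S ℕ} (hb : b ∈ σ.body) (hb' : b' ∈ σ.body) {i j x x' : ℕ}
    (hi : b.get i = some x) (hj : b'.get j = some x') (e : β x = β x') :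
    (compress D Sg T w (rep D Sg T w (b.map h))).get i =
      (compress D Sg T w (rep D Sg T w (b'.map h))).get j := by
  have hxx : h x = h x' := by
    rw [hv.comp x ⟨b, hb, Atom.mem_vars_of_get hi⟩, hv.comp x' ⟨b', hb', Atom.mem_vars_of_get hj⟩,
      e]
  by_cases hT : h x ∈ T
  · have key : ∀ b ∈ σ.body, ∀ i y, b.get i = some y → h y ∈ T →
        (compress D Sg T w (rep D Sg T w (b.map h))).get i = some (h y) := by
      intro b hb i y hi hT
      exact (ih b hb).label i _ hT (get_eq_some_of_atomType_eq hw (rep_mem (hch b hb)).1.symm hT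
        (Atom.get_map_some hi))
    rw [key b hb i x hi hT, key b' hb' j x' hj (hxx ▸ hT), hxx]
  · obtain ⟨h1, h2⟩ := hv.map_eq hs hb hb' (Atom.mem_vars_of_get hi) (Atom.mem_vars_of_get hj) e hT
    rw [← h2]
    refine (ih b hb).context (b.map β) ?_ i j (β x) (Atom.get_map_some hi) ?_
    · exact (hv.context hb).of_atomType_eq hw (rep_mem (hch b hb)).1.symm
    · rw [h1, e]; exact Atom.get_map_some hj

theorem exists_get_of_pred_eq {V V' : Type} {a : Atom S V} {b : Atom S V'} (hp : a.pred = b.pred)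
    {k : ℕ} {t : V} (h : a.get k = some t) : ∃ u, b.get k = some u :=
  b.exists_get (hp ▸ Atom.lt_of_get h)

open Classical in
/-- The derivation step of a compressed atom, from compressed representatives. -/
theorem compress_step (hs : StickyJoin Sg) (hw : ∀ p, S.arity p ≤ w) {c : Atom S (ChaseVal S C)}
    (hc : c ∈ chase D Sg) (hr : Relevant Sg T c)
    (ih : ∀ c' ∈ chase D Sg, Relevant Sg T c' → chaseRank D Sg c' < chaseRank D Sg c →
      CompressSpec D Sg T w c') :
    (∃ a ∈ D, c = a.map .base ∧ compress D Sg T w c = c) ∨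
    ∃ (σ : TGD S) (h h' : ℕ → ChaseVal S C), FiredBy D Sg c σ h ∧
      compress D Sg T w c =
        σ.head.map (fun x => if x ∈ conjVars σ.body then h' x else .null σ h) ∧
      (∀ b ∈ σ.body, CompressSpec D Sg T w (rep D Sg T w (b.map h))) ∧
      ∀ b ∈ σ.body, compress D Sg T w (rep D Sg T w (b.map h)) = b.map h' := by
  rcases compress_eq (T := T) (w := w) hc with h | ⟨σ, h, h', hf, he, hh'⟩
  · exact Or.inl h
  have ihb : ∀ b ∈ σ.body, CompressSpec D Sg T w (rep D Sg T w (b.map h)) := fun b hb =>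
    ih _ (rep_mem (hf.body b hb).1).2
      ((Relevant.body hf.mem (hf.eq ▸ hr) hb).of_atomType_eq hw (rep_mem (hf.body b hb).1).1.symm)
      ((rep_rank_le (hf.body b hb).1).trans_lt (hf.body b hb).2)
  have hpred : ∀ b ∈ σ.body, (compress D Sg T w (rep D Sg T w (b.map h))).pred = b.pred :=
    fun b hb => (ihb b hb).pred.trans (congrArg Prod.fst (rep_mem (w := w) (T := T)
      (hf.body b hb).1).1)
  refine Or.inr ⟨σ, h, h', hf, he, ihb, fun b hb => Atom.ext_some (hpred b hb) fun k t hk => ?_⟩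
  obtain ⟨x, hx⟩ := exists_get_of_pred_eq (hpred b hb) hk
  obtain ⟨b', hb', j, hj, e'⟩ := hh' x ⟨b, hb, Atom.mem_vars_of_get hx⟩
  obtain ⟨β, γ, M, hv⟩ := Relevant.exists_bodyView hf.mem (hf.eq ▸ hr)
  have := hv.get_compress_eq hs hw (fun b hb => (hf.body b hb).1) ihb hb hb' hx hj rfl
  rw [Atom.get_map_some hx, e', ← this, hk]
  rfl

/-- By induction on the rank. If a context identifies two positions of a derived atom, then the view
of the body to which it resolves identifies the variables there, and `BodyView.get_compress_eq`
applies. -/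
theorem compressSpec (hs : StickyJoin Sg) (hw : ∀ p, S.arity p ≤ w) :
    ∀ {c : Atom S (ChaseVal S C)}, c ∈ chase D Sg → Relevant Sg T c →
      CompressSpec D Sg T w c := by
  classical
  have main : ∀ n, ∀ c : Atom S (ChaseVal S C), c ∈ chase D Sg → Relevant Sg T c →
      chaseRank D Sg c = n → CompressSpec D Sg T w c := by
    intro n
    induction n using Nat.strong_induction_on with
    | _ n IH =>
    rintro c hc hr rfl
    rcases compress_step hs hw hc hr fun c' hc' hr' hlt => IH _ hlt c' hc' hr' rfl with
      ⟨a, -, -, e⟩ | ⟨σ, h, h', hf, he, ihb, hb⟩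
    · refine ⟨by rw [e], fun i v _ hi => by rwa [e], ?_⟩
      rintro a ⟨B, M, γ, -, -, rfl, -⟩ i j x hi hj
      rw [e, Atom.get_map_some hi, Atom.get_map_some hj]
    · have hget : ∀ k x, σ.head.get k = some x → (compress D Sg T w c).get k =
          some (if x ∈ conjVars σ.body then h' x else .null σ h) := by
        intro k x hx
        rw [he, Atom.get_map_some hx]
      have hpred : σ.head.pred = c.pred := by rw [hf.eq]; rfl
      have hlabel : ∀ i, ∀ v ∈ T, c.get i = some v →
          (compress D Sg T w c).get i = some v := by
        intro i v hv hi
        obtain ⟨x, hx⟩ := exists_get_of_pred_eq hpred.symm hi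
        rw [hget i x hx]
        rw [hf.eq, Atom.get_map_some hx] at hi
        by_cases hxb : x ∈ conjVars σ.body
        · rw [if_pos hxb]
          rw [TGD.fire_of_mem hxb] at hi
          obtain ⟨b, hb', hxb'⟩ := hxb
          obtain ⟨k, hk⟩ := Atom.mem_vars_iff.1 hxb'
          have h1 := (ihb b hb').label k v hv (get_eq_some_of_atomType_eq hw
            (rep_mem (hf.body b hb').1).1.symm hv (by rw [Atom.get_map_some hk, hi]))
          rwa [hb b hb', Atom.get_map_some hk] at h1
        · rw [if_neg hxb]
          rwa [TGD.fire_of_notMem hxb] at hi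
      refine ⟨by rw [he, hf.eq]; rfl, hlabel, ?_⟩
      intro a ha i j y hi hj
      have hap : a.pred = σ.head.pred := by
        obtain ⟨_, _, γ, -, -, e, -⟩ := ha
        rw [hpred, ← e]; rfl
      obtain ⟨x, hx⟩ := exists_get_of_pred_eq hap hi
      obtain ⟨x', hx'⟩ := exists_get_of_pred_eq hap hj
      obtain ⟨α, β, γ, M, hv, hαβ⟩ := Context.exists_bodyView hf.mem (hf.eq ▸ ha)
      have hcx : σ.fire h x = σ.fire h x' := by
        obtain ⟨_, _, γ, -, -, e, -⟩ := ha
        have h1 := Atom.get_map_some (f := γ) hi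
        have h2 := Atom.get_map_some (f := γ) hj
        rw [e, hf.eq, Atom.get_map_some hx] at h1
        rw [e, hf.eq, Atom.get_map_some hx'] at h2
        exact (Option.some.inj h1).trans (Option.some.inj h2).symm
      have hβ : β x = β x' := by
        have h1 := Atom.get_map_some (f := α) hi
        have h2 := Atom.get_map_some (f := α) hj
        rw [hαβ, Atom.get_map_some hx] at h1
        rw [hαβ, Atom.get_map_some hx'] at h2
        exact (Option.some.inj h1).trans (Option.some.inj h2).symm
      rw [hget i x hx, hget j x' hx']
      by_cases hxb : x ∈ conjVars σ.body <;> by_cases hxb' : x' ∈ conjVars σ.body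
      · rw [if_pos hxb, if_pos hxb']
        obtain ⟨b, hb1, hxb⟩ := hxb
        obtain ⟨b', hb1', hxb'⟩ := hxb'
        obtain ⟨k, hk⟩ := Atom.mem_vars_iff.1 hxb
        obtain ⟨l, hl⟩ := Atom.mem_vars_iff.1 hxb'
        have := hv.get_compress_eq hs hw (fun b hb => (hf.body b hb).1) ihb hb1 hb1' hk hl hβ
        rwa [hb b hb1, hb b' hb1', Atom.get_map_some hk, Atom.get_map_some hl] at this
      · rw [TGD.fire_of_mem hxb, TGD.fire_of_notMem hxb'] at hcx
        exact (ChaseVal.null_ne _ σ h x rfl hcx).elim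
      · rw [TGD.fire_of_mem hxb', TGD.fire_of_notMem hxb] at hcx
        exact (ChaseVal.null_ne _ σ h x' rfl hcx.symm).elim
      · rw [if_neg hxb, if_neg hxb']
  exact fun {c} hc hr => main _ _ hc hr rfl

end Compress


/-! ### Derivations of bounded length -/

section Derivation

variable {S : Signature} {C W : Type}

open Classical in
/-- A derivation of the query `q` in `n` rounds. In round `t` at most one atom is derived for each
predicate `P` of `Sg`; if so, `used t P` holds and the atom has the arguments `X t P`. It is a fact,
or it stems from a tgd, with the assignment `Y t P`, and atoms of earlier rounds; then the value
of the existential variable is the null `nl (t, P)`, which is named after the place of the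
derivation. The assignment `Z` maps the query to the derived atoms and the facts. -/
structure IsDerivation (Sg : Finset (TGD S)) (q : BCQ S C) (n : ℕ) (F : Set (Atom S W))
    (κ : C → W) (nl : Fin n × S.Pred → W) (used : Fin n → S.Pred → Prop)
    (X Y : Fin n → S.Pred → ℕ → W) (Z : ℕ → W) : Prop where
  step : ∀ t, ∀ P ∈ tgdsPreds Sg, used t P → (⟨P, fun k => X t P k⟩ : Atom S W) ∈ F ∨
    ∃ σ ∈ Sg, σ.head.pred = P ∧
      (∀ k : Fin (S.arity σ.head.pred), X t P k =
        if σ.head.args k ∈ conjVars σ.body then Y t P (σ.head.args k) else nl (t, P)) ∧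
      ∀ b ∈ σ.body, ∃ t' < t, used t' b.pred ∧
        ∀ k : Fin (S.arity b.pred), X t' b.pred k = Y t P (b.args k)
  query : ∀ a ∈ q,
    (a.pred ∈ tgdsPreds Sg ∧ ∃ t, used t a.pred ∧
      ∀ k : Fin (S.arity a.pred), X t a.pred k = (a.args k).eval κ Z) ∨
    (a.pred ∉ tgdsPreds Sg ∧ a.map (Term.eval κ Z) ∈ F)

/-! ### An entailed query has a derivation of bounded length -/

/-- The elements of a finite set can be numbered compatibly with a rank function. -/
theorem exists_numbering {α : Type} [DecidableEq α] (r : α → ℕ) (s : Finset α) :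
    ∃ f : α → ℕ, (∀ a ∈ s, f a < s.card) ∧ Set.InjOn f s ∧
      ∀ a ∈ s, ∀ b ∈ s, r a < r b → f a < f b := by
  induction s using Finset.induction_on_max_value r with
  | empty => exact ⟨fun _ => 0, by simp, by simp, by simp⟩
  | insert a s ha hmax ih =>
    obtain ⟨f, h1, h2, h3⟩ := ih
    have hne : ∀ b ∈ s, b ≠ a := fun b hb e => ha (e ▸ hb)
    refine ⟨Function.update f a s.card, ?_, ?_, ?_⟩
    · intro b hb
      rw [Finset.card_insert_of_notMem ha]
      rcases Finset.mem_insert.1 hb with rfl | hb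
      · simp
      · rw [Function.update_of_ne (hne b hb)]
        exact (h1 b hb).trans (Nat.lt_succ_self _)
    · intro b hb c hc e
      rcases Finset.mem_insert.1 hb with hb' | hb' <;> rcases Finset.mem_insert.1 hc with hc' | hc'
      · rw [hb', hc']
      · rw [hb', Function.update_self, Function.update_of_ne (hne c hc')] at e
        exact absurd e (h1 c hc').ne'
      · rw [hc', Function.update_self, Function.update_of_ne (hne b hb')] at e
        exact absurd e (h1 b hb').ne
      · rw [Function.update_of_ne (hne b hb'), Function.update_of_ne (hne c hc')] at e
        exact h2 hb' hc' e
    · intro b hb c hc hlt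
      rcases Finset.mem_insert.1 hb with hb' | hb' <;> rcases Finset.mem_insert.1 hc with hc' | hc'
      · rw [hb', hc'] at hlt
        exact absurd hlt (lt_irrefl _)
      · rw [hb'] at hlt
        exact absurd (hmax c hc') (not_le.2 hlt)
      · rw [hc', Function.update_self, Function.update_of_ne (hne b hb')]
        exact h1 b hb'
      · rw [Function.update_of_ne (hne b hb'), Function.update_of_ne (hne c hc')]
        exact h3 b hb' c hc' hlt

/-- A bound on the number of types of atoms over `K` predicates of arity at most `w`, relative to
at most `m` values. It is a polynomial in `m`; the semiring is that of the natural numbers or of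
the polynomials. -/
def typeBound {A : Type} [CommSemiring A] (K w : ℕ) (m : A) : A :=
  K * ((m + 1) ^ w * (2 ^ w) ^ w)

theorem card_types_le [Finite S.Pred] {V : Type} {T : Set V} (hT : T.Finite) (w m : ℕ)
    (hm : T.ncard ≤ m) :
    Nat.card (S.Pred × (Fin w → Option T) × (Fin w → Fin w → Prop)) ≤
      typeBound (Nat.card S.Pred) w m := by
  have : Finite T := hT
  simp only [Nat.card_prod, Nat.card_fun, Nat.card_eq_fintype_card (α := Fin w), Fintype.card_fin,
    Finite.card_option, typeBound, Nat.card_eq_fintype_card (α := Prop), Fintype.card_prop,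
    Nat.cast_id]
  gcongr
  exact hm

theorem BCQ.sum_arity_le_size (q : BCQ S C) :
    (q.map fun a => S.arity a.pred).sum ≤ q.size :=
  List.sum_le_sum fun _ _ => Nat.le_succ _

/-- The terms of a query take at most as many values as the query has symbols. -/
theorem BCQ.ncard_values_le {V : Type} (q : BCQ S C) (f : Term C → V) :
    {v | ∃ a ∈ q, v ∈ (a.map f).vars}.Finite ∧
      {v | ∃ a ∈ q, v ∈ (a.map f).vars}.ncard ≤ q.size := by
  classical
  refine (fun h => ⟨h.1, h.2.trans q.sum_arity_le_size⟩) (?_ : _ ∧ _ ≤ _)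
  induction q with
  | nil => simp
  | cons a q ih =>
    have e : {v | ∃ b ∈ a :: q, v ∈ (b.map f).vars} =
        (a.map f).vars ∪ {v | ∃ b ∈ q, v ∈ (b.map f).vars} := by
      ext v; simp
    have hfin : (a.map f).vars.Finite := Set.finite_range _
    have hcard : (a.map f).vars.ncard ≤ S.arity a.pred := by
      have := Set.ncard_image_le (f := (a.map f).args) (Set.finite_univ)
      rw [Set.image_univ, Set.ncard_univ, Nat.card_eq_fintype_card, Fintype.card_fin] at this
      exact this
    rw [e]
    refine ⟨hfin.union ih.1, (Set.ncard_union_le _ _).trans ?_⟩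
    rw [List.map_cons, List.sum_cons]
    exact add_le_add hcard ih.2

section Completeness

variable {D : Set (Atom S C)} {Sg : Finset (TGD S)} {T : Set (ChaseVal S C)} {w : ℕ}

/-- The relevant representatives. -/
def repSet (D : Set (Atom S C)) (Sg : Finset (TGD S)) (T : Set (ChaseVal S C)) (w : ℕ) :
    Set (Atom S (ChaseVal S C)) :=
  {c | c ∈ chase D Sg ∧ Relevant Sg T c ∧ rep D Sg T w c = c}

theorem repSet_finite [Finite S.Pred] (hT : T.Finite) {m : ℕ} (hm : T.ncard ≤ m) :
    (repSet D Sg T w).Finite ∧ (repSet D Sg T w).ncard ≤ typeBound (Nat.card S.Pred) w m := by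
  have : Finite T := hT
  have hinj : Set.InjOn (atomType T w) (repSet D Sg T w) := by
    rintro c ⟨-, -, e⟩ c' ⟨-, -, e'⟩ h
    rw [← e, ← e', rep, rep, h]
  refine ⟨Set.Finite.of_finite_image (Set.toFinite _) hinj, ?_⟩
  rw [← hinj.ncard_image]
  exact (Set.ncard_le_card _).trans (card_types_le hT w m hm)

theorem rep_mem_repSet (hw : ∀ p, S.arity p ≤ w) {c : Atom S (ChaseVal S C)}
    (hc : c ∈ chase D Sg) (hr : Relevant Sg T c) : rep D Sg T w c ∈ repSet D Sg T w :=
  ⟨(rep_mem hc).2, hr.of_atomType_eq hw (rep_mem hc).1.symm, rep_rep hc⟩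

theorem rep_eq_self (hw : ∀ p, S.arity p ≤ w) {c : Atom S (ChaseVal S C)}
    (hc : c ∈ chase D Sg) (hT : ∀ v ∈ c.vars, v ∈ T) : rep D Sg T w c = c :=
  (Atom.ext_some (congrArg Prod.fst (rep_mem (w := w) (T := T) hc).1.symm) fun _ _ hk =>
    get_eq_some_of_atomType_eq hw (rep_mem hc).1.symm (hT _ (Atom.mem_vars_of_get hk)) hk).symm

end Completeness

open Classical in
/-- The values of the chase in another set of values; `slot` tells how to name nulls. -/
noncomputable def renameVal (κ : C → W) (w₀ : W) (slot : Atom S (ChaseVal S C) → W) :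
    ChaseVal S C → W
  | .base c => κ c
  | .bot => w₀
  | .null σ h => slot (σ.head.map (σ.fire h))

/-- Each entailed query has a derivation in a number of rounds that is polynomial for a fixed
signature: the compressed representatives, numbered by rank. -/
theorem Entails.exists_isDerivation [Finite S.Pred] [Nonempty W] {D : Set (Atom S C)}
    {Sg : Finset (TGD S)} {q : BCQ S C} (hq : Entails D Sg q) (hs : StickyJoin Sg) {w n : ℕ}
    (hw : ∀ p, S.arity p ≤ w) (hn : typeBound (Nat.card S.Pred) w q.size ≤ n)
    (κ : C → W) (nl : Fin n × S.Pred → W) :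
    ∃ used X Y Z, IsDerivation Sg q n ((fun a => a.map κ) '' D) κ nl used X Y Z := by
  classical
  obtain ⟨hom, hhom⟩ := hq.holds_chase
  set T : Set (ChaseVal S C) := {v | ∃ a ∈ q, v ∈ (a.map (Term.eval .base hom)).vars} with hTdef
  obtain ⟨hTfin, hTcard⟩ := q.ncard_values_le (Term.eval ChaseVal.base hom)
  obtain ⟨hfin, hcard⟩ := repSet_finite (D := D) (Sg := Sg) (w := w) hTfin hTcard
  obtain ⟨f, hf1, hf2, hf3⟩ := exists_numbering (chaseRank D Sg) hfin.toFinset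
  have hfn : ∀ c ∈ repSet D Sg T w, f c < n := by
    intro c hc
    refine (hf1 c (hfin.mem_toFinset.2 hc)).trans_le ?_
    rw [← Set.ncard_eq_toFinset_card _ hfin]
    exact hcard.trans hn
  have hinj : ∀ c ∈ repSet D Sg T w, ∀ c' ∈ repSet D Sg T w, f c = f c' → c = c' :=
    fun c hc c' hc' e => hf2 (by simpa using hc) (by simpa using hc') e
  let w₀ : W := Classical.arbitrary W
  let slot : Atom S (ChaseVal S C) → W := fun c =>
    if h : f c < n then nl (⟨f c, h⟩, c.pred) else w₀
  let ren : ChaseVal S C → W := renameVal κ w₀ slot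
  let used : Fin n → S.Pred → Prop := fun t P => ∃ c ∈ repSet D Sg T w, f c = t ∧ c.pred = P
  let X : Fin n → S.Pred → ℕ → W := fun t P k =>
    if h : used t P then (((compress D Sg T w h.choose).get k).map ren).getD w₀ else w₀
  have hX : ∀ c ∈ repSet D Sg T w, ∀ t : Fin n, f c = t → ∀ P, c.pred = P → ∀ k v,
      (compress D Sg T w c).get k = some v → X t P k = ren v := by
    rintro c hc t ht _ rfl k v hk
    have hu : used t c.pred := ⟨c, hc, ht, rfl⟩
    have hch := hu.choose_spec
    have e : hu.choose = c := hinj _ hch.1 c hc (hch.2.1.trans ht.symm)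
    simp only [X, dif_pos hu]
    rw [e, hk]
    rfl
  have hspec : ∀ c ∈ repSet D Sg T w, CompressSpec D Sg T w c := fun c hc =>
    compressSpec hs hw hc.1 hc.2.1
  have hstep : ∀ t P, ∃ y : ℕ → W, used t P →
      (⟨P, fun k => X t P k⟩ : Atom S W) ∈ (fun a => a.map κ) '' D ∨
      ∃ σ ∈ Sg, σ.head.pred = P ∧
        (∀ k : Fin (S.arity σ.head.pred), X t P k =
          if σ.head.args k ∈ conjVars σ.body then y (σ.head.args k) else nl (t, P)) ∧
        ∀ b ∈ σ.body, ∃ t' < t, used t' b.pred ∧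
          ∀ k : Fin (S.arity b.pred), X t' b.pred k = y (b.args k) := by
    intro t P
    by_cases hu : used t P
    swap
    · exact ⟨fun _ => w₀, fun h => (hu h).elim⟩
    obtain ⟨c, hc, ht, rfl⟩ := hu
    rcases compress_step hs hw hc.1 hc.2.1 (fun c' hc' hr' _ => compressSpec hs hw hc' hr') with
      ⟨a, ha, e, e'⟩ | ⟨σ, h, h', hfb, he, hb1, hb2⟩
    · refine ⟨fun _ => w₀, fun _ => Or.inl ⟨a, ha, ?_⟩⟩
      subst e
      refine congrArg (Atom.mk a.pred) (funext fun k => ?_)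
      exact (hX _ hc t ht _ rfl k (.base (a.args k)) (by
        rw [e', Atom.get_map_some (a.get_fin k)])).symm
    · have hp : σ.head.pred = c.pred := by rw [hfb.eq]; rfl
      refine ⟨fun x => ren (h' x), fun _ => Or.inr ⟨σ, hfb.mem, hp, fun k => ?_, fun b hb => ?_⟩⟩
      · rw [hX c hc t ht _ rfl k _ (by rw [he, Atom.get_map_some (σ.head.get_fin k)])]
        by_cases hx : σ.head.args k ∈ conjVars σ.body
        · rw [if_pos hx, if_pos hx]
        · rw [if_neg hx, if_neg hx]
          change slot (σ.head.map (σ.fire h)) = _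
          rw [← hfb.eq]
          simp only [slot]
          rw [dif_pos (hfn c hc)]
          congr 2
          exact Fin.ext ht
      · have hbc := (hfb.body b hb).1
        have hbr : Relevant Sg T (b.map h) := Relevant.body hfb.mem (hfb.eq ▸ hc.2.1) hb
        have hmem := rep_mem_repSet (w := w) hw hbc hbr
        have hpr : (rep D Sg T w (b.map h)).pred = b.pred :=
          congrArg Prod.fst (rep_mem (w := w) (T := T) hbc).1
        refine ⟨⟨f (rep D Sg T w (b.map h)), hfn _ hmem⟩, ?_, ⟨_, hmem, rfl, hpr⟩, fun k => ?_⟩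
        · rw [Fin.lt_def, ← ht]
          exact hf3 _ (by simpa using hmem) _ (by simpa using hc)
            ((rep_rank_le hbc).trans_lt (hfb.body b hb).2)
        · refine hX _ hmem _ rfl _ hpr k _ ?_
          rw [hb2 b hb, Atom.get_map_some (b.get_fin k)]
  choose Y hY using hstep
  refine ⟨used, X, Y, fun x => ren (hom x), fun t P _ => hY t P, fun a ha => ?_⟩
  have hren : ∀ τ : Term C, ren (τ.eval .base hom) = τ.eval κ fun x => ren (hom x) := by
    rintro (x | c) <;> rfl
  have hc := hhom a ha
  by_cases hp : a.pred ∈ tgdsPreds Sg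
  · left
    have hT : ∀ v ∈ (a.map (Term.eval .base hom)).vars, v ∈ T := fun v hv => ⟨a, ha, hv⟩
    have hmem : a.map (Term.eval .base hom) ∈ repSet D Sg T w :=
      ⟨hc, Or.inl hT, rep_eq_self hw hc hT⟩
    refine ⟨hp, ⟨_, hfn _ hmem⟩, ⟨_, hmem, rfl, rfl⟩, fun k => ?_⟩
    rw [← hren]
    have hk := Atom.get_map_some (f := Term.eval ChaseVal.base hom) (a.get_fin k)
    exact hX _ hmem _ rfl _ rfl k _ ((hspec _ hmem).label k _ (hT _ (Atom.mem_vars_of_get hk)) hk)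
  · right
    refine ⟨hp, ?_⟩
    obtain ⟨b, hb, e⟩ := exists_fact_of_pred_notMem hc hp
    refine ⟨b, hb, ?_⟩
    have := congrArg (Atom.map ren) e
    rw [Atom.map_map, Atom.map_map] at this
    change _ = b.map κ at this
    exact this.symm.trans (Atom.map_congr fun τ _ => hren τ)

/-- The constants of an entailed query occur in the facts. -/
theorem Entails.const_mem {D : Set (Atom S C)} {Sg : Finset (TGD S)} {q : BCQ S C}
    (hq : Entails D Sg q) {c : C} (hc : c ∈ q.consts) : ∃ f ∈ D, c ∈ f.vars := by
  obtain ⟨hom, hhom⟩ := hq.holds_chase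
  obtain ⟨a, ha, hca⟩ := hc
  exact exists_fact_of_base_mem (hhom a ha) (Atom.mem_vars_map.2 ⟨_, hca, rfl⟩)

/-! ### A query with a derivation is entailed -/

namespace IsDerivation

variable {Sg : Finset (TGD S)} {q : BCQ S C} {n : ℕ} {F : Set (Atom S W)} {κ : C → W}
  {nl : Fin n × S.Pred → W} {used : Fin n → S.Pred → Prop} {X Y : Fin n → S.Pred → ℕ → W}
  {Z : ℕ → W}

theorem mem_tgdsPreds_of_mem_body {σ : TGD S} (hσ : σ ∈ Sg) {b : Atom S ℕ} (hb : b ∈ σ.body) :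
    b.pred ∈ tgdsPreds Sg := ⟨σ, hσ, b, List.mem_cons_of_mem _ hb, rfl⟩

/-- The nulls in an atom of round `t` are named after rounds up to `t`. -/
theorem null_le (h : IsDerivation Sg q n F κ nl used X Y Z) (hnl : Function.Injective nl)
    (hF : ∀ a ∈ F, ∀ s, nl s ∉ a.vars) :
    ∀ t P, P ∈ tgdsPreds Sg → used t P → ∀ k : Fin (S.arity P), ∀ s, X t P k = nl s → s.1 ≤ t := by
  intro t
  induction t using WellFoundedLT.induction with
  | _ t ih =>
  intro P hP hu k s hs
  rcases h.step t P hP hu with hfact | ⟨σ, hσ, rfl, hhead, hbody⟩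
  · exact (hF _ hfact s ⟨k, hs⟩).elim
  · rw [hhead k] at hs
    split_ifs at hs with hx
    · obtain ⟨b, hb, ⟨j, hj⟩⟩ := hx
      obtain ⟨t', ht', hu', he⟩ := hbody b hb
      exact (ih t' ht' b.pred (mem_tgdsPreds_of_mem_body hσ hb) hu' j s (by
        rw [he j, hj, hs])).trans ht'.le
    · rw [← hnl hs]

/-- Soundness: each instance that contains the facts and satisfies the tgds receives a homomorphism
from the derived atoms, by induction on the rounds. -/
theorem holds (h : IsDerivation Sg q n F κ nl used X Y Z) (hnl : Function.Injective nl)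
    (hκ : ∀ c s, κ c ≠ nl s) (hF : ∀ a ∈ F, ∀ s, nl s ∉ a.vars) {U : Type} (g₀ : W → U)
    {B : Set (Atom S U)} (hB : ∀ a ∈ F, a.map g₀ ∈ B) (hsat : ∀ σ ∈ Sg, σ.Sat B) :
    q.Holds (fun c => g₀ (κ c)) B := by
  classical
  have hnull := h.null_le hnl hF
  have main : ∀ m ≤ n, ∃ g : W → U, (∀ v, (∀ s, v ≠ nl s) → g v = g₀ v) ∧
      ∀ t : Fin n, t.1 < m → ∀ P ∈ tgdsPreds Sg, used t P →
        (⟨P, fun k => g (X t P k)⟩ : Atom S U) ∈ B := by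
    intro m
    induction m with
    | zero => exact fun _ => ⟨g₀, fun _ _ => rfl, fun t ht => absurd ht (Nat.not_lt_zero _)⟩
    | succ m ih =>
      intro hm
      obtain ⟨g, hg0, hg⟩ := ih (by omega)
      let t : Fin n := ⟨m, hm⟩
      have hex : ∀ P, ∃ u : U, P ∈ tgdsPreds Sg → used t P → ∀ g' : W → U,
          (∀ v, (∀ Q, v ≠ nl (t, Q)) → g' v = g v) → g' (nl (t, P)) = u →
          (⟨P, fun k => g' (X t P k)⟩ : Atom S U) ∈ B := by
        intro P
        by_cases hP : P ∈ tgdsPreds Sg ∧ used t P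
        swap
        · exact ⟨g (nl (t, P)), fun h1 h2 => (hP ⟨h1, h2⟩).elim⟩
        obtain ⟨hP, hu⟩ := hP
        rcases h.step t P hP hu with hfact | ⟨σ, hσ, rfl, hhead, hbody⟩
        · refine ⟨g (nl (t, P)), fun _ _ g' hg' _ => ?_⟩
          have := hB _ hfact
          convert this using 1
          refine congrArg (Atom.mk P) (funext fun k => ?_)
          have hne : ∀ s, X t P k ≠ nl s := fun s e => hF _ hfact s ⟨k, e⟩
          rw [hg' _ fun Q => hne _, hg0 _ hne]
        · -- the body variables take values that are older than the nulls of this round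
          have hold : ∀ x ∈ conjVars σ.body, ∀ Q, Y t σ.head.pred x ≠ nl (t, Q) := by
            rintro x ⟨b, hb, ⟨j, rfl⟩⟩ Q e
            obtain ⟨t', ht', hu', he⟩ := hbody b hb
            have := hnull t' b.pred (mem_tgdsPreds_of_mem_body hσ hb) hu' j (t, Q) (by
              rw [he j, e])
            exact absurd ht' (not_lt.2 this)
          obtain ⟨h', hh', hmem⟩ := hsat σ hσ (fun x => g (Y t σ.head.pred x)) (by
            intro b hb
            obtain ⟨t', ht', hu', he⟩ := hbody b hb
            have := hg t' ht' b.pred (mem_tgdsPreds_of_mem_body hσ hb) hu'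
            convert this using 1
            refine congrArg (Atom.mk b.pred) (funext fun k => ?_)
            rw [he k])
          by_cases hz : ∃ z ∈ σ.head.vars, z ∉ conjVars σ.body
          · obtain ⟨z, hz, hzb⟩ := hz
            refine ⟨h' z, fun _ _ g' hg' hz' => ?_⟩
            convert hmem using 1
            refine congrArg (Atom.mk _) (funext fun k => ?_)
            rw [hhead k]
            by_cases hx : σ.head.args k ∈ conjVars σ.body
            · rw [if_pos hx, hg' _ (hold _ hx), hh' _ hx]
            · rw [if_neg hx, hz', σ.exists_unique _ ⟨k, rfl⟩ z hz hx hzb]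
          · push Not at hz
            refine ⟨g (nl (t, σ.head.pred)), fun _ _ g' hg' _ => ?_⟩
            convert hmem using 1
            refine congrArg (Atom.mk _) (funext fun k => ?_)
            have hx := hz _ ⟨k, rfl⟩
            rw [hhead k, if_pos hx, hg' _ (hold _ hx), hh' _ hx]
      choose u hu using hex
      let g' : W → U := fun v => if hv : ∃ P, v = nl (t, P) then u hv.choose else g v
      have hg'1 : ∀ v, (∀ Q, v ≠ nl (t, Q)) → g' v = g v := by
        intro v hv
        exact dif_neg fun ⟨P, hP⟩ => hv P hP
      have hg'2 : ∀ P, g' (nl (t, P)) = u P := by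
        intro P
        have hv : ∃ Q, nl (t, P) = nl (t, Q) := ⟨P, rfl⟩
        simp only [g', dif_pos hv]
        have := hnl hv.choose_spec
        exact congrArg u (congrArg Prod.snd this).symm
      refine ⟨g', fun v hv => ?_, fun t₁ ht₁ P hP hu₁ => ?_⟩
      · rw [hg'1 v fun Q => hv _, hg0 v hv]
      · rcases Nat.lt_succ_iff_lt_or_eq.1 ht₁ with hlt | heq
        · have := hg t₁ hlt P hP hu₁
          convert this using 1
          refine congrArg (Atom.mk P) (funext fun k => ?_)
          refine hg'1 _ fun Q e => ?_
          have := hnull t₁ P hP hu₁ k (t, Q) e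
          exact absurd hlt (not_lt.2 this)
        · obtain rfl : t₁ = t := Fin.ext heq
          exact hu P hP hu₁ g' hg'1 (hg'2 P)
  obtain ⟨g, hg0, hg⟩ := main n le_rfl
  refine ⟨fun x => g (Z x), fun a ha => ?_⟩
  have hev : ∀ τ : Term C, τ.eval (fun c => g₀ (κ c)) (fun x => g (Z x)) = g (τ.eval κ Z) := by
    rintro (x | c)
    · rfl
    · exact (hg0 _ (hκ c)).symm
  rcases h.query a ha with ⟨hp, t, hu, he⟩ | ⟨-, hmem⟩
  · have := hg t t.2 a.pred hp hu
    convert this using 1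
    refine congrArg (Atom.mk a.pred) (funext fun k => ?_)
    rw [hev, he k]
  · have := hB _ hmem
    convert this using 1
    refine congrArg (Atom.mk a.pred) (funext fun k => ?_)
    rw [hev]
    exact hg0 _ fun s e => hF _ hmem s ⟨k, e⟩

end IsDerivation

end Derivation


/-! ### Positive formulas -/

/-- Positive propositional combinations of equations and facts over the variables `X` and the
constants `C`. They are read with all variables existentially quantified. -/
inductive PosForm (S : Signature) (X C : Type) where
  | eq (s t : X ⊕ C)
  | rel (P : S.Pred) (args : Fin (S.arity P) → X)
  | and (f g : PosForm S X C)
  | or (f g : PosForm S X C)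

namespace PosForm

variable {S : Signature} {X C V : Type}

/-- Truth of a formula, for a set `F` of facts and interpretations of constants and variables. -/
def Sat (F : Set (Atom S V)) (ι : C → V) (ν : X → V) : PosForm S X C → Prop
  | eq s t => Sum.elim ν ι s = Sum.elim ν ι t
  | rel P args => (⟨P, fun k => ν (args k)⟩ : Atom S V) ∈ F
  | and f g => f.Sat F ι ν ∧ g.Sat F ι ν
  | or f g => f.Sat F ι ν ∨ g.Sat F ι ν

/-- The number of symbols of the constraints that the formula is translated to. -/
def size : PosForm S X C → ℕ
  | eq _ _ => 4
  | rel P _ => S.arity P + 2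
  | and f g => f.size + g.size + 6
  | or f g => f.size + g.size + 4

def consts : PosForm S X C → Set C
  | eq s t => {c | s = Sum.inr c ∨ t = Sum.inr c}
  | rel _ _ => ∅
  | and f g => f.consts ∪ g.consts
  | or f g => f.consts ∪ g.consts

def preds : PosForm S X C → Set S.Pred
  | eq _ _ => ∅
  | rel P _ => {P}
  | and f g => f.preds ∪ g.preds
  | or f g => f.preds ∪ g.preds

/-- The truth value of the subformula at a given place; a place is a path from the root. -/
def valueAt (F : Set (Atom S V)) (ι : C → V) (ν : X → V) : PosForm S X C → List Bool → Prop
  | f, [] => f.Sat F ι ν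
  | and f _, true :: l => f.valueAt F ι ν l
  | and _ g, false :: l => g.valueAt F ι ν l
  | or f _, true :: l => f.valueAt F ι ν l
  | or _ g, false :: l => g.valueAt F ι ν l
  | _, _ :: _ => False

theorem valueAt_nil (F : Set (Atom S V)) (ι : C → V) (ν : X → V) (f : PosForm S X C) :
    f.valueAt F ι ν [] ↔ f.Sat F ι ν := by
  cases f <;> simp [valueAt]

end PosForm

/-! ### Datalog programs for positive formulas -/

section Datalog

variable {S K E : Signature} {C T T' V : Type}

/-- The intensional atom with name `n` and the arguments `ts`. -/
def idbAtom (n : ℕ) (ts : List T) : Atom idbSig T := ⟨(n, ts.length), fun i => ts.get i⟩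

theorem idbAtom_map (f : T → T') (n : ℕ) (ts : List T) :
    (idbAtom n ts).map f = idbAtom n (ts.map f) := by
  refine Atom.ext_some ?_ fun k t hk => ?_
  · exact Prod.ext rfl (List.length_map _).symm
  · obtain ⟨u, hu, rfl⟩ := Atom.get_map_eq_some hk
    obtain ⟨h, rfl⟩ := Atom.get_eq_some_iff.1 hu
    have h' : k < ts.length := h
    refine Atom.get_eq_some_iff.2 ⟨?_, ?_⟩
    · change k < (ts.map f).length
      simpa using h'
    · exact List.getElem_map f

theorem mem_vars_idbAtom {n : ℕ} {ts : List T} {t : T} : t ∈ (idbAtom n ts).vars ↔ t ∈ ts := by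
  constructor
  · rintro ⟨i, rfl⟩; exact List.get_mem _ _
  · intro h
    obtain ⟨i, rfl⟩ := List.mem_iff_get.1 h
    exact ⟨i, rfl⟩

/-- The built-in predicates that the rewriting uses. -/
structure Builtins (K : Signature) where
  zero : K.Pred
  one : K.Pred
  neq : K.Pred
  zero_arity : K.arity zero = 1
  one_arity : K.arity one = 1
  neq_arity : K.arity neq = 2

namespace Builtins

variable (b : Builtins K)

def zeroAtom (t : T) : Atom (S.sum K) T := ⟨Sum.inr b.zero, fun _ => t⟩

def oneAtom (t : T) : Atom (S.sum K) T := ⟨Sum.inr b.one, fun _ => t⟩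

def neqAtom (s t : T) : Atom (S.sum K) T :=
  ⟨Sum.inr b.neq, fun i => if i.val = 0 then s else t⟩

theorem neqAtom_map (f : T → T') (s t : T) :
    (b.neqAtom s t : Atom (S.sum K) T).map f = b.neqAtom (f s) (f t) := by
  refine congrArg (Atom.mk _) (funext fun i => ?_)
  simp only [neqAtom]
  split_ifs <;> rfl

theorem mem_vars_zeroAtom {s t : T} : s ∈ (b.zeroAtom t : Atom (S.sum K) T).vars ↔ s = t :=
  ⟨fun ⟨_, h⟩ => h.symm, fun h => ⟨⟨0, by
    change 0 < K.arity b.zero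
    rw [b.zero_arity]; exact Nat.one_pos⟩, h.symm⟩⟩

theorem mem_vars_oneAtom {s t : T} : s ∈ (b.oneAtom t : Atom (S.sum K) T).vars ↔ s = t :=
  ⟨fun ⟨_, h⟩ => h.symm, fun h => ⟨⟨0, by
    change 0 < K.arity b.one
    rw [b.one_arity]; exact Nat.one_pos⟩, h.symm⟩⟩

theorem mem_vars_neqAtom_left {s t : T} : s ∈ (b.neqAtom s t : Atom (S.sum K) T).vars :=
  ⟨⟨0, by
    change 0 < K.arity b.neq
    rw [b.neq_arity]; exact Nat.two_pos⟩, rfl⟩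

theorem eq_or_eq_of_mem_vars_neqAtom {r s t : T}
    (h : r ∈ (b.neqAtom s t : Atom (S.sum K) T).vars) : r = s ∨ r = t := by
  obtain ⟨i, rfl⟩ := h
  simp only [neqAtom]
  split_ifs <;> simp

/-- The set `I` of extensional facts consists, as far as the rewriting is concerned, of the facts
`F` and of the built-in facts for the domain `dom` with the distinguished elements `z` and `o`. -/
structure Interp (I : Set (Atom (S.sum K) V)) (F : Set (Atom S V)) (dom : Set V) (z o : V) :
    Prop where
  zero : ∀ v, b.zeroAtom v ∈ I ↔ v = z
  one : ∀ v, b.oneAtom v ∈ I ↔ v = o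
  neq : ∀ v v', b.neqAtom v v' ∈ I ↔ v ∈ dom ∧ v' ∈ dom ∧ v ≠ v'
  rel : ∀ a : Atom S V, a.inl ∈ I ↔ a ∈ F
  zero_mem : z ∈ dom
  one_mem : o ∈ dom
  ne : z ≠ o
  args_mem : ∀ a ∈ F, ∀ v ∈ a.vars, v ∈ dom

/-- The body atom which asserts that `t` is in the domain. -/
def domBody (t : Term C) : Atom ((S.sum K).sum idbSig) (Term C) := (idbAtom 1 [t]).inr

def zeroBody (t : Term C) : Atom ((S.sum K).sum idbSig) (Term C) := (b.zeroAtom t).inl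

def oneBody (t : Term C) : Atom ((S.sum K).sum idbSig) (Term C) := (b.oneAtom t).inl

/-- The rules of the intensional predicates with the names `1`, `2`, `3`, `4`: membership in the
domain, and the constraints `β → β'`, `β → β' ∨ β''`, `β → x = y` for bits `β`, `β'`, `β''`. -/
def coreRules : Program (S.sum K) C :=
  [⟨idbAtom 1 [.var 0], [(b.neqAtom (.var 0) (.var 1)).inl]⟩,
   ⟨idbAtom 2 [.var 0, .var 1], [b.zeroBody (.var 0), domBody (.var 1)]⟩,
   ⟨idbAtom 2 [.var 0, .var 1], [b.oneBody (.var 0), b.oneBody (.var 1)]⟩,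
   ⟨idbAtom 3 [.var 0, .var 1, .var 2],
      [b.zeroBody (.var 0), domBody (.var 1), domBody (.var 2)]⟩,
   ⟨idbAtom 3 [.var 0, .var 1, .var 2],
      [b.oneBody (.var 0), b.oneBody (.var 1), domBody (.var 2)]⟩,
   ⟨idbAtom 3 [.var 0, .var 1, .var 2],
      [b.oneBody (.var 0), domBody (.var 1), b.oneBody (.var 2)]⟩,
   ⟨idbAtom 4 [.var 0, .var 1, .var 2],
      [b.zeroBody (.var 0), domBody (.var 1), domBody (.var 2)]⟩,
   ⟨idbAtom 4 [.var 0, .var 1, .var 1], [b.oneBody (.var 0), domBody (.var 1)]⟩]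

/-- The head of the rules of the constraint `β → P(x₁, …, xₖ)`. -/
def relHead (idx : S.Pred → ℕ) (P : S.Pred) : Atom idbSig (Term C) :=
  idbAtom (idx P + 5) (.var 0 :: List.ofFn fun k : Fin (S.arity P) => .var (k + 1))

/-- The rules of the constraint `β → P(x₁, …, xₖ)`. -/
def relRules (idx : S.Pred → ℕ) (P : S.Pred) : Program (S.sum K) C :=
  [⟨relHead idx P,
      b.zeroBody (.var 0) :: List.ofFn fun k : Fin (S.arity P) => domBody (.var (k + 1))⟩,
   ⟨relHead idx P,
      [b.oneBody (.var 0), (Atom.mk P fun k => Term.var (k + 1)).inl.inl]⟩]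

end Builtins

namespace PosForm

variable {X : Type}

def toTerm (vn : X → ℕ) : X ⊕ C → Term C := Sum.elim (fun x => .var (vn x)) .const

/-- The constraints that express a formula. Each subformula has a bit, a variable whose value is
`1` only if the subformula is true; `ρ` names the bits by the places of the subformulas. -/
def compile (vn : X → ℕ) (idx : S.Pred → ℕ) :
    PosForm S X C → (List Bool → ℕ) → List (Atom idbSig (Term C))
  | eq s t, ρ => [idbAtom 4 [.var (ρ []), toTerm vn s, toTerm vn t]]
  | rel P args, ρ =>
      [idbAtom (idx P + 5) (.var (ρ []) :: List.ofFn fun k => .var (vn (args k)))]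
  | and f g, ρ => idbAtom 2 [.var (ρ []), .var (ρ [true])] ::
      idbAtom 2 [.var (ρ []), .var (ρ [false])] ::
      (f.compile vn idx (fun l => ρ (true :: l)) ++ g.compile vn idx (fun l => ρ (false :: l)))
  | or f g, ρ => idbAtom 3 [.var (ρ []), .var (ρ [true]), .var (ρ [false])] ::
      (f.compile vn idx (fun l => ρ (true :: l)) ++ g.compile vn idx (fun l => ρ (false :: l)))

/-- The rule for the goal: it asserts the extensional atoms `ext` and that `f` is true. -/
def mainRule (b : Builtins K) (vn : X → ℕ) (idx : S.Pred → ℕ) (ρ : List Bool → ℕ)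
    (ext : List (Atom (S.sum K) (X ⊕ C))) (f : PosForm S X C) : Rule (S.sum K) C where
  head := idbAtom 0 []
  body := b.oneBody (.var (ρ [])) :: (ext.map (fun a => (a.map (toTerm vn)).inl) ++
    (f.compile vn idx ρ).map Atom.inr)

/-- The Datalog program that expresses the conjunction of the atoms `ext` and of `f`. The list `Ps`
contains the predicates of `f`. -/
def program (b : Builtins K) (vn : X → ℕ) (idx : S.Pred → ℕ) (ρ : List Bool → ℕ)
    (Ps : List S.Pred) (ext : List (Atom (S.sum K) (X ⊕ C))) (f : PosForm S X C) :
    Program (S.sum K) C :=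
  mainRule b vn idx ρ ext f :: (b.coreRules ++ Ps.flatMap (b.relRules idx))

end PosForm

/-! ### Correctness of the programs -/

section Correctness

variable {X : Type} {b : Builtins K} {vn : X → ℕ} {idx : S.Pred → ℕ} {ρ : List Bool → ℕ}
  {Ps : List S.Pred} {ext : List (Atom (S.sum K) (X ⊕ C))} {f : PosForm S X C}
  {I : Set (Atom (S.sum K) V)} {F : Set (Atom S V)} {dom : Set V} {z o : V} {ι : C → V}

/-- The intended meaning of the intensional predicates; `G` is that of the goal. -/
def IdbMeaning (G : Prop) (F : Set (Atom S V)) (dom : Set V) (o : V) (idx : S.Pred → ℕ) :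
    ℕ → List V → Prop
  | 0, _ => G
  | 1, [x] => x ∈ dom
  | 2, [β, β'] => β = o → β' = o
  | 3, [β, β', β''] => β = o → β' = o ∨ β'' = o
  | 4, [β, x, y] => β = o → x = y
  | n + 5, β :: xs => β = o → ∀ (P : S.Pred) (args : Fin (S.arity P) → V), idx P = n →
      List.ofFn args = xs → (⟨P, args⟩ : Atom S V) ∈ F
  | _, _ => True

/-- The intended meaning of all predicates of a program. -/
def AtomMeaning (G : Prop) (I : Set (Atom (S.sum K) V)) (F : Set (Atom S V)) (dom : Set V) (o : V)
    (idx : S.Pred → ℕ) : Atom ((S.sum K).sum idbSig) V → Prop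
  | ⟨.inl p, args⟩ => (⟨p, args⟩ : Atom (S.sum K) V) ∈ I
  | ⟨.inr p, args⟩ => IdbMeaning G F dom o idx p.1 (List.ofFn (n := p.2) args)

theorem atomMeaning_idbAtom {G : Prop} (n : ℕ) (ts : List V) :
    AtomMeaning G I F dom o idx (idbAtom n ts).inr ↔ IdbMeaning G F dom o idx n ts := by
  change IdbMeaning G F dom o idx n (List.ofFn fun i : Fin ts.length => ts.get i) ↔ _
  rw [List.ofFn_get]

theorem atomMeaning_idbAtom_map {G : Prop} (e : Term C → V) (n : ℕ) (ts : List (Term C)) :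
    AtomMeaning G I F dom o idx ((idbAtom n ts).inr.map e) ↔
      IdbMeaning G F dom o idx n (ts.map e) := by
  rw [← atomMeaning_idbAtom, ← idbAtom_map]; rfl

theorem eval_toTerm (ι : C → V) (μ : ℕ → V) (t : X ⊕ C) :
    (PosForm.toTerm vn t).eval ι μ = Sum.elim (fun x => μ (vn x)) ι t := by
  cases t <;> rfl

/-- If the constraints have their intended meaning and the bit of the formula is `1`, then the
formula is true. -/
theorem PosForm.sat_of_compile {G : Prop} (μ : ℕ → V) (f : PosForm S X C) :
    ∀ ρ : List Bool → ℕ, (∀ a ∈ f.compile vn idx ρ,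
      AtomMeaning G I F dom o idx (a.inr.map (Term.eval ι μ))) → μ (ρ []) = o →
      f.Sat F ι fun x => μ (vn x) := by
  induction f with
  | eq s t =>
    intro ρ h h0
    have := h _ List.mem_cons_self
    rw [atomMeaning_idbAtom_map] at this
    have := this h0
    rwa [eval_toTerm, eval_toTerm] at this
  | rel P args =>
    intro ρ h h0
    have := h _ List.mem_cons_self
    rw [atomMeaning_idbAtom_map] at this
    exact this h0 P _ rfl (by rw [List.map_ofFn]; rfl)
  | and f g ihf ihg =>
    intro ρ h h0
    simp only [compile, List.mem_cons, List.mem_append, forall_eq_or_imp] at h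
    obtain ⟨h1, h2, h3⟩ := h
    rw [atomMeaning_idbAtom_map] at h1 h2
    exact ⟨ihf _ (fun a ha => h3 a (Or.inl ha)) (h1 h0),
      ihg _ (fun a ha => h3 a (Or.inr ha)) (h2 h0)⟩
  | or f g ihf ihg =>
    intro ρ h h0
    simp only [compile, List.mem_cons, List.mem_append, forall_eq_or_imp] at h
    obtain ⟨h1, h3⟩ := h
    rw [atomMeaning_idbAtom_map] at h1
    exact (h1 h0).imp (ihf _ fun a ha => h3 a (Or.inl ha)) (ihg _ fun a ha => h3 a (Or.inr ha))

/-- Derivable atoms are true in the intended meaning, by induction on the derivation. -/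
theorem Builtins.Interp.atomMeaning (hI : b.Interp I F dom z o) (hidx : Function.Injective idx)
    {a : Atom ((S.sum K).sum idbSig) V}
    (h : (PosForm.program b vn idx ρ Ps ext f).Derives ι I a) :
    AtomMeaning (∃ ν : X → V, (∀ a ∈ ext, a.map (Sum.elim ν ι) ∈ I) ∧ f.Sat F ι ν)
      I F dom o idx a := by
  induction h with
  | edb ha => exact ha
  | @rule r hr μ hb ih =>
    clear hb
    set G := ∃ ν : X → V, (∀ a ∈ ext, a.map (Sum.elim ν ι) ∈ I) ∧ f.Sat F ι ν with hG
    have hz : ∀ t : Term C, AtomMeaning G I F dom o idx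
        ((b.zeroBody t).map (Term.eval ι μ)) → t.eval ι μ ≠ o := by
      intro t ht
      rw [(hI.zero (t.eval ι μ)).1 ht]
      exact hI.ne
    have ho : ∀ t : Term C, AtomMeaning G I F dom o idx
        ((b.oneBody t).map (Term.eval ι μ)) → t.eval ι μ = o := fun t ht =>
      (hI.one (t.eval ι μ)).1 ht
    rcases List.mem_cons.1 hr with rfl | hr
    · change AtomMeaning G I F dom o idx ((idbAtom 0 []).inr.map (Term.eval ι μ))
      rw [atomMeaning_idbAtom_map]
      refine ⟨fun x => μ (vn x), fun a ha => ?_, ?_⟩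
      · have := ih (a.map (PosForm.toTerm vn)).inl
          (List.mem_cons_of_mem _ (List.mem_append_left _ (List.mem_map.2 ⟨a, ha, rfl⟩)))
        change (a.map (PosForm.toTerm vn)).map (Term.eval ι μ) ∈ I at this
        rw [Atom.map_map] at this
        convert this using 1
        exact Atom.map_congr fun t _ => (eval_toTerm ι μ t).symm
      · refine PosForm.sat_of_compile (G := G) (I := I) (dom := dom) (o := o) (idx := idx) μ f ρ
          (fun a ha => ?_) (ho (.var (ρ [])) (ih _ List.mem_cons_self))
        exact ih a.inr (List.mem_cons_of_mem _ (List.mem_append_right _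
          (List.mem_map.2 ⟨a, ha, rfl⟩)))
    rcases List.mem_append.1 hr with hr | hr
    · simp only [Builtins.coreRules, List.mem_cons, List.not_mem_nil, or_false] at hr
      rcases hr with rfl | rfl | rfl | rfl | rfl | rfl | rfl | rfl
      all_goals
        simp only [List.mem_cons, List.not_mem_nil, or_false, forall_eq_or_imp, forall_eq] at ih
        refine (atomMeaning_idbAtom_map (Term.eval ι μ) _ _).2 ?_
        simp only [List.map_cons, List.map_nil, IdbMeaning]
      · change (b.neqAtom (.var 0) (.var 1) : Atom (S.sum K) (Term C)).map _ ∈ I at ih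
        rw [b.neqAtom_map, hI.neq] at ih
        exact ih.1
      · exact fun h => (hz _ ih.1 h).elim
      · exact fun _ => ho _ ih.2
      · exact fun h => (hz _ ih.1 h).elim
      · exact fun _ => Or.inl (ho _ ih.2.1)
      · exact fun _ => Or.inr (ho _ ih.2.2)
      · exact fun h => (hz _ ih.1 h).elim
      · exact fun _ => trivial
    · obtain ⟨P, -, hr⟩ := List.mem_flatMap.1 hr
      simp only [Builtins.relRules, List.mem_cons, List.not_mem_nil, or_false] at hr
      rcases hr with rfl | rfl
      · refine (atomMeaning_idbAtom_map (Term.eval ι μ) _ _).2 ?_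
        exact fun h => (hz _ (ih _ List.mem_cons_self) h).elim
      · refine (atomMeaning_idbAtom_map (Term.eval ι μ) _ _).2 ?_
        rintro - P' args hP' hargs
        obtain rfl := hidx hP'
        rw [List.map_ofFn] at hargs
        have e := List.ofFn_injective hargs
        have := ih _ (List.mem_cons_of_mem _ List.mem_cons_self)
        rw [e]
        exact (hI.rel _).1 this

/-- Soundness of the program of a formula. -/
theorem PosForm.exists_sat_of_holds (hI : b.Interp I F dom z o) (hidx : Function.Injective idx)
    (h : (PosForm.program b vn idx ρ Ps ext f).Holds ι I) :
    ∃ ν : X → V, (∀ a ∈ ext, a.map (Sum.elim ν ι) ∈ I) ∧ f.Sat F ι ν :=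
  hI.atomMeaning hidx h

theorem derives_idbAtom {P : Program E C} {I : Set (Atom E V)} {n : ℕ} {ts : List (Term C)}
    {body : List (Atom (E.sum idbSig) (Term C))} (hr : ⟨idbAtom n ts, body⟩ ∈ P) (μ : ℕ → V)
    (hb : ∀ a ∈ body, P.Derives ι I (a.map (Term.eval ι μ))) :
    P.Derives ι I (idbAtom n (ts.map (Term.eval ι μ))).inr := by
  have := Program.Derives.rule hr μ hb
  rwa [idbAtom_map] at this

open Classical in
/-- The bit that represents a truth value. -/
noncomputable def bitOf (z o : V) (p : Prop) : V := if p then o else z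

theorem bitOf_of_true {z o : V} {p : Prop} (h : p) : bitOf z o p = o := if_pos h

theorem bitOf_of_false {z o : V} {p : Prop} (h : ¬ p) : bitOf z o p = z := if_neg h

namespace Builtins.Interp

variable {P : Program (S.sum K) C}

theorem bitOf_mem (hI : b.Interp I F dom z o) (p : Prop) : bitOf z o p ∈ dom := by
  by_cases h : p
  · rw [bitOf_of_true h]; exact hI.one_mem
  · rw [bitOf_of_false h]; exact hI.zero_mem

theorem derives_zero (hI : b.Interp I F dom z o) {μ : ℕ → V} {t : Term C}
    (h : t.eval ι μ = z) : P.Derives ι I ((b.zeroBody t).map (Term.eval ι μ)) :=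
  Program.Derives.edb ((hI.zero (t.eval ι μ)).2 h)

theorem derives_one (hI : b.Interp I F dom z o) {μ : ℕ → V} {t : Term C}
    (h : t.eval ι μ = o) : P.Derives ι I ((b.oneBody t).map (Term.eval ι μ)) :=
  Program.Derives.edb ((hI.one (t.eval ι μ)).2 h)

theorem derives_dom (hI : b.Interp I F dom z o) (hP : b.coreRules ⊆ P) {v : V} (hv : v ∈ dom) :
    P.Derives ι I (idbAtom 1 [v]).inr := by
  classical
  -- some element of the domain differs from `v`
  obtain ⟨v', hv', hne⟩ : ∃ v' ∈ dom, v ≠ v' := by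
    by_cases h : v = z
    · exact ⟨o, hI.one_mem, h ▸ hI.ne⟩
    · exact ⟨z, hI.zero_mem, h⟩
  refine derives_idbAtom (hP (a := ⟨idbAtom 1 [.var 0], _⟩) List.mem_cons_self)
    (fun n => if n = 0 then v else v') fun a ha => ?_
  obtain rfl := List.mem_singleton.1 ha
  refine Program.Derives.edb (a := (b.neqAtom (.var 0) (.var 1) :
    Atom (S.sum K) (Term C)).map (Term.eval ι fun n => if n = 0 then v else v')) ?_
  rw [b.neqAtom_map]
  exact (hI.neq _ _).2 ⟨hv, hv', hne⟩

theorem derives_domBody (hI : b.Interp I F dom z o) (hP : b.coreRules ⊆ P) {μ : ℕ → V}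
    {t : Term C} (ht : t.eval ι μ ∈ dom) :
    P.Derives ι I ((domBody t : Atom ((S.sum K).sum idbSig) (Term C)).map (Term.eval ι μ)) := by
  have := hI.derives_dom (ι := ι) hP ht
  have e : (idbAtom 1 [t]).map (Term.eval ι μ) = idbAtom 1 [t.eval ι μ] := idbAtom_map _ _ _
  rw [← e] at this
  exact this

theorem derives_and (hI : b.Interp I F dom z o) (hP : b.coreRules ⊆ P) {p p' : Prop}
    (h : p → p') : P.Derives ι I (idbAtom 2 [bitOf z o p, bitOf z o p']).inr := by
  by_cases hp : p
  · refine derives_idbAtom (body := [b.oneBody (.var 0), b.oneBody (.var 1)])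
      (ts := [.var 0, .var 1])
      (hP (by simp [coreRules])) (fun n => if n = 0 then bitOf z o p else bitOf z o p') ?_
    simp only [List.forall_mem_cons, List.not_mem_nil, false_imp_iff, implies_true, and_true]
    exact ⟨hI.derives_one (bitOf_of_true hp), hI.derives_one (bitOf_of_true (h hp))⟩
  · refine derives_idbAtom (body := [b.zeroBody (.var 0), domBody (.var 1)])
      (ts := [.var 0, .var 1])
      (hP (by simp [coreRules])) (fun n => if n = 0 then bitOf z o p else bitOf z o p') ?_
    simp only [List.forall_mem_cons, List.not_mem_nil, false_imp_iff, implies_true, and_true]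
    exact ⟨hI.derives_zero (bitOf_of_false hp), hI.derives_domBody hP (hI.bitOf_mem p')⟩

theorem derives_or (hI : b.Interp I F dom z o) (hP : b.coreRules ⊆ P) {p p' p'' : Prop}
    (h : p → p' ∨ p'') :
    P.Derives ι I (idbAtom 3 [bitOf z o p, bitOf z o p', bitOf z o p'']).inr := by
  let μ : ℕ → V := fun n =>
    if n = 0 then bitOf z o p else if n = 1 then bitOf z o p' else bitOf z o p''
  by_cases hp : p
  · rcases h hp with hp' | hp'
    · refine derives_idbAtom (body := [b.oneBody (.var 0), b.oneBody (.var 1), domBody (.var 2)])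
        (ts := [.var 0, .var 1, .var 2]) (hP (by simp [coreRules])) μ ?_
      simp only [List.forall_mem_cons, List.not_mem_nil, false_imp_iff, implies_true, and_true]
      exact ⟨hI.derives_one (bitOf_of_true hp), hI.derives_one (bitOf_of_true hp'),
        hI.derives_domBody hP (hI.bitOf_mem p'')⟩
    · refine derives_idbAtom (body := [b.oneBody (.var 0), domBody (.var 1), b.oneBody (.var 2)])
        (ts := [.var 0, .var 1, .var 2]) (hP (by simp [coreRules])) μ ?_
      simp only [List.forall_mem_cons, List.not_mem_nil, false_imp_iff, implies_true, and_true]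
      exact ⟨hI.derives_one (bitOf_of_true hp), hI.derives_domBody hP (hI.bitOf_mem p'),
        hI.derives_one (bitOf_of_true hp')⟩
  · refine derives_idbAtom (body := [b.zeroBody (.var 0), domBody (.var 1), domBody (.var 2)])
      (ts := [.var 0, .var 1, .var 2]) (hP (by simp [coreRules])) μ ?_
    simp only [List.forall_mem_cons, List.not_mem_nil, false_imp_iff, implies_true, and_true]
    exact ⟨hI.derives_zero (bitOf_of_false hp), hI.derives_domBody hP (hI.bitOf_mem p'),
      hI.derives_domBody hP (hI.bitOf_mem p'')⟩

theorem derives_eq (hI : b.Interp I F dom z o) (hP : b.coreRules ⊆ P) {p : Prop} {x y : V}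
    (hx : x ∈ dom) (hy : y ∈ dom) (h : p → x = y) :
    P.Derives ι I (idbAtom 4 [bitOf z o p, x, y]).inr := by
  by_cases hp : p
  · obtain rfl := h hp
    refine derives_idbAtom (body := [b.oneBody (.var 0), domBody (.var 1)])
      (ts := [.var 0, .var 1, .var 1]) (hP (by simp [coreRules]))
      (fun n => if n = 0 then bitOf z o p else x) ?_
    simp only [List.forall_mem_cons, List.not_mem_nil, false_imp_iff, implies_true, and_true]
    exact ⟨hI.derives_one (bitOf_of_true hp), hI.derives_domBody hP hx⟩
  · refine derives_idbAtom (body := [b.zeroBody (.var 0), domBody (.var 1), domBody (.var 2)])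
      (ts := [.var 0, .var 1, .var 2]) (hP (by simp [coreRules]))
      (fun n => if n = 0 then bitOf z o p else if n = 1 then x else y) ?_
    simp only [List.forall_mem_cons, List.not_mem_nil, false_imp_iff, implies_true, and_true]
    exact ⟨hI.derives_zero (bitOf_of_false hp), hI.derives_domBody hP hx,
      hI.derives_domBody hP hy⟩

theorem derives_rel (hI : b.Interp I F dom z o) (hP : b.coreRules ⊆ P) {Q : S.Pred}
    (hQ : b.relRules idx Q ⊆ P) {p : Prop} {args : Fin (S.arity Q) → V}
    (hargs : ∀ k, args k ∈ dom) (h : p → (⟨Q, args⟩ : Atom S V) ∈ F) :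
    P.Derives ι I (idbAtom (idx Q + 5) (bitOf z o p :: List.ofFn args)).inr := by
  let μ : ℕ → V := fun n =>
    if n = 0 then bitOf z o p else if h : n - 1 < S.arity Q then args ⟨n - 1, h⟩ else z
  have hμ : ∀ k : Fin (S.arity Q), μ (k + 1) = args k := by
    intro k
    simp [μ]
  have e : (Term.var 0 :: List.ofFn fun k : Fin (S.arity Q) => Term.var (k + 1)).map
      (Term.eval ι μ) = bitOf z o p :: List.ofFn args := by
    rw [List.map_cons, List.map_ofFn]
    exact congrArg _ (congrArg List.ofFn (funext hμ))
  rw [← e]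
  by_cases hp : p
  · refine derives_idbAtom (hQ (List.mem_cons_of_mem _ List.mem_cons_self)) μ ?_
    simp only [List.forall_mem_cons, List.not_mem_nil, false_imp_iff, implies_true, and_true]
    refine ⟨hI.derives_one (bitOf_of_true hp), Program.Derives.edb (a := Atom.inl ⟨Q, _⟩)
      ((hI.rel _).2 ?_)⟩
    convert h hp using 1
    exact congrArg (Atom.mk Q) (funext hμ)
  · refine derives_idbAtom (hQ List.mem_cons_self) μ ?_
    simp only [List.forall_mem_cons]
    refine ⟨hI.derives_zero (bitOf_of_false hp), fun a ha => ?_⟩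
    obtain ⟨k, rfl⟩ := (List.mem_ofFn' _ _).1 ha
    refine hI.derives_domBody hP ?_
    change μ (k + 1) ∈ dom
    rw [hμ]
    exact hargs k

end Builtins.Interp

/-- The constraints of a formula are derivable if each bit has the value of its subformula. -/
theorem PosForm.derives_compile {P : Program (S.sum K) C} (hI : b.Interp I F dom z o)
    (hP : b.coreRules ⊆ P) {ν : X → V} {μ : ℕ → V} (hν : ∀ x, ν x ∈ dom)
    (hμ : ∀ x, μ (vn x) = ν x) (f : PosForm S X C) :
    ∀ ρ : List Bool → ℕ, (∀ l, μ (ρ l) = bitOf z o (f.valueAt F ι ν l)) →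
      (∀ c ∈ f.consts, ι c ∈ dom) → (∀ Q ∈ f.preds, b.relRules idx Q ⊆ P) →
      ∀ a ∈ f.compile vn idx ρ, P.Derives ι I (a.map (Term.eval ι μ)).inr := by
  have hvar : ∀ n, (Term.var n : Term C).eval ι μ = μ n := fun _ => rfl
  have hterm : ∀ t : X ⊕ C, (toTerm vn t).eval ι μ = Sum.elim ν ι t := by
    intro t
    rw [eval_toTerm]
    congr 1
    exact funext hμ
  induction f with
  | eq s t =>
    intro ρ hρ hc _ a ha
    obtain rfl := List.mem_singleton.1 ha
    rw [idbAtom_map]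
    simp only [List.map_cons, List.map_nil, hvar, hterm, hρ]
    have hdom : ∀ u : X ⊕ C, (u = s ∨ u = t) → Sum.elim ν ι u ∈ dom := by
      rintro (x | c) hu
      · exact hν x
      · exact hc c (hu.imp Eq.symm Eq.symm)
    exact hI.derives_eq hP (hdom s (Or.inl rfl)) (hdom t (Or.inr rfl)) id
  | rel Q args =>
    intro ρ hρ _ hQ a ha
    obtain rfl := List.mem_singleton.1 ha
    rw [idbAtom_map, List.map_cons, List.map_ofFn, hvar, hρ]
    refine hI.derives_rel hP (hQ Q rfl) (fun k => ?_) (fun h => ?_)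
    · change μ (vn (args k)) ∈ dom
      rw [hμ]; exact hν _
    · have h' : (⟨Q, fun k => ν (args k)⟩ : Atom S V) ∈ F := (valueAt_nil _ _ _ (rel Q args)).1 h
      convert h' using 1
      exact congrArg (Atom.mk Q) (funext fun k => hμ (args k))
  | and f g ihf ihg =>
    intro ρ hρ hc hQ a ha
    simp only [compile, List.mem_cons, List.mem_append] at ha
    rcases ha with rfl | rfl | ha | ha
    · rw [idbAtom_map]
      simp only [List.map_cons, List.map_nil, hvar, hρ]
      exact hI.derives_and hP fun h => (valueAt_nil _ _ _ f).2 h.1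
    · rw [idbAtom_map]
      simp only [List.map_cons, List.map_nil, hvar, hρ]
      exact hI.derives_and hP fun h => (valueAt_nil _ _ _ g).2 h.2
    · exact ihf _ (fun l => hρ (true :: l)) (fun c h => hc c (Or.inl h))
        (fun Q h => hQ Q (Or.inl h)) a ha
    · exact ihg _ (fun l => hρ (false :: l)) (fun c h => hc c (Or.inr h))
        (fun Q h => hQ Q (Or.inr h)) a ha
  | or f g ihf ihg =>
    intro ρ hρ hc hQ a ha
    simp only [compile, List.mem_cons, List.mem_append] at ha
    rcases ha with rfl | ha | ha
    · rw [idbAtom_map]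
      simp only [List.map_cons, List.map_nil, hvar, hρ]
      exact hI.derives_or hP fun h => Or.imp (valueAt_nil _ _ _ f).2 (valueAt_nil _ _ _ g).2 h
    · exact ihf _ (fun l => hρ (true :: l)) (fun c h => hc c (Or.inl h))
        (fun Q h => hQ Q (Or.inl h)) a ha
    · exact ihg _ (fun l => hρ (false :: l)) (fun c h => hc c (Or.inr h))
        (fun Q h => hQ Q (Or.inr h)) a ha

/-- Completeness of the program of a formula. -/
theorem PosForm.holds_of_sat (hI : b.Interp I F dom z o) (hn : Function.Injective (Sum.elim vn ρ))
    {ν : X → V} (hν : ∀ x, ν x ∈ dom) (hc : ∀ c ∈ f.consts, ι c ∈ dom)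
    (hPs : ∀ Q ∈ f.preds, Q ∈ Ps) (hext : ∀ a ∈ ext, a.map (Sum.elim ν ι) ∈ I)
    (hf : f.Sat F ι ν) : (PosForm.program b vn idx ρ Ps ext f).Holds ι I := by
  have hne : Nonempty (X ⊕ List Bool) := ⟨Sum.inr []⟩
  let val : X ⊕ List Bool → V := Sum.elim ν fun l => bitOf z o (f.valueAt F ι ν l)
  let μ : ℕ → V := fun n => val (Function.invFun (Sum.elim vn ρ) n)
  have hμv : ∀ x, μ (vn x) = ν x := fun x =>
    congrArg val (Function.leftInverse_invFun hn (Sum.inl x))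
  have hμρ : ∀ l, μ (ρ l) = bitOf z o (f.valueAt F ι ν l) := fun l =>
    congrArg val (Function.leftInverse_invFun hn (Sum.inr l))
  have := derives_idbAtom (P := PosForm.program b vn idx ρ Ps ext f) (I := I) (ι := ι)
    (n := 0) (ts := []) (List.mem_cons_self) μ ?_
  · have e : (idbAtom 0 (List.map (Term.eval ι μ) [])) = Program.goal V :=
      congrArg (Atom.mk _) (funext fun i => i.elim0)
    rwa [e] at this
  · intro a ha
    rcases List.mem_cons.1 ha with rfl | ha
    · refine hI.derives_one ?_
      change μ (ρ []) = o
      rw [hμρ]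
      exact bitOf_of_true ((valueAt_nil _ _ _ f).2 hf)
    rcases List.mem_append.1 ha with ha | ha
    · obtain ⟨a, ha', rfl⟩ := List.mem_map.1 ha
      refine Program.Derives.edb (a := (a.map (toTerm vn)).map (Term.eval ι μ)) ?_
      convert hext a ha' using 1
      rw [Atom.map_map]
      refine Atom.map_congr fun t _ => ?_
      rw [eval_toTerm]
      congr 1
      exact funext hμv
    · obtain ⟨a, ha', rfl⟩ := List.mem_map.1 ha
      refine PosForm.derives_compile hI ?_ hν hμv f ρ hμρ hc ?_ a ha'
      · exact fun r hr => List.mem_cons_of_mem _ (List.mem_append_left _ hr)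
      · exact fun Q hQ r hr => List.mem_cons_of_mem _ (List.mem_append_right _
          (List.mem_flatMap.2 ⟨Q, hPs Q hQ, hr⟩))

end Correctness

end Datalog


/-! ### Syntactic properties of the programs -/

section ProgramProperties

variable {S K : Signature} {C X : Type} {b : Builtins K} {vn : X → ℕ} {idx : S.Pred → ℕ}
  {ρ : List Bool → ℕ} {Ps : List S.Pred} {ext : List (Atom (S.sum K) (X ⊕ C))}
  {f : PosForm S X C}

/-- The shape of the constraints of a formula. -/
theorem PosForm.mem_compile (f : PosForm S X C) : ∀ ρ : List Bool → ℕ,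
    ∀ a ∈ f.compile vn idx ρ, ∃ n ts, a = idbAtom n ts ∧ 2 ≤ n ∧
      (ts.length ≤ 3 ∨ ∃ Q ∈ f.preds, ts.length = S.arity Q + 1) ∧
      ∀ c, Term.const c ∈ ts → c ∈ f.consts := by
  induction f with
  | eq s t =>
    intro ρ a ha
    obtain rfl := List.mem_singleton.1 ha
    refine ⟨_, _, rfl, by omega, Or.inl le_rfl, fun c hc => ?_⟩
    simp only [List.mem_cons, List.not_mem_nil, or_false, reduceCtorEq, false_or] at hc
    rcases s with x | c' <;> rcases t with y | c'' <;>
      simp_all [consts, toTerm, eq_comm]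
  | rel P args =>
    intro ρ a ha
    obtain rfl := List.mem_singleton.1 ha
    refine ⟨_, _, rfl, by omega, Or.inr ⟨P, rfl, by simp⟩, fun c hc => ?_⟩
    simp at hc
  | and f g ihf ihg =>
    intro ρ a ha
    simp only [compile, List.mem_cons, List.mem_append] at ha
    rcases ha with rfl | rfl | ha | ha
    · exact ⟨_, _, rfl, by omega, Or.inl (by simp), fun c hc => by simp at hc⟩
    · exact ⟨_, _, rfl, by omega, Or.inl (by simp), fun c hc => by simp at hc⟩
    · obtain ⟨n, ts, e, hn, hl, hc⟩ := ihf _ a ha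
      exact ⟨n, ts, e, hn, hl.imp_right fun ⟨Q, hQ, h⟩ => ⟨Q, Or.inl hQ, h⟩,
        fun c h => Or.inl (hc c h)⟩
    · obtain ⟨n, ts, e, hn, hl, hc⟩ := ihg _ a ha
      exact ⟨n, ts, e, hn, hl.imp_right fun ⟨Q, hQ, h⟩ => ⟨Q, Or.inr hQ, h⟩,
        fun c h => Or.inr (hc c h)⟩
  | or f g ihf ihg =>
    intro ρ a ha
    simp only [compile, List.mem_cons, List.mem_append] at ha
    rcases ha with rfl | ha | ha
    · exact ⟨_, _, rfl, by omega, Or.inl (by simp), fun c hc => by simp at hc⟩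
    · obtain ⟨n, ts, e, hn, hl, hc⟩ := ihf _ a ha
      exact ⟨n, ts, e, hn, hl.imp_right fun ⟨Q, hQ, h⟩ => ⟨Q, Or.inl hQ, h⟩,
        fun c h => Or.inl (hc c h)⟩
    · obtain ⟨n, ts, e, hn, hl, hc⟩ := ihg _ a ha
      exact ⟨n, ts, e, hn, hl.imp_right fun ⟨Q, hQ, h⟩ => ⟨Q, Or.inr hQ, h⟩,
        fun c h => Or.inr (hc c h)⟩

theorem size_idbAtom {T : Type} (n : ℕ) (ts : List T) : (idbAtom n ts).size = ts.length + 1 := rfl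

theorem PosForm.size_compile (f : PosForm S X C) : ∀ ρ : List Bool → ℕ,
    ((f.compile vn idx ρ).map Atom.size).sum = f.size := by
  induction f with
  | eq s t => intro ρ; rfl
  | rel P args =>
    intro ρ
    simp [compile, size_idbAtom, size]
  | and f g ihf ihg =>
    intro ρ
    simp only [compile, List.map_cons, List.map_append, List.sum_cons, List.sum_append, ihf, ihg,
      size_idbAtom, size, List.length_cons, List.length_nil]
    omega
  | or f g ihf ihg =>
    intro ρ
    simp only [compile, List.map_cons, List.map_append, List.sum_cons, List.sum_append, ihf, ihg,
      size_idbAtom, size, List.length_cons, List.length_nil]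
    omega

theorem PosForm.mem_program {r : Rule (S.sum K) C} :
    r ∈ PosForm.program b vn idx ρ Ps ext f ↔ r = PosForm.mainRule b vn idx ρ ext f ∨
      r ∈ b.coreRules ∨ ∃ Q ∈ Ps, r ∈ b.relRules idx Q := by
  simp [PosForm.program]

theorem PosForm.program_safe : (PosForm.program b vn idx ρ Ps ext f).Safe := by
  intro r hr x hx
  have hdom : ∀ y, (Term.var y : Term C) ∈ (Builtins.domBody (.var y) :
      Atom ((S.sum K).sum idbSig) (Term C)).vars := fun y =>
    mem_vars_idbAtom.2 List.mem_cons_self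
  have hzero : ∀ y, (Term.var y : Term C) ∈ (b.zeroBody (.var y) :
      Atom ((S.sum K).sum idbSig) (Term C)).vars := fun y => b.mem_vars_zeroAtom.2 rfl
  have hone : ∀ y, (Term.var y : Term C) ∈ (b.oneBody (.var y) :
      Atom ((S.sum K).sum idbSig) (Term C)).vars := fun y => b.mem_vars_oneAtom.2 rfl
  rcases PosForm.mem_program.1 hr with rfl | hr | ⟨Q, -, hr⟩
  · exact absurd (mem_vars_idbAtom.1 hx) (by simp)
  · simp only [Builtins.coreRules, List.mem_cons, List.not_mem_nil, or_false] at hr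
    rcases hr with rfl | rfl | rfl | rfl | rfl | rfl | rfl | rfl
    all_goals
      have hx' := mem_vars_idbAtom.1 hx
      simp only [List.mem_cons, List.not_mem_nil, or_false, Term.var.injEq] at hx'
      simp only [List.mem_cons, List.not_mem_nil, or_false, exists_eq_or_imp, exists_eq_left]
    · subst hx'; exact b.mem_vars_neqAtom_left
    all_goals
      rcases hx' with rfl | rfl | rfl <;> simp only [hdom, hzero, hone, true_or, or_true]
  · simp only [Builtins.relRules, List.mem_cons, List.not_mem_nil, or_false] at hr
    rcases hr with rfl | rfl
    all_goals
      have hx' := mem_vars_idbAtom.1 hx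
      rcases List.mem_cons.1 hx' with e | hx'
    · cases e; exact ⟨_, List.mem_cons_self, hzero 0⟩
    · obtain ⟨k, e⟩ := (List.mem_ofFn' _ _).1 hx'
      cases e
      exact ⟨_, List.mem_cons_of_mem _ ((List.mem_ofFn' _ _).2 ⟨k, rfl⟩), hdom _⟩
    · cases e; exact ⟨_, List.mem_cons_self, hone 0⟩
    · obtain ⟨k, e⟩ := (List.mem_ofFn' _ _).1 hx'
      cases e
      exact ⟨_, List.mem_cons_of_mem _ List.mem_cons_self, ⟨k, rfl⟩⟩

/-- The intensional predicate symbols of the bodies, with the rules they occur in. -/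
theorem PosForm.idb_of_mem_body {r : Rule (S.sum K) C}
    (hr : r ∈ PosForm.program b vn idx ρ Ps ext f) {a : Atom ((S.sum K).sum idbSig) (Term C)}
    (ha : a ∈ r.body) {p : ℕ × ℕ} (hp : a.pred = Sum.inr p) :
    (r = PosForm.mainRule b vn idx ρ ext f ∧ ∃ a' ∈ f.compile vn idx ρ, a'.pred = p) ∨
      (2 ≤ r.head.pred.1 ∧ p = (1, 1)) := by
  rcases PosForm.mem_program.1 hr with rfl | hr | ⟨Q, -, hr⟩
  · left
    refine ⟨rfl, ?_⟩
    rcases List.mem_cons.1 ha with rfl | ha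
    · cases hp
    rcases List.mem_append.1 ha with ha | ha
    · obtain ⟨a, -, rfl⟩ := List.mem_map.1 ha
      cases hp
    · obtain ⟨a, ha', rfl⟩ := List.mem_map.1 ha
      exact ⟨a, ha', Sum.inr.inj hp⟩
  · right
    simp only [Builtins.coreRules, List.mem_cons, List.not_mem_nil, or_false] at hr
    rcases hr with rfl | rfl | rfl | rfl | rfl | rfl | rfl | rfl
    all_goals simp only [List.mem_cons, List.not_mem_nil, or_false] at ha
    · subst ha; cases hp
    all_goals
      refine ⟨by simp [idbAtom], ?_⟩
      rcases ha with rfl | rfl | rfl <;> cases hp <;> rfl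
  · right
    simp only [Builtins.relRules, List.mem_cons, List.not_mem_nil, or_false] at hr
    rcases hr with rfl | rfl
    · refine ⟨by simp [Builtins.relHead, idbAtom], ?_⟩
      rcases List.mem_cons.1 ha with rfl | ha
      · cases hp
      · obtain ⟨k, rfl⟩ := (List.mem_ofFn' _ _).1 ha
        cases hp; rfl
    · refine ⟨by simp [Builtins.relHead, idbAtom], ?_⟩
      simp only [List.mem_cons, List.not_mem_nil, or_false] at ha
      rcases ha with rfl | rfl <;> cases hp

theorem PosForm.program_nonrecursive : (PosForm.program b vn idx ρ Ps ext f).Nonrecursive := by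
  -- the goal depends on the constraints, and these on the domain predicate
  let level : ℕ × ℕ → ℕ := fun p => if p.1 = 0 then 2 else if p.1 = 1 then 0 else 1
  have hdep : ∀ p p', (PosForm.program b vn idx ρ Ps ext f).DependsOn p p' →
      level p' < level p := by
    rintro p p' ⟨r, hr, rfl, a, ha, hp⟩
    rcases PosForm.idb_of_mem_body hr ha hp with ⟨rfl, a', ha', rfl⟩ | ⟨h2, rfl⟩
    · obtain ⟨n, ts, rfl, hn, -⟩ := f.mem_compile ρ a' ha'
      have h0 : n ≠ 0 := by omega
      have h1 : n ≠ 1 := by omega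
      simp [level, idbAtom, mainRule, h0, h1]
    · have h0 : r.head.pred.1 ≠ 0 := by omega
      have h1 : r.head.pred.1 ≠ 1 := by omega
      simp [level, h0, h1]
  have htrans : ∀ p p', Relation.TransGen (PosForm.program b vn idx ρ Ps ext f).DependsOn p p' →
      level p' < level p := by
    intro p p' h
    induction h with
    | single h => exact hdep _ _ h
    | tail _ h ih => exact (hdep _ _ h).trans ih
  exact fun p h => lt_irrefl _ (htrans p p h)

theorem PosForm.program_arityLE {k : ℕ} (hk : 3 ≤ k) (hPs : ∀ Q ∈ Ps, S.arity Q + 1 ≤ k)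
    (hf : ∀ Q ∈ f.preds, Q ∈ Ps) : (PosForm.program b vn idx ρ Ps ext f).ArityLE k := by
  rintro p ⟨r, hr, hp⟩
  change p.2 ≤ k
  rcases hp with rfl | ⟨a, ha, hp⟩
  · rcases PosForm.mem_program.1 hr with rfl | hr | ⟨Q, hQ, hr⟩
    · exact Nat.zero_le _
    · simp only [Builtins.coreRules, List.mem_cons, List.not_mem_nil, or_false] at hr
      rcases hr with rfl | rfl | rfl | rfl | rfl | rfl | rfl | rfl <;>
        simp only [idbAtom, List.length_cons, List.length_nil] <;> omega
    · simp only [Builtins.relRules, List.mem_cons, List.not_mem_nil, or_false] at hr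
      rcases hr with rfl | rfl <;>
        simpa only [Builtins.relHead, idbAtom, List.length_cons, List.length_ofFn] using hPs Q hQ
  · rcases PosForm.idb_of_mem_body hr ha hp with ⟨rfl, a', ha', rfl⟩ | ⟨-, rfl⟩
    · obtain ⟨n, ts, rfl, -, h3 | ⟨Q, hQ, hl⟩, -⟩ := f.mem_compile ρ a' ha'
      · exact h3.trans hk
      · exact hl.trans_le (hPs Q (hf Q hQ))
    · change 1 ≤ k
      omega

theorem PosForm.program_consts {c : C}
    (hc : c ∈ (PosForm.program b vn idx ρ Ps ext f).consts) :
    c ∈ f.consts ∨ ∃ a ∈ ext, Sum.inr c ∈ a.vars := by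
  obtain ⟨r, hr, hc⟩ := hc
  have hdom : ∀ y, (Term.const c : Term C) ∉ (Builtins.domBody (.var y) :
      Atom ((S.sum K).sum idbSig) (Term C)).vars := fun y h => by
    have := mem_vars_idbAtom.1 h
    simp at this
  have hzero : ∀ y, (Term.const c : Term C) ∉ (b.zeroBody (.var y) :
      Atom ((S.sum K).sum idbSig) (Term C)).vars := fun y h => by
    cases b.mem_vars_zeroAtom.1 h
  have hone : ∀ y, (Term.const c : Term C) ∉ (b.oneBody (.var y) :
      Atom ((S.sum K).sum idbSig) (Term C)).vars := fun y h => by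
    cases b.mem_vars_oneAtom.1 h
  rcases PosForm.mem_program.1 hr with rfl | hr | ⟨Q, -, hr⟩
  · rcases hc with hc | ⟨a, ha, hc⟩
    · exact absurd (mem_vars_idbAtom.1 hc) (by simp)
    rcases List.mem_cons.1 ha with rfl | ha
    · exact (hone _ hc).elim
    rcases List.mem_append.1 ha with ha | ha
    · obtain ⟨a, ha', rfl⟩ := List.mem_map.1 ha
      have hc' : Term.const c ∈ (a.map (toTerm vn)).vars := hc
      obtain ⟨t, ht, e⟩ := Atom.mem_vars_map.1 hc'
      rcases t with x | c'
      · cases e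
      · cases e; exact Or.inr ⟨a, ha', ht⟩
    · obtain ⟨a, ha', rfl⟩ := List.mem_map.1 ha
      obtain ⟨n, ts, rfl, -, -, h⟩ := f.mem_compile ρ a ha'
      exact Or.inl (h c (mem_vars_idbAtom.1 hc))
  · simp only [Builtins.coreRules, List.mem_cons, List.not_mem_nil, or_false] at hr
    rcases hr with rfl | rfl | rfl | rfl | rfl | rfl | rfl | rfl
    all_goals
      rcases hc with hc | ⟨a, ha, hc⟩
      · exact absurd (mem_vars_idbAtom.1 hc) (by simp)
      simp only [List.mem_cons, List.not_mem_nil, or_false] at ha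
    · subst ha
      rcases b.eq_or_eq_of_mem_vars_neqAtom hc with e | e <;> cases e
    all_goals
      rcases ha with rfl | rfl | rfl <;>
        simp only [hdom, hzero, hone] at hc
  · simp only [Builtins.relRules, List.mem_cons, List.not_mem_nil, or_false] at hr
    rcases hr with rfl | rfl
    all_goals
      rcases hc with hc | ⟨a, ha, hc⟩
      · have := mem_vars_idbAtom.1 hc
        simp at this
      rcases List.mem_cons.1 ha with rfl | ha
      · simp only [hzero, hone] at hc
    · obtain ⟨k, rfl⟩ := (List.mem_ofFn' _ _).1 ha
      exact (hdom _ hc).elim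
    · obtain rfl := List.mem_singleton.1 ha
      obtain ⟨k, e⟩ := hc
      cases e

theorem PosForm.program_edbPreds {p : S.Pred}
    (hp : Sum.inl p ∈ (PosForm.program b vn idx ρ Ps ext f).edbPreds) :
    p ∈ Ps ∨ ∃ a ∈ ext, a.pred = Sum.inl p := by
  obtain ⟨r, hr, a, ha, hp⟩ := hp
  rcases PosForm.mem_program.1 hr with rfl | hr | ⟨Q, hQ, hr⟩
  · right
    rcases List.mem_cons.1 ha with rfl | ha
    · cases hp
    rcases List.mem_append.1 ha with ha | ha
    · obtain ⟨a, ha', rfl⟩ := List.mem_map.1 ha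
      exact ⟨a, ha', Sum.inl.inj hp⟩
    · obtain ⟨a, ha', rfl⟩ := List.mem_map.1 ha
      cases hp
  · simp only [Builtins.coreRules, List.mem_cons, List.not_mem_nil, or_false] at hr
    rcases hr with rfl | rfl | rfl | rfl | rfl | rfl | rfl | rfl
    all_goals simp only [List.mem_cons, List.not_mem_nil, or_false] at ha
    · subst ha; cases hp
    all_goals rcases ha with rfl | rfl | rfl <;> cases hp
  · left
    simp only [Builtins.relRules, List.mem_cons, List.not_mem_nil, or_false] at hr
    rcases hr with rfl | rfl
    all_goals
      rcases List.mem_cons.1 ha with rfl | ha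
      · cases hp
    · obtain ⟨k, rfl⟩ := (List.mem_ofFn' _ _).1 ha
      cases hp
    · obtain rfl := List.mem_singleton.1 ha
      cases hp
      exact hQ

theorem Builtins.size_zeroBody (t : Term C) :
    (b.zeroBody t : Atom ((S.sum K).sum idbSig) (Term C)).size = 2 :=
  congrArg (· + 1) b.zero_arity

theorem Builtins.size_oneBody (t : Term C) :
    (b.oneBody t : Atom ((S.sum K).sum idbSig) (Term C)).size = 2 :=
  congrArg (· + 1) b.one_arity

theorem Builtins.size_domBody (t : Term C) :
    (domBody t : Atom ((S.sum K).sum idbSig) (Term C)).size = 2 := rfl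

theorem Builtins.size_coreRules : (b.coreRules : Program (S.sum K) C).size = 67 := by
  have h : ((b.neqAtom (.var 0) (.var 1) : Atom (S.sum K) (Term C)).inl :
      Atom ((S.sum K).sum idbSig) (Term C)).size = 3 := congrArg (· + 1) b.neq_arity
  simp only [coreRules, Program.size, Rule.size, List.map_cons, List.map_nil, List.sum_cons,
    List.sum_nil, size_zeroBody, size_oneBody, size_domBody, size_idbAtom, h, List.length_cons,
    List.length_nil]
  norm_num

theorem Builtins.size_relRules (Q : S.Pred) :
    (b.relRules idx Q : Program (S.sum K) C).size = 5 * S.arity Q + 9 := by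
  have h : ((Atom.mk Q fun k => Term.var (k + 1)).inl.inl :
      Atom ((S.sum K).sum idbSig) (Term C)).size = S.arity Q + 1 := rfl
  have h2 : ((List.ofFn fun k : Fin (S.arity Q) => (domBody (.var (k + 1)) :
      Atom ((S.sum K).sum idbSig) (Term C))).map Atom.size).sum = 2 * S.arity Q := by
    rw [List.map_ofFn, List.sum_ofFn]
    simp only [Function.comp_apply, size_domBody, Finset.sum_const, Finset.card_univ,
      Fintype.card_fin, smul_eq_mul]
    exact mul_comm _ _
  simp only [relRules, relHead, Program.size, Rule.size, List.map_cons, List.map_nil,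
    List.sum_cons, List.sum_nil, size_zeroBody, size_oneBody, size_idbAtom, h, h2,
    List.length_cons, List.length_ofFn]
  omega

theorem Program.size_append (P Q : Program (S.sum K) C) :
    Program.size (P ++ Q) = P.size + Q.size := by
  simp [Program.size]

theorem PosForm.size_program_le {w : ℕ} (hw : ∀ Q, S.arity Q ≤ w) :
    (PosForm.program b vn idx ρ Ps ext f).size ≤
      70 + (ext.map Atom.size).sum + f.size + Ps.length * (5 * w + 9) := by
  have h1 : (PosForm.mainRule b vn idx ρ ext f).size = 3 + (ext.map Atom.size).sum + f.size := by
    have h : ∀ a : Atom (S.sum K) (X ⊕ C), ((a.map (PosForm.toTerm vn)).inl :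
        Atom ((S.sum K).sum idbSig) (Term C)).size = a.size := fun _ => rfl
    have h' : ∀ a : Atom idbSig (Term C),
        (a.inr : Atom ((S.sum K).sum idbSig) (Term C)).size = a.size := fun _ => rfl
    simp only [PosForm.mainRule, Rule.size, List.map_cons, List.map_append, List.map_map,
      List.sum_cons, List.sum_append, Builtins.size_oneBody, size_idbAtom, List.length_nil,
      Function.comp_def, h, h', PosForm.size_compile]
    change _ = 3 + (ext.map fun a => a.size).sum + f.size
    omega
  have h2 : Program.size (Ps.flatMap (b.relRules idx) : Program (S.sum K) C) ≤
      Ps.length * (5 * w + 9) := by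
    induction Ps with
    | nil => exact Nat.zero_le _
    | cons Q Ps ih =>
      rw [List.flatMap_cons, Program.size_append, Builtins.size_relRules, List.length_cons]
      have := hw Q
      have e : (Ps.length + 1) * (5 * w + 9) = Ps.length * (5 * w + 9) + (5 * w + 9) :=
        Nat.succ_mul _ _
      omega
  have h3 : (PosForm.program b vn idx ρ Ps ext f).size =
      (PosForm.mainRule b vn idx ρ ext f).size + (Program.size (b.coreRules : Program (S.sum K) C) +
        Program.size (Ps.flatMap (b.relRules idx) : Program (S.sum K) C)) := by
    rw [← Program.size_append]; rfl
  rw [h3, h1, Builtins.size_coreRules]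
  omega

end ProgramProperties


/-! ### The formula that describes derivations -/

section DerivationFormula

/-- The places of a derivation in `n` rounds: a round and a predicate. -/
abbrev Slot (S : Signature) (n : ℕ) := Fin n × S.Pred

/-- The coordinates of encoded values. A value of a derivation is encoded as a tuple over the
domain of the database: an element `v` as `v` at the base coordinate `none` and `0` elsewhere, and
the null of a place `s` as `1` at the coordinate `some s` and `0` elsewhere. -/
abbrev Coord (S : Signature) (n : ℕ) := Option (Slot S n)

/-- The variables of the formula: the elements `0` and `1`, and the components of a derivation. -/
inductive DVar (S : Signature) (n : ℕ) where
  | zero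
  | one
  | used (s : Slot S n)
  | arg (s : Slot S n) (k : ℕ) (i : Coord S n)
  | ruleVar (s : Slot S n) (x : ℕ) (i : Coord S n)
  | queryVar (x : ℕ) (i : Coord S n)

instance (S : Signature) (n : ℕ) [Countable S.Pred] : Countable (DVar S n) := by
  let f : DVar S n → Bool ⊕ Slot S n ⊕ (Bool × Slot S n × ℕ × Coord S n) ⊕ (ℕ × Coord S n) :=
    fun v => match v with
    | .zero => .inl false
    | .one => .inl true
    | .used s => .inr (.inl s)
    | .arg s k i => .inr (.inr (.inl (false, s, k, i)))
    | .ruleVar s k i => .inr (.inr (.inl (true, s, k, i)))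
    | .queryVar x i => .inr (.inr (.inr (x, i)))
  refine Function.Injective.countable (f := f) fun v v' h => ?_
  cases v <;> cases v' <;> simp_all [f]

variable {S : Signature} {C V : Type} {n : ℕ}

namespace PosForm

/-- The conjunction of a list of formulas. -/
def conj (l : List (PosForm S (DVar S n) C)) : PosForm S (DVar S n) C :=
  l.foldr .and (.eq (.inl .zero) (.inl .zero))

/-- The disjunction of a list of formulas. -/
def disj (l : List (PosForm S (DVar S n) C)) : PosForm S (DVar S n) C :=
  l.foldr .or (.eq (.inl .zero) (.inl .one))

variable {F : Set (Atom S V)} {ι : C → V} {ν : DVar S n → V}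

theorem sat_conj {l : List (PosForm S (DVar S n) C)} :
    (conj l).Sat F ι ν ↔ ∀ f ∈ l, f.Sat F ι ν := by
  induction l with
  | nil => simp [conj, Sat]
  | cons f l ih =>
    rw [List.forall_mem_cons, ← ih]; rfl

theorem sat_disj (h : ν .zero ≠ ν .one) {l : List (PosForm S (DVar S n) C)} :
    (disj l).Sat F ι ν ↔ ∃ f ∈ l, f.Sat F ι ν := by
  induction l with
  | nil => simpa [disj, Sat] using h
  | cons f l ih =>
    simp only [List.mem_cons, exists_eq_or_imp, ← ih]; rfl

theorem size_conj_le {l : List (PosForm S (DVar S n) C)} {c s : ℕ} (hl : l.length ≤ c)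
    (h : ∀ f ∈ l, f.size ≤ s) : (conj l).size ≤ 4 + c * (s + 6) := by
  refine le_trans ?_ (Nat.add_le_add_left (Nat.mul_le_mul_right _ hl) 4)
  clear hl
  induction l with
  | nil => simp [conj, size]
  | cons f l ih =>
    obtain ⟨h1, h2⟩ := List.forall_mem_cons.1 h
    have := ih h2
    change f.size + (conj l).size + 6 ≤ _
    rw [List.length_cons, Nat.add_mul, Nat.one_mul]
    omega

theorem size_disj_le {l : List (PosForm S (DVar S n) C)} {c s : ℕ} (hl : l.length ≤ c)
    (h : ∀ f ∈ l, f.size ≤ s) : (disj l).size ≤ 4 + c * (s + 4) := by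
  refine le_trans ?_ (Nat.add_le_add_left (Nat.mul_le_mul_right _ hl) 4)
  clear hl
  induction l with
  | nil => simp [disj, size]
  | cons f l ih =>
    obtain ⟨h1, h2⟩ := List.forall_mem_cons.1 h
    have := ih h2
    change f.size + (disj l).size + 4 ≤ _
    rw [List.length_cons, Nat.add_mul, Nat.one_mul]
    omega

/-- All constants of the formula are from `A`, and all its predicates from `B`. -/
def Over (A : Set C) (B : Set S.Pred) (f : PosForm S (DVar S n) C) : Prop :=
  f.consts ⊆ A ∧ f.preds ⊆ B

variable {A : Set C} {B : Set S.Pred}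

theorem Over.and {f g : PosForm S (DVar S n) C} (hf : f.Over A B) (hg : g.Over A B) :
    (f.and g).Over A B :=
  ⟨Set.union_subset hf.1 hg.1, Set.union_subset hf.2 hg.2⟩

theorem Over.or {f g : PosForm S (DVar S n) C} (hf : f.Over A B) (hg : g.Over A B) :
    (f.or g).Over A B :=
  ⟨Set.union_subset hf.1 hg.1, Set.union_subset hf.2 hg.2⟩

theorem over_eq {s t : DVar S n ⊕ C} (hs : ∀ c, s = .inr c → c ∈ A) (ht : ∀ c, t = .inr c → c ∈ A) :
    (eq s t : PosForm S (DVar S n) C).Over A B :=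
  ⟨fun c hc => hc.elim (hs c) (ht c), Set.empty_subset _⟩

theorem over_eq_inl {s t : DVar S n} :
    (eq (.inl s) (.inl t) : PosForm S (DVar S n) C).Over A B :=
  over_eq (fun _ h => by cases h) (fun _ h => by cases h)

theorem over_conj {l : List (PosForm S (DVar S n) C)} (h : ∀ f ∈ l, f.Over A B) :
    (conj l).Over A B := by
  induction l with
  | nil => exact over_eq_inl
  | cons f l ih =>
    obtain ⟨h1, h2⟩ := List.forall_mem_cons.1 h
    exact h1.and (ih h2)

theorem over_disj {l : List (PosForm S (DVar S n) C)} (h : ∀ f ∈ l, f.Over A B) :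
    (disj l).Over A B := by
  induction l with
  | nil => exact over_eq_inl
  | cons f l ih =>
    obtain ⟨h1, h2⟩ := List.forall_mem_cons.1 h
    exact h1.or (ih h2)

end PosForm

/-- The symbolic encoding of a value: a variable or a constant for each coordinate. -/
abbrev TupleTerm (S : Signature) (C : Type) (n : ℕ) := Coord S n → DVar S n ⊕ C

namespace TupleTerm

/-- The tuple denoted by a symbolic tuple. -/
def eval (ν : DVar S n → V) (ι : C → V) (s : TupleTerm S C n) : Coord S n → V :=
  fun i => Sum.elim ν ι (s i)

/-- The encoding of an element of the domain. -/
def base (t : DVar S n ⊕ C) : TupleTerm S C n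
  | none => t
  | some _ => .inl .zero

open Classical in
/-- The encoding of the null of a place. -/
noncomputable def null (s : Slot S n) : TupleTerm S C n
  | none => .inl .zero
  | some s' => if s' = s then .inl .one else .inl .zero

/-- The encoding of the `k`-th argument of the atom at a place. -/
def arg (s : Slot S n) (k : ℕ) : TupleTerm S C n := fun i => .inl (.arg s k i)

/-- The encoding of the value of the variable `x` of the tgd that is applied at a place. -/
def ruleVar (s : Slot S n) (x : ℕ) : TupleTerm S C n := fun i => .inl (.ruleVar s x i)

/-- The encoding of a term of the query. -/
def query : Term C → TupleTerm S C n
  | .var x => fun i => .inl (.queryVar x i)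
  | .const c => base (.inr c)

/-- All constants of the tuple are from `A`. -/
def Over (A : Set C) (s : TupleTerm S C n) : Prop := ∀ i c, s i = .inr c → c ∈ A

end TupleTerm

/-- The tuple that encodes an element of the domain. -/
def baseTuple (S : Signature) (n : ℕ) (z v : V) : Coord S n → V
  | none => v
  | some _ => z

open Classical in
/-- The tuple that encodes the null of a place. -/
noncomputable def nullTuple (z o : V) (s : Slot S n) : Coord S n → V
  | none => z
  | some s' => if s' = s then o else z

theorem nullTuple_injective {z o : V} (h : z ≠ o) :
    Function.Injective (nullTuple z o : Slot S n → _) := by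
  intro s s' e
  have := congrFun e (some s)
  simp only [nullTuple, if_true] at this
  by_contra hne
  rw [if_neg hne] at this
  exact h this.symm

theorem baseTuple_ne_nullTuple {z o v : V} (h : z ≠ o) (s : Slot S n) :
    baseTuple S n z v ≠ nullTuple z o s := by
  intro e
  have := congrFun e (some s)
  simp only [nullTuple, baseTuple, if_true] at this
  exact h this

/-- The facts over encoded values are the facts none of whose values is a null. -/
theorem mem_image_baseTuple {ι : C → V} {D : Set (Atom S C)} {z : V} {a : Atom S (Coord S n → V)} :
    a ∈ (fun a => a.map fun c => baseTuple S n z (ι c)) '' D ↔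
      a.map (· none) ∈ (fun a => a.map ι) '' D ∧
        ∀ v ∈ a.vars, v = baseTuple S n z (v none) := by
  constructor
  · rintro ⟨a, ha, rfl⟩
    refine ⟨⟨a, ha, rfl⟩, ?_⟩
    rintro v ⟨k, rfl⟩
    rfl
  · rintro ⟨⟨d, hd, e⟩, h⟩
    refine ⟨d, hd, ?_⟩
    change (d.map ι).map (baseTuple S n z) = a
    change d.map ι = _ at e
    rw [e, Atom.map_map]
    exact (Atom.map_congr (g := id) fun v hv => (h v hv).symm).trans a.map_id'

namespace TupleTerm

variable {ν : DVar S n → V} {ι : C → V}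

theorem eval_base (t : DVar S n ⊕ C) :
    (base t).eval ν ι = baseTuple S n (ν .zero) (Sum.elim ν ι t) := by
  funext i; cases i <;> rfl

theorem eval_null (s : Slot S n) :
    (null s : TupleTerm S C n).eval ν ι = nullTuple (ν .zero) (ν .one) s := by
  funext i
  cases i with
  | none => rfl
  | some s' =>
    simp only [eval, null, nullTuple]
    split_ifs <;> rfl

theorem eval_query (t : Term C) :
    (query t).eval ν ι = t.eval (fun c => baseTuple S n (ν .zero) (ι c))
      (fun x i => ν (.queryVar x i)) := by
  cases t with
  | var x => rfl
  | const c => exact eval_base _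

end TupleTerm

section Formulas

variable [Fintype S.Pred]

/-- Equality of encoded values. -/
noncomputable def eqForm (s t : TupleTerm S C n) : PosForm S (DVar S n) C :=
  .conj ((Finset.univ : Finset (Coord S n)).toList.map fun i => .eq (s i) (t i))

/-- Equality of tuples of encoded values. -/
noncomputable def eqArgsForm {l : ℕ} (s t : Fin l → TupleTerm S C n) : PosForm S (DVar S n) C :=
  .conj ((List.finRange l).map fun k => eqForm (s k) (t k))

/-- The atom at the place `(t, P)` is a fact. -/
noncomputable def factForm (t : Fin n) (P : S.Pred) : PosForm S (DVar S n) C :=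
  .and (.rel P fun k => .arg (t, P) k none)
    (eqArgsForm (l := S.arity P) (fun k => .arg (t, P) k)
      fun k => .base (.inl (.arg (t, P) k none)))

/-- An atom with the given arguments is derived at one of the given rounds. -/
noncomputable def derivedForm (ts : List (Fin n)) (P : S.Pred)
    (args : Fin (S.arity P) → TupleTerm S C n) : PosForm S (DVar S n) C :=
  .disj (ts.map fun t => .and (.eq (.inl (.used (t, P))) (.inl .one))
    (eqArgsForm (fun k => .arg (t, P) k) args))

open Classical in
/-- The atom at the place `(t, P)` stems from the tgd `σ` and earlier atoms. -/
noncomputable def tgdForm (t : Fin n) (P : S.Pred) (σ : TGD S) : PosForm S (DVar S n) C :=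
  .and (eqArgsForm (l := S.arity σ.head.pred) (fun k => .arg (t, P) k) fun k =>
      if σ.head.args k ∈ conjVars σ.body then .ruleVar (t, P) (σ.head.args k) else .null (t, P))
    (.conj (σ.body.map fun a => derivedForm ((List.finRange n).filter (· < t)) a.pred
      fun k => .ruleVar (t, P) (a.args k)))

open Classical in
/-- If the place `(t, P)` is in use, then its atom is justified. -/
noncomputable def stepForm (Sg : Finset (TGD S)) (t : Fin n) (P : S.Pred) :
    PosForm S (DVar S n) C :=
  .or (.eq (.inl (.used (t, P))) (.inl .zero)) (.or (factForm t P)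
    (.disj ((Sg.toList.filter (·.head.pred = P)).map (tgdForm t P))))

open Classical in
/-- The predicates of a set of tgds, as a list. -/
noncomputable def predList (Sg : Finset (TGD S)) : List S.Pred :=
  (Finset.univ : Finset S.Pred).toList.filter (· ∈ tgdsPreds Sg)

theorem mem_predList {Sg : Finset (TGD S)} {P : S.Pred} : P ∈ predList Sg ↔ P ∈ tgdsPreds Sg := by
  simp [predList]

open Classical in
/-- An atom of the query is derived; or, for a predicate without tgds, its values are no nulls. -/
noncomputable def queryAtomForm (Sg : Finset (TGD S)) (a : Atom S (Term C)) :
    PosForm S (DVar S n) C :=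
  if a.pred ∈ tgdsPreds Sg then derivedForm (List.finRange n) a.pred fun k => .query (a.args k)
  else eqArgsForm (fun k => .query (a.args k)) fun k => .base (TupleTerm.query (a.args k) none)

/-- The variables encode a derivation of the query. -/
noncomputable def derivationForm (n : ℕ) (Sg : Finset (TGD S)) (q : BCQ S C) :
    PosForm S (DVar S n) C :=
  .and (.conj ((List.finRange n ×ˢ predList Sg).map fun s => stepForm Sg s.1 s.2))
    (.conj (q.map (queryAtomForm Sg)))

open Classical in
/-- The extensional atoms of the goal rule: the elements `0` and `1`, and the atoms of the query
whose predicates do not occur in the tgds. The latter may exceed the arity that is available for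
intensional predicates, and they can only be facts. -/
noncomputable def extAtoms {K : Signature} (b : Builtins K) (n : ℕ) (Sg : Finset (TGD S))
    (q : BCQ S C) : List (Atom (S.sum K) (DVar S n ⊕ C)) :=
  b.zeroAtom (.inl .zero) :: b.oneAtom (.inl .one) ::
    (q.filter (·.pred ∉ tgdsPreds Sg)).map fun a => (a.map fun t => TupleTerm.query t none).inl

variable {F : Set (Atom S V)} {ι : C → V} {ν : DVar S n → V}

theorem sat_eqForm {s t : TupleTerm S C n} :
    (eqForm s t).Sat F ι ν ↔ s.eval ν ι = t.eval ν ι := by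
  rw [eqForm, PosForm.sat_conj, funext_iff]
  simp only [List.mem_map, Finset.mem_toList, Finset.mem_univ, true_and, forall_exists_index,
    forall_apply_eq_imp_iff]
  rfl

theorem sat_eqArgsForm {l : ℕ} {s t : Fin l → TupleTerm S C n} :
    (eqArgsForm s t).Sat F ι ν ↔ ∀ k, (s k).eval ν ι = (t k).eval ν ι := by
  rw [eqArgsForm, PosForm.sat_conj]
  simp only [List.mem_map, List.mem_finRange, true_and, forall_exists_index,
    forall_apply_eq_imp_iff, sat_eqForm]

theorem sat_derivedForm (h01 : ν .zero ≠ ν .one) {ts : List (Fin n)} {P : S.Pred}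
    {args : Fin (S.arity P) → TupleTerm S C n} :
    (derivedForm ts P args).Sat F ι ν ↔ ∃ t ∈ ts, ν (.used (t, P)) = ν .one ∧
      ∀ k : Fin (S.arity P), (fun i => ν (.arg (t, P) k i)) = (args k).eval ν ι := by
  rw [derivedForm, PosForm.sat_disj h01]
  simp only [List.mem_map, exists_exists_and_eq_and]
  refine exists_congr fun t => and_congr_right fun _ => ?_
  exact and_congr Iff.rfl sat_eqArgsForm

open Classical in
theorem sat_tgdForm (h01 : ν .zero ≠ ν .one) {t : Fin n} {P : S.Pred} {σ : TGD S} :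
    (tgdForm t P σ).Sat F ι ν ↔
      (∀ k : Fin (S.arity σ.head.pred), (fun i => ν (.arg (t, P) k i)) =
        if σ.head.args k ∈ conjVars σ.body then (fun i => ν (.ruleVar (t, P) (σ.head.args k) i))
        else nullTuple (ν .zero) (ν .one) (t, P)) ∧
      ∀ a ∈ σ.body, ∃ t' < t, ν (.used (t', a.pred)) = ν .one ∧
        ∀ k : Fin (S.arity a.pred), (fun i => ν (.arg (t', a.pred) k i)) =
          fun i => ν (.ruleVar (t, P) (a.args k) i) := by
  refine and_congr (sat_eqArgsForm.trans (forall_congr' fun k => ?_)) ?_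
  · split_ifs
    · rfl
    · rw [TupleTerm.eval_null]; rfl
  · rw [PosForm.sat_conj]
    simp only [List.mem_map, forall_exists_index, and_imp, forall_apply_eq_imp_iff₂,
      sat_derivedForm h01, List.mem_filter, List.mem_finRange, true_and, decide_eq_true_eq]
    rfl

theorem sat_stepForm (h01 : ν .zero ≠ ν .one) {Sg : Finset (TGD S)} {t : Fin n} {P : S.Pred} :
    (stepForm Sg t P).Sat F ι ν ↔ ν (.used (t, P)) = ν .zero ∨ (factForm t P).Sat F ι ν ∨
      ∃ σ ∈ Sg, σ.head.pred = P ∧ (tgdForm t P σ).Sat F ι ν := by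
  refine or_congr Iff.rfl (or_congr Iff.rfl ?_)
  rw [PosForm.sat_disj h01]
  simp only [List.mem_map, List.mem_filter, Finset.mem_toList, decide_eq_true_eq]
  exact ⟨fun ⟨_, ⟨σ, h, e⟩, hf⟩ => ⟨σ, h.1, h.2, e ▸ hf⟩,
    fun ⟨σ, h, hp, hf⟩ => ⟨_, ⟨σ, ⟨h, hp⟩, rfl⟩, hf⟩⟩

theorem sat_factForm {D : Set (Atom S C)} {t : Fin n} {P : S.Pred} :
    (factForm t P).Sat ((fun a => a.map ι) '' D) ι ν ↔
      (⟨P, fun k i => ν (.arg (t, P) k i)⟩ : Atom S (Coord S n → V)) ∈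
        (fun a => a.map fun c => baseTuple S n (ν .zero) (ι c)) '' D := by
  rw [mem_image_baseTuple]
  refine and_congr Iff.rfl ?_
  rw [sat_eqArgsForm]
  simp only [TupleTerm.eval_base]
  constructor
  · rintro h v ⟨k, rfl⟩
    exact h k
  · exact fun h k => h _ ⟨k, rfl⟩

/-- The derivation formula and the extensional atoms hold only if the variables encode a
derivation. The converse is true if each variable `used s` takes one of the values `0` and `1`. -/
theorem sat_derivationForm (h01 : ν .zero ≠ ν .one)
    {D : Set (Atom S C)} {Sg : Finset (TGD S)} {q : BCQ S C} :
    let A := (derivationForm n Sg q).Sat ((fun a => a.map ι) '' D) ι ν ∧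
      ∀ a ∈ q, a.pred ∉ tgdsPreds Sg →
        a.map (fun t => Sum.elim ν ι (TupleTerm.query t none)) ∈ (fun a => a.map ι) '' D
    let B := IsDerivation Sg q n ((fun a => a.map fun c => baseTuple S n (ν .zero) (ι c)) '' D)
      (fun c => baseTuple S n (ν .zero) (ι c)) (nullTuple (ν .zero) (ν .one))
      (fun t P => ν (.used (t, P)) = ν .one)
      (fun t P k i => ν (.arg (t, P) k i)) (fun t P x i => ν (.ruleVar (t, P) x i))
      (fun x i => ν (.queryVar x i))
    (A → B) ∧ ((∀ s, ν (.used s) = ν .zero ∨ ν (.used s) = ν .one) → B → A) := by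
  intro A B
  have hstep : ∀ t P, (stepForm Sg t P).Sat ((fun a => a.map ι) '' D) ι ν ↔
      (ν (.used (t, P)) ≠ ν .zero → (factForm t P).Sat ((fun a => a.map ι) '' D) ι ν ∨
        ∃ σ ∈ Sg, σ.head.pred = P ∧ (tgdForm t P σ).Sat ((fun a => a.map ι) '' D) ι ν) := by
    intro t P
    rw [sat_stepForm h01, ne_eq, ← or_iff_not_imp_left]
  have hquery : ∀ a : Atom S (Term C), ((queryAtomForm Sg a).Sat ((fun a => a.map ι) '' D) ι ν ∧
      (a.pred ∉ tgdsPreds Sg →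
        a.map (fun t => Sum.elim ν ι (TupleTerm.query t none)) ∈ (fun a => a.map ι) '' D)) ↔
      ((a.pred ∈ tgdsPreds Sg ∧ ∃ t, ν (.used (t, a.pred)) = ν .one ∧
        ∀ k : Fin (S.arity a.pred), (fun i => ν (.arg (t, a.pred) k i)) =
          (a.args k).eval (fun c => baseTuple S n (ν .zero) (ι c)) fun x i => ν (.queryVar x i)) ∨
      (a.pred ∉ tgdsPreds Sg ∧ a.map (Term.eval (fun c => baseTuple S n (ν .zero) (ι c))
          fun x i => ν (.queryVar x i)) ∈
        (fun a => a.map fun c => baseTuple S n (ν .zero) (ι c)) '' D)) := by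
    intro a
    by_cases hp : a.pred ∈ tgdsPreds Sg
    · rw [show (queryAtomForm Sg a : PosForm S (DVar S n) C) = _ from if_pos hp]
      simp only [hp, not_true_eq_false, false_imp_iff, and_true,
        false_and, or_false, true_and, sat_derivedForm h01, List.mem_finRange,
        TupleTerm.eval_query]
    · rw [show (queryAtomForm Sg a : PosForm S (DVar S n) C) = _ from if_neg hp,
        mem_image_baseTuple]
      simp only [hp, not_false_eq_true, true_imp_iff, false_and,
        false_or, true_and, sat_eqArgsForm, TupleTerm.eval_query, TupleTerm.eval_base]
      rw [and_comm]
      have hnone : ∀ t : Term C, t.eval (fun c => baseTuple S n (ν .zero) (ι c))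
          (fun x i => ν (.queryVar x i)) none = Sum.elim ν ι (TupleTerm.query t none) :=
        fun t => (congrFun (TupleTerm.eval_query t) none).symm
      refine and_congr ?_ ⟨?_, fun h k => ?_⟩
      · rw [Atom.map_map]
        simp only [hnone]
      · rintro h v ⟨k, rfl⟩
        exact (h k).trans (congrArg (baseTuple S n _) (hnone (a.args k)).symm)
      · exact (h _ ⟨k, rfl⟩).trans (congrArg (baseTuple S n _) (hnone (a.args k)))
  have h1 : (derivationForm n Sg q).Sat ((fun a => a.map ι) '' D) ι ν ↔
      (∀ t, ∀ P ∈ tgdsPreds Sg, (stepForm Sg t P).Sat ((fun a => a.map ι) '' D) ι ν) ∧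
        ∀ a ∈ q, (queryAtomForm Sg a).Sat ((fun a => a.map ι) '' D) ι ν := by
    refine and_congr ?_ ?_
    · rw [PosForm.sat_conj]
      simp only [List.mem_map, forall_exists_index, and_imp, List.mem_product, Prod.forall,
        List.mem_finRange, true_and, mem_predList]
      exact ⟨fun h t P hP => h _ t P hP rfl, fun h _ t P hP e => e ▸ h t P hP⟩
    · rw [PosForm.sat_conj]
      simp only [List.mem_map, forall_exists_index, and_imp, forall_apply_eq_imp_iff₂]
  simp only [A, B]
  rw [h1, and_assoc, ← forall₂_and]
  constructor
  · rintro ⟨hs, hq⟩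
    refine ⟨fun t P hP hused => ?_, fun a ha => (hquery a).1 (hq a ha)⟩
    refine ((hstep t P).1 (hs t P hP) fun h => h01 (h.symm.trans hused)).imp sat_factForm.1 ?_
    exact fun ⟨σ, hσ, hp, h⟩ => ⟨σ, hσ, hp, (sat_tgdForm h01).1 h⟩
  · intro hu h
    refine ⟨fun t P hP => (hstep t P).2 fun hused => ?_, fun a ha => (hquery a).2 (h.query a ha)⟩
    refine (h.step t P hP ((hu _).resolve_left hused)).imp sat_factForm.2 ?_
    exact fun ⟨σ, hσ, hp, h⟩ => ⟨σ, hσ, hp, (sat_tgdForm h01).2 h⟩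

end Formulas

end DerivationFormula


/-! ### The size of the rewriting -/

section Size

variable {A : Type} [CommSemiring A]

/-- A bound on the size of `eqForm`. The bounds are for `K` predicates of arity at most `w`,
derivations in `n` rounds, and input of size `m`; they are polynomials in `n` and `m`, stated for a
semiring so that they may be read in `ℕ` and in `ℕ[X]`. -/
def eqSize (K : ℕ) (n : A) : A := 4 + (n * K + 1) * 10

/-- A bound on the size of `eqArgsForm`. -/
def argsSize (K w : ℕ) (n : A) : A := 4 + w * (eqSize K n + 6)

/-- A bound on the size of `derivedForm`. -/
def derivedSize (K w : ℕ) (n : A) : A := 4 + n * (argsSize K w n + 14)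

/-- A bound on the size of `tgdForm`. -/
def tgdFormSize (K w : ℕ) (n m : A) : A :=
  argsSize K w n + (4 + m * (derivedSize K w n + 6)) + 6

/-- A bound on the size of `stepForm`. -/
def stepSize (K w : ℕ) (n m : A) : A :=
  4 + ((w + 2 + argsSize K w n + 6) + (4 + m * (tgdFormSize K w n m + 4)) + 4) + 4

/-- A bound on the size of `derivationForm`. -/
def formSize (K w : ℕ) (n m : A) : A :=
  (4 + n * K * (stepSize K w n m + 6)) + (4 + m * (derivedSize K w n + argsSize K w n + 6)) + 6

/-- A bound on the size of the rewriting, as a polynomial in the size `m` of the input. -/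
def programSize (K w : ℕ) (m : A) : A :=
  70 + (4 + m) + formSize K w (typeBound K w m) m + K * (5 * w + 9)

theorem eval_programSize (K w m : ℕ) :
    (programSize K w (Polynomial.X : Polynomial ℕ)).eval m = programSize K w m := by
  simp [programSize, formSize, stepSize, tgdFormSize, derivedSize, argsSize, eqSize, typeBound]

end Size

section SizeBounds

variable {S : Signature} {C : Type} {n w : ℕ}

theorem TGD.body_length_le_size (σ : TGD S) : σ.body.length ≤ σ.size := by
  have : σ.body.length ≤ (σ.body.map Atom.size).sum := by
    have := List.length_le_sum_of_one_le (σ.body.map Atom.size) (by simp [Atom.size])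
    simpa using this
  exact this.trans (Nat.le_add_left _ _)

theorem TGD.size_le_tgdsSize {Sg : Finset (TGD S)} {σ : TGD S} (hσ : σ ∈ Sg) :
    σ.size ≤ tgdsSize Sg :=
  Finset.single_le_sum (f := TGD.size) (fun _ _ => Nat.zero_le _) hσ

theorem card_le_tgdsSize (Sg : Finset (TGD S)) : Sg.card ≤ tgdsSize Sg := by
  have := Finset.card_nsmul_le_sum Sg TGD.size 1 fun σ _ => by
    have : 1 ≤ σ.head.size := Nat.le_add_left _ _
    exact this.trans (Nat.le_add_right _ _)
  simpa [tgdsSize] using this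

theorem BCQ.length_le_size (q : BCQ S C) : q.length ≤ q.size := by
  have := List.length_le_sum_of_one_le (q.map Atom.size) (by simp [Atom.size])
  simpa [BCQ.size] using this

theorem size_extAtoms_le {K : Signature} (b : Builtins K) (Sg : Finset (TGD S)) (q : BCQ S C) :
    ((extAtoms b n Sg q).map Atom.size).sum ≤ 4 + q.size := by
  classical
  have h0 : (b.zeroAtom (.inl .zero) : Atom (S.sum K) (DVar S n ⊕ C)).size = 2 :=
    congrArg (· + 1) b.zero_arity
  have h1 : (b.oneAtom (.inl .one) : Atom (S.sum K) (DVar S n ⊕ C)).size = 2 :=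
    congrArg (· + 1) b.one_arity
  have h2 : ∀ q : BCQ S C, (((q.filter (·.pred ∉ tgdsPreds Sg)).map fun a =>
      ((a.map fun t => (TupleTerm.query t none : DVar S n ⊕ C)).inl :
        Atom (S.sum K) (DVar S n ⊕ C))).map Atom.size).sum ≤ q.size := by
    intro q
    rw [List.map_map]
    exact (List.filter_sublist.map _).sum_le_sum fun _ _ => Nat.zero_le _
  have := h2 q
  simp only [extAtoms, List.map_cons, List.sum_cons, h0, h1]
  omega

variable [Fintype S.Pred]

theorem size_eqForm_le (s t : TupleTerm S C n) :
    (eqForm s t).size ≤ eqSize (Fintype.card S.Pred) n := by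
  refine PosForm.size_conj_le (s := 4) ?_ ?_
  · simp
  · simp [PosForm.size]

theorem size_eqArgsForm_le {l : ℕ} (hl : l ≤ w) (s t : Fin l → TupleTerm S C n) :
    (eqArgsForm s t).size ≤ argsSize (Fintype.card S.Pred) w n := by
  refine PosForm.size_conj_le (by simpa using hl) ?_
  simp only [List.mem_map, forall_exists_index, and_imp, forall_apply_eq_imp_iff₂]
  exact fun k _ => size_eqForm_le _ _

theorem size_derivedForm_le (hw : ∀ p, S.arity p ≤ w) {ts : List (Fin n)} (hts : ts.length ≤ n)
    (P : S.Pred) (args : Fin (S.arity P) → TupleTerm S C n) :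
    (derivedForm ts P args).size ≤ derivedSize (Fintype.card S.Pred) w n := by
  refine PosForm.size_disj_le (s := argsSize (Fintype.card S.Pred) w n + 10) (by simpa using hts) ?_
  simp only [List.mem_map, forall_exists_index, and_imp, forall_apply_eq_imp_iff₂]
  intro t _
  have := size_eqArgsForm_le (hw P) (fun k => TupleTerm.arg (t, P) k) args
  simp only [PosForm.size]
  omega

theorem size_tgdForm_le (hw : ∀ p, S.arity p ≤ w) (t : Fin n) (P : S.Pred) {σ : TGD S} {m : ℕ}
    (hm : σ.body.length ≤ m) :
    (tgdForm t P σ : PosForm S (DVar S n) C).size ≤ tgdFormSize (Fintype.card S.Pred) w n m := by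
  refine Nat.add_le_add_right (Nat.add_le_add (size_eqArgsForm_le (hw _) _ _) ?_) 6
  refine PosForm.size_conj_le (by simpa using hm) ?_
  simp only [List.mem_map, forall_exists_index, and_imp, forall_apply_eq_imp_iff₂]
  exact fun a _ => size_derivedForm_le hw
    ((List.length_filter_le _ _).trans (by simp)) _ _

theorem size_stepForm_le (hw : ∀ p, S.arity p ≤ w) {Sg : Finset (TGD S)} {m : ℕ}
    (hm : tgdsSize Sg ≤ m) (t : Fin n) (P : S.Pred) :
    (stepForm Sg t P : PosForm S (DVar S n) C).size ≤ stepSize (Fintype.card S.Pred) w n m := by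
  refine Nat.add_le_add_right (Nat.add_le_add_left (Nat.add_le_add_right
    (Nat.add_le_add ?_ ?_) 4) 4) 4
  · have := size_eqArgsForm_le (C := C) (hw P) (fun k => TupleTerm.arg (t, P) k)
      fun k => .base (.inl (.arg (t, P) k none))
    have := hw P
    simp only [factForm, PosForm.size, Nat.cast_id]
    omega
  · refine PosForm.size_disj_le ?_ ?_
    · rw [List.length_map]
      refine (List.length_filter_le _ _).trans ?_
      rw [Finset.length_toList]
      exact (card_le_tgdsSize Sg).trans hm
    · simp only [List.mem_map, List.mem_filter, Finset.mem_toList, forall_exists_index, and_imp]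
      rintro _ σ hσ - rfl
      exact size_tgdForm_le hw t P
        ((σ.body_length_le_size.trans (TGD.size_le_tgdsSize hσ)).trans hm)

theorem length_predList_le (Sg : Finset (TGD S)) : (predList Sg).length ≤ Fintype.card S.Pred := by
  refine (List.length_filter_le _ _).trans ?_
  simp

theorem size_derivationForm_le (hw : ∀ p, S.arity p ≤ w) (Sg : Finset (TGD S)) (q : BCQ S C) :
    (derivationForm n Sg q).size ≤
      formSize (Fintype.card S.Pred) w n (tgdsSize Sg + q.size) := by
  classical
  refine Nat.add_le_add_right (Nat.add_le_add ?_ ?_) 6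
  · refine PosForm.size_conj_le ?_ ?_
    · rw [List.length_map, List.length_product, List.length_finRange]
      exact Nat.mul_le_mul_left _ (length_predList_le Sg)
    · simp only [List.mem_map, forall_exists_index, and_imp]
      rintro _ s - rfl
      exact size_stepForm_le hw (Nat.le_add_right _ _) _ _
  · refine PosForm.size_conj_le ?_ ?_
    · rw [List.length_map]
      exact q.length_le_size.trans (Nat.le_add_left _ _)
    · simp only [List.mem_map, forall_exists_index, and_imp, forall_apply_eq_imp_iff₂]
      intro a _
      unfold queryAtomForm
      split_ifs
      · exact (size_derivedForm_le hw (by simp) _ _).trans (Nat.le_add_right _ _)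
      · exact (size_eqArgsForm_le (hw _) _ _).trans (Nat.le_add_left _ _)

end SizeBounds

/-! ### Constants and predicates of the rewriting -/

section Over

variable {S : Signature} {C : Type} {n : ℕ} {A : Set C} {B : Set S.Pred}

theorem TupleTerm.over_base {t : DVar S n ⊕ C} (h : ∀ c, t = .inr c → c ∈ A) :
    (base t).Over A := by
  rintro (_ | i) c hc
  · exact h c hc
  · cases hc

theorem TupleTerm.over_null (s : Slot S n) : (null s : TupleTerm S C n).Over A := by
  rintro (_ | i) c hc
  · cases hc
  · simp only [null] at hc
    split_ifs at hc

theorem TupleTerm.over_query {t : Term C} (h : ∀ c, t = .const c → c ∈ A) :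
    (query t : TupleTerm S C n).Over A := by
  rcases t with x | c
  · intro i c hc; cases hc
  · exact over_base fun c' hc => h c' (by cases hc; rfl)

theorem TupleTerm.over_arg (s : Slot S n) (k : ℕ) : (arg s k : TupleTerm S C n).Over A :=
  fun _ _ h => by cases h

theorem TupleTerm.over_ruleVar (s : Slot S n) (x : ℕ) : (ruleVar s x : TupleTerm S C n).Over A :=
  fun _ _ h => by cases h

theorem consts_extAtoms {K : Signature} {b : Builtins K} {Sg : Finset (TGD S)} {q : BCQ S C} {c : C}
    (h : ∃ a ∈ extAtoms b n Sg q, Sum.inr c ∈ a.vars) : c ∈ q.consts := by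
  classical
  obtain ⟨a, ha, hc⟩ := h
  simp only [extAtoms, List.mem_cons, List.mem_map, List.mem_filter] at ha
  rcases ha with rfl | rfl | ⟨a, ⟨ha, -⟩, rfl⟩
  · cases b.mem_vars_zeroAtom.1 hc
  · cases b.mem_vars_oneAtom.1 hc
  · obtain ⟨k, hk⟩ := hc
    exact TupleTerm.over_query (n := n) (S := S) (A := q.consts) (fun c hc => ⟨a, ha, k, hc⟩)
      none c hk

theorem pred_extAtoms {K : Signature} {b : Builtins K} {Sg : Finset (TGD S)} {q : BCQ S C}
    {p : S.Pred} (h : ∃ a ∈ extAtoms b n Sg q, a.pred = Sum.inl p) : p ∈ q.preds := by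
  classical
  obtain ⟨a, ha, hp⟩ := h
  simp only [extAtoms, List.mem_cons, List.mem_map, List.mem_filter] at ha
  rcases ha with rfl | rfl | ⟨a, ⟨ha, -⟩, rfl⟩
  · cases hp
  · cases hp
  · exact ⟨a, ha, Sum.inl.inj hp⟩

variable [Fintype S.Pred]

theorem over_eqForm {s t : TupleTerm S C n} (hs : s.Over A) (ht : t.Over A) :
    (eqForm s t).Over A B := by
  refine PosForm.over_conj ?_
  simp only [List.mem_map, forall_exists_index, and_imp, forall_apply_eq_imp_iff₂]
  exact fun i _ => PosForm.over_eq (hs i) (ht i)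

theorem over_eqArgsForm {l : ℕ} {s t : Fin l → TupleTerm S C n} (hs : ∀ k, (s k).Over A)
    (ht : ∀ k, (t k).Over A) : (eqArgsForm s t).Over A B := by
  refine PosForm.over_conj ?_
  simp only [List.mem_map, forall_exists_index, and_imp, forall_apply_eq_imp_iff₂]
  exact fun k _ => over_eqForm (hs k) (ht k)

theorem over_derivedForm {ts : List (Fin n)} {P : S.Pred}
    {args : Fin (S.arity P) → TupleTerm S C n} (h : ∀ k, (args k).Over A) :
    (derivedForm ts P args).Over A B := by
  refine PosForm.over_disj ?_
  simp only [List.mem_map, forall_exists_index, and_imp, forall_apply_eq_imp_iff₂]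
  exact fun t _ => PosForm.over_eq_inl.and (over_eqArgsForm (fun _ => TupleTerm.over_arg _ _) h)

theorem over_stepForm {Sg : Finset (TGD S)} {t : Fin n} {P : S.Pred} (hP : P ∈ B) :
    (stepForm Sg t P).Over A B := by
  classical
  refine PosForm.over_eq_inl.or (PosForm.Over.or (PosForm.Over.and ⟨Set.empty_subset _, ?_⟩
    (over_eqArgsForm (fun _ => TupleTerm.over_arg _ _)
      fun _ => TupleTerm.over_base fun _ h => by cases h)) (PosForm.over_disj ?_))
  · rintro _ rfl; exact hP
  · simp only [List.mem_map, forall_exists_index, and_imp, forall_apply_eq_imp_iff₂]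
    intro σ _
    refine (over_eqArgsForm (fun _ => TupleTerm.over_arg _ _) fun k => ?_).and
      (PosForm.over_conj ?_)
    · split_ifs
      · exact TupleTerm.over_ruleVar _ _
      · exact TupleTerm.over_null _
    · simp only [List.mem_map, forall_exists_index, and_imp, forall_apply_eq_imp_iff₂]
      exact fun a _ => over_derivedForm fun _ => TupleTerm.over_ruleVar _ _

theorem over_derivationForm (Sg : Finset (TGD S)) (q : BCQ S C) :
    (derivationForm n Sg q).Over q.consts (tgdsPreds Sg) := by
  classical
  refine (PosForm.over_conj ?_).and (PosForm.over_conj ?_)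
  · simp only [List.mem_map, forall_exists_index, and_imp]
    rintro _ ⟨t, P⟩ hs rfl
    exact over_stepForm (mem_predList.1 (List.mem_product.1 hs).2)
  · simp only [List.mem_map, forall_exists_index, and_imp, forall_apply_eq_imp_iff₂]
    intro a ha
    have hq : ∀ k, (TupleTerm.query (a.args k) : TupleTerm S C n).Over q.consts := fun k =>
      TupleTerm.over_query fun c hc => ⟨a, ha, k, hc⟩
    unfold queryAtomForm
    split_ifs
    · exact over_derivedForm hq
    · exact over_eqArgsForm hq fun k => TupleTerm.over_base fun c hc => hq k none c hc

end Over


/-! ### The rewriting -/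

section Rewriting

variable {S K : Signature} {C V : Type}

theorem arity_le_tgdsArity {Sg : Finset (TGD S)} {P : S.Pred} (hP : P ∈ tgdsPreds Sg) :
    S.arity P ≤ tgdsArity Sg := by
  obtain ⟨σ, hσ, a, ha, rfl⟩ := hP
  refine le_trans ?_ (Finset.le_sup (f := TGD.maxArity) hσ)
  unfold TGD.maxArity
  generalize σ.head :: σ.body = l at ha
  induction l with
  | nil => cases ha
  | cons b l ih =>
    rcases List.mem_cons.1 ha with rfl | ha
    · exact le_max_left _ _
    · exact (ih ha).trans (le_max_right _ _)

/-- A derivation may be transferred along any map of the values. -/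
theorem IsDerivation.map {W W' : Type} {Sg : Finset (TGD S)} {q : BCQ S C} {n : ℕ}
    {F : Set (Atom S W)} {κ : C → W} {nl : Fin n × S.Pred → W} {used : Fin n → S.Pred → Prop}
    {X Y : Fin n → S.Pred → ℕ → W} {Z : ℕ → W} (h : IsDerivation Sg q n F κ nl used X Y Z)
    (e : W → W') {F' : Set (Atom S W')} (hF : ∀ a ∈ F, a.map e ∈ F') {κ' : C → W'}
    (hκ : ∀ c ∈ q.consts, e (κ c) = κ' c) {used' : Fin n → S.Pred → Prop}
    (hu : ∀ t P, used' t P ↔ used t P) :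
    IsDerivation Sg q n F' κ' (fun s => e (nl s)) used' (fun t P k => e (X t P k))
      (fun t P x => e (Y t P x)) (fun x => e (Z x)) := by
  have hev : ∀ a ∈ q, ∀ τ ∈ a.vars, e (Term.eval κ Z τ) = Term.eval κ' (fun x => e (Z x)) τ := by
    rintro a ha (x | c) hτ
    · rfl
    · exact hκ c ⟨a, ha, hτ⟩
  constructor
  · intro t P hP hut
    rcases h.step t P hP ((hu _ _).1 hut) with hf | ⟨σ, hσ, hp, hhead, hbody⟩
    · exact Or.inl (hF _ hf)
    · refine Or.inr ⟨σ, hσ, hp, fun k => ?_, fun a ha => ?_⟩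
      · rw [hhead k, apply_ite e]
      · obtain ⟨t', ht', hu', he⟩ := hbody a ha
        exact ⟨t', ht', (hu _ _).2 hu', fun k => congrArg e (he k)⟩
  · intro a ha
    rcases h.query a ha with ⟨hp, t, hut, he⟩ | ⟨hp, hf⟩
    · refine Or.inl ⟨hp, t, (hu _ _).2 hut, fun k => ?_⟩
      rw [he k, hev a ha _ ⟨k, rfl⟩]
    · refine Or.inr ⟨hp, ?_⟩
      have := hF _ hf
      rwa [Atom.map_map, Atom.map_congr (hev a ha)] at this

/-- Each query has a rewriting that uses only the built-in predicates `zero`, `one` and `neq`. -/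
theorem exists_rewriting [Finite S.Pred] (b : Builtins K) {w : ℕ} (hw : ∀ p, S.arity p ≤ w)
    (Sg : Finset (TGD S)) (q : BCQ S C) (hs : StickyJoin Sg) :
    ∃ P : Program (S.sum K) C, IsNonrecDatalog Sg q P ∧
      P.size ≤ programSize (Nat.card S.Pred) w (tgdsSize Sg + q.size) ∧
      P.ArityLE (max (tgdsArity Sg + 1) 3) ∧
      ∀ {V : Type} {ι : C → V} (_ : Function.Injective ι) (D : Set (Atom S C))
        {I : Set (Atom (S.sum K) V)} {dom : Set V} {z o : V},
        b.Interp I ((fun a => a.map ι) '' D) dom z o → (Entails D Sg q ↔ P.Holds ι I) := by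
  classical
  have : Fintype S.Pred := Fintype.ofFinite _
  set m := tgdsSize Sg + q.size with hm
  set n := typeBound (Nat.card S.Pred) w m with hn
  obtain ⟨idx, hidx⟩ := exists_injective_nat S.Pred
  obtain ⟨name, hname⟩ := exists_injective_nat (DVar S n ⊕ List Bool)
  have hover := over_derivationForm (n := n) Sg q
  refine ⟨PosForm.program b (name ∘ Sum.inl) idx (name ∘ Sum.inr) (predList Sg) (extAtoms b n Sg q)
    (derivationForm n Sg q), ⟨PosForm.program_safe, PosForm.program_nonrecursive, ?_, ?_⟩, ?_, ?_,
    ?_⟩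
  · intro c hc
    exact (PosForm.program_consts hc).elim (fun h => hover.1 h) consts_extAtoms
  · intro p hp
    exact (PosForm.program_edbPreds hp).imp mem_predList.1 pred_extAtoms
  · refine (PosForm.size_program_le hw).trans ?_
    have h1 := size_extAtoms_le (n := n) b Sg q
    have h2 := size_derivationForm_le (n := n) hw Sg q
    have h3 := Nat.mul_le_mul_right (5 * w + 9) (length_predList_le Sg)
    have h4 : q.size ≤ m := Nat.le_add_left _ _
    rw [← hm] at h2
    simp only [programSize, Nat.cast_id, Nat.card_eq_fintype_card] at h2 h3 hn ⊢
    rw [← hn]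
    omega
  · refine PosForm.program_arityLE (le_max_right _ _) (fun Q hQ => ?_) fun Q hQ => ?_
    · exact (Nat.succ_le_succ (arity_le_tgdsArity (mem_predList.1 hQ))).trans (le_max_left _ _)
    · exact mem_predList.2 (hover.2 hQ)
  intro V ι hι D I dom z o hI
  have hext : ∀ ν : DVar S n → V, (∀ a ∈ extAtoms b n Sg q, a.map (Sum.elim ν ι) ∈ I) ↔
      ν .zero = z ∧ ν .one = o ∧ ∀ a ∈ q, a.pred ∉ tgdsPreds Sg →
        a.map (fun t => Sum.elim ν ι (TupleTerm.query t none)) ∈ (fun a => a.map ι) '' D := by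
    intro ν
    simp only [extAtoms, List.forall_mem_cons]
    refine and_congr (hI.zero _) (and_congr (hI.one _) ?_)
    simp only [List.mem_map, List.mem_filter, forall_exists_index, and_imp, decide_eq_true_eq]
    exact ⟨fun h a ha hp => (hI.rel _).1 (h _ a ha hp rfl),
      fun h _ a ha hp e => e ▸ (hI.rel _).2 (h a ha hp)⟩
  constructor
  · intro hq
    -- the derivation takes values among the tuples over the domain
    let W := {v : Coord S n → V // ∀ i, v i ∈ dom}
    -- a constant outside the domain does not occur in the facts and may have any value
    let κ : C → W := fun c => ⟨baseTuple S n z (if ι c ∈ dom then ι c else z), by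
      rintro (_ | i)
      · simp only [baseTuple]
        split_ifs with h
        exacts [h, hI.zero_mem]
      · exact hI.zero_mem⟩
    let nl : Fin n × S.Pred → W := fun s => ⟨nullTuple z o s, by
      rintro (_ | i)
      · exact hI.zero_mem
      · simp only [nullTuple]
        split_ifs
        exacts [hI.one_mem, hI.zero_mem]⟩
    have hκ : ∀ c, (∃ a ∈ D, c ∈ a.vars) → (κ c).1 = baseTuple S n z (ι c) := by
      rintro c ⟨a, ha, hc⟩
      have : ι c ∈ dom := hI.args_mem _ ⟨a, ha, rfl⟩ _ (Atom.mem_vars_map.2 ⟨c, hc, rfl⟩)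
      simp only [κ, if_pos this]
    have : Nonempty W := ⟨⟨fun _ => z, fun _ => hI.zero_mem⟩⟩
    have hle : typeBound (Nat.card S.Pred) w q.size ≤ n := by
      rw [hn, typeBound, typeBound]
      have : q.size ≤ m := Nat.le_add_left _ _
      gcongr
    obtain ⟨used, X, Y, Z, hder⟩ := hq.exists_isDerivation hs hw hle κ nl
    let ν : DVar S n → V := fun v => match v with
      | .zero => z
      | .one => o
      | .used s => bitOf z o (used s.1 s.2)
      | .arg s k i => (X s.1 s.2 k).1 i
      | .ruleVar s x i => (Y s.1 s.2 x).1 i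
      | .queryVar x i => (Z x).1 i
    have hν : ∀ x, ν x ∈ dom := by
      rintro (_ | _ | s | ⟨s, k, i⟩ | ⟨s, x, i⟩ | ⟨x, i⟩)
      exacts [hI.zero_mem, hI.one_mem, hI.bitOf_mem _, (X s.1 s.2 k).2 i, (Y s.1 s.2 x).2 i,
        (Z x).2 i]
    have hder' := hder.map Subtype.val
      (F' := (fun a => a.map fun c => baseTuple S n z (ι c)) '' D)
      (κ' := fun c => baseTuple S n z (ι c)) (used' := fun t P => ν (.used (t, P)) = o) ?_ ?_ ?_
    · obtain ⟨h1, h2⟩ := (sat_derivationForm (ν := ν) (ι := ι) hI.ne).2 (fun s => by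
        by_cases h : used s.1 s.2
        · exact Or.inr (bitOf_of_true h)
        · exact Or.inl (bitOf_of_false h)) hder'
      refine PosForm.holds_of_sat hI ?_ hν (fun c hc => ?_)
        (fun Q hQ => mem_predList.2 (hover.2 hQ)) ((hext ν).2 ⟨rfl, rfl, h2⟩) h1
      · rwa [Sum.elim_comp_inl_inr]
      · obtain ⟨a, ha, hca⟩ := hq.const_mem (hover.1 hc)
        exact hI.args_mem _ ⟨a, ha, rfl⟩ _ (Atom.mem_vars_map.2 ⟨c, hca, rfl⟩)
    · rintro _ ⟨a, ha, rfl⟩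
      refine ⟨a, ha, ?_⟩
      rw [Atom.map_map]
      exact Atom.map_congr fun c hc => (hκ c ⟨a, ha, hc⟩).symm
    · exact fun c hc => hκ c (hq.const_mem hc)
    · intro t P
      by_cases h : used t P
      · exact ⟨fun _ => h, fun _ => bitOf_of_true h⟩
      · exact ⟨fun h' => absurd ((bitOf_of_false h).symm.trans h') hI.ne, fun h' => (h h').elim⟩
  · intro hP U _ ιU hιU B hDB hsat
    obtain ⟨ν, hνext, hνsat⟩ := PosForm.exists_sat_of_holds hI hidx hP
    obtain ⟨rfl, rfl, hν⟩ := (hext ν).1 hνext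
    have hder := (sat_derivationForm hI.ne).1 ⟨hνsat, hν⟩
    -- encoded elements of the database are mapped back to the instance
    let g₀ : (Coord S n → V) → U := fun v =>
      Function.extend ι ιU (fun _ => Classical.arbitrary U) (v none)
    have hg₀ : ∀ c, g₀ (baseTuple S n (ν .zero) (ι c)) = ιU c := fun c => hι.extend_apply _ _ c
    have := hder.holds (nullTuple_injective hI.ne) (fun c s => baseTuple_ne_nullTuple hI.ne s) ?_ g₀
      (B := B) ?_ hsat
    · rwa [funext hg₀] at this
    · rintro _ ⟨a, -, rfl⟩ s hs'
      obtain ⟨c, -, e⟩ := Atom.mem_vars_map.1 hs'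
      exact baseTuple_ne_nullTuple hI.ne s e
    · rintro _ ⟨a, ha, rfl⟩
      rw [Atom.map_map, Atom.map_congr fun c _ => hg₀ c]
      exact hDB a ha

end Rewriting

/-! ### Databases with built-in predicates -/

section Databases

variable {S : Signature} {C : Type}

theorem Atom.inl_injective {S S' : Signature} {T : Type} {a a' : Atom S T}
    (h : (a.inl : Atom (S.sum S') T) = a'.inl) : a = a' := by
  refine Atom.ext_some (Sum.inl.inj (congrArg Atom.pred h)) fun k t hk => ?_
  have h' : (a.inl : Atom (S.sum S') T).get k = (a'.inl : Atom (S.sum S') T).get k := by rw [h]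
  exact h'.symm.trans hk

/-- The built-in predicates of plain databases. -/
def boolBuiltins : Builtins boolSig := ⟨.zero, .one, .neq, rfl, rfl, rfl⟩

/-- The built-in predicates of numerical databases that the rewriting uses. -/
def numBuiltins : Builtins numSig := ⟨.zero, .one, .neq, rfl, rfl, rfl⟩

theorem Atom.inl_ne_inr {S S' : Signature} {T : Type} {a : Atom S T} {p : S'.Pred}
    {v : Fin ((S.sum S').arity (.inr p)) → T} : (a.inl : Atom (S.sum S') T) ≠ ⟨.inr p, v⟩ :=
  fun h => by cases congrArg Atom.pred h

theorem Database.plain_interp (D : Database S C) {z o : C} (hz : z ∈ D.dom) (ho : o ∈ D.dom)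
    (h : z ≠ o) : boolBuiltins.Interp (D.plain z o) ((fun a => a.map id) '' D.facts) D.dom z o := by
  have hid : (fun a : Atom S C => a.map id) '' D.facts = D.facts := Set.image_id _
  have hzero : ∀ v : C, (boolBuiltins.zeroAtom v : Atom (S.sum boolSig) C) =
      ⟨.inr .zero, ![v]⟩ := fun v => congrArg (Atom.mk _) (funext fun i : Fin 1 => by
        fin_cases i; rfl)
  have hone : ∀ v : C, (boolBuiltins.oneAtom v : Atom (S.sum boolSig) C) =
      ⟨.inr .one, ![v]⟩ := fun v => congrArg (Atom.mk _) (funext fun i : Fin 1 => by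
        fin_cases i; rfl)
  have hneq : ∀ v v' : C, (boolBuiltins.neqAtom v v' : Atom (S.sum boolSig) C) =
      ⟨.inr .neq, ![v, v']⟩ := fun v v' => congrArg (Atom.mk _) (funext fun i : Fin 2 => by
        fin_cases i <;> rfl)
  rw [hid]
  refine ⟨fun v => ⟨fun hv => ?_, ?_⟩, fun v => ⟨fun hv => ?_, ?_⟩,
    fun v v' => ⟨fun hv => ?_, ?_⟩, fun a => ⟨fun ha => ?_, fun ha => .rel ha⟩, hz, ho, h,
    D.args_mem⟩
  · change D.Plain z o _ at hv
    generalize e : boolBuiltins.zeroAtom v = a at hv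
    cases hv with
    | zero => exact Option.some.inj (congrArg (Atom.get · 0) e)
    | _ => cases congrArg Atom.pred e
  · rintro rfl
    exact hzero v ▸ .zero
  · change D.Plain z o _ at hv
    generalize e : boolBuiltins.oneAtom v = a at hv
    cases hv with
    | one => exact Option.some.inj (congrArg (Atom.get · 0) e)
    | _ => cases congrArg Atom.pred e
  · rintro rfl
    exact hone v ▸ .one
  · change D.Plain z o _ at hv
    generalize e : boolBuiltins.neqAtom v v' = a at hv
    cases hv with
    | neq hc hd hne =>
      obtain rfl := Option.some.inj (congrArg (Atom.get · 0) e)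
      obtain rfl := Option.some.inj (congrArg (Atom.get · 1) e)
      exact ⟨hc, hd, hne⟩
    | _ => cases congrArg Atom.pred e
  · rintro ⟨hc, hd, hne⟩
    exact hneq v v' ▸ .neq hc hd hne
  · change D.Plain z o _ at ha
    generalize e : a.inl = a' at ha
    cases ha with
    | rel ha => exact Atom.inl_injective e ▸ ha
    | _ => exact (Atom.inl_ne_inr e).elim

theorem Database.numerical_interp (D : Database S C) {N : ℕ} (hN : 1 ≤ N) :
    numBuiltins.Interp (D.numerical N) ((fun a => a.map Sum.inl) '' D.facts) (D.numDom N)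
      (.inr 0) (.inr 1) := by
  have hzero : ∀ v : C ⊕ ℕ, (numBuiltins.zeroAtom v : Atom (S.sum numSig) (C ⊕ ℕ)) =
      ⟨.inr .zero, ![v]⟩ := fun v => congrArg (Atom.mk _) (funext fun i : Fin 1 => by
        fin_cases i; rfl)
  have hone : ∀ v : C ⊕ ℕ, (numBuiltins.oneAtom v : Atom (S.sum numSig) (C ⊕ ℕ)) =
      ⟨.inr .one, ![v]⟩ := fun v => congrArg (Atom.mk _) (funext fun i : Fin 1 => by
        fin_cases i; rfl)
  have hneq : ∀ v v' : C ⊕ ℕ, (numBuiltins.neqAtom v v' : Atom (S.sum numSig) (C ⊕ ℕ)) =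
      ⟨.inr .neq, ![v, v']⟩ := fun v v' => congrArg (Atom.mk _) (funext fun i : Fin 2 => by
        fin_cases i <;> rfl)
  refine ⟨fun v => ⟨fun hv => ?_, ?_⟩, fun v => ⟨fun hv => ?_, ?_⟩,
    fun v v' => ⟨fun hv => ?_, ?_⟩, fun a => ⟨fun ha => ?_, ?_⟩,
    Or.inr ⟨0, Nat.zero_le _, rfl⟩, Or.inr ⟨1, hN, rfl⟩, Sum.inr_injective.ne Nat.zero_ne_one, ?_⟩
  · change D.Numerical N _ at hv
    generalize e : numBuiltins.zeroAtom v = a at hv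
    cases hv with
    | zero => exact Option.some.inj (congrArg (Atom.get · 0) e)
    | _ => cases congrArg Atom.pred e
  · rintro rfl
    exact hzero _ ▸ .zero
  · change D.Numerical N _ at hv
    generalize e : numBuiltins.oneAtom v = a at hv
    cases hv with
    | one => exact Option.some.inj (congrArg (Atom.get · 0) e)
    | _ => cases congrArg Atom.pred e
  · rintro rfl
    exact hone _ ▸ .one hN
  · change D.Numerical N _ at hv
    generalize e : numBuiltins.neqAtom v v' = a at hv
    cases hv with
    | neq hc hd hne =>
      obtain rfl := Option.some.inj (congrArg (Atom.get · 0) e)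
      obtain rfl := Option.some.inj (congrArg (Atom.get · 1) e)
      exact ⟨hc, hd, hne⟩
    | _ => cases congrArg Atom.pred e
  · rintro ⟨hc, hd, hne⟩
    exact hneq v v' ▸ .neq hc hd hne
  · change D.Numerical N _ at ha
    generalize e : a.inl = a' at ha
    cases ha with
    | rel ha => exact ⟨_, ha, (Atom.inl_injective e).symm⟩
    | _ => exact (Atom.inl_ne_inr e).elim
  · rintro ⟨a, ha, rfl⟩
    exact .rel ha
  · rintro _ ⟨a, ha, rfl⟩ v hv
    obtain ⟨c, hc, rfl⟩ := Atom.mem_vars_map.1 hv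
    exact Or.inl ⟨c, D.args_mem a ha c hc, rfl⟩

end Databases

end Onto

theorem mainTheorem4 (R : Signature) [Finite R.Pred] :
    ∃ (γ s : Polynomial ℕ) (k : ℕ), ∀ (C : Type) (Sg : Finset (TGD R)) (q : BCQ R C),
      (Sticky Sg ∨ StickyJoin Sg) →
      (∃ P : Program (R.sum numSig) C, IsNonrecDatalog Sg q P ∧
        P.size ≤ s.eval (tgdsSize Sg + q.size) ∧
        P.ArityLE (max (tgdsArity Sg + 1) 3) ∧
        ∀ N : ℕ, γ.eval (tgdsSize Sg + q.size) ≤ N → ∀ D : Database R C,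
          (Entails D.facts Sg q ↔ P.Holds Sum.inl (D.numerical N))) ∧
      (∃ P : Program (R.sum boolSig) C, IsNonrecDatalog Sg q P ∧
        P.size ≤ s.eval (tgdsSize Sg + q.size) ∧
        P.ArityLE
          (k * (max (tgdsArity Sg + 1) 3 * Nat.log 2 (γ.eval (tgdsSize Sg + q.size)))) ∧
        ∀ (D : Database R C) (z o : C), z ∈ D.dom → o ∈ D.dom → z ≠ o →
          (Entails D.facts Sg q ↔ P.Holds id (D.plain z o))) := by
  classical
  have := Fintype.ofFinite R.Pred
  have hw : ∀ p, R.arity p ≤ Finset.univ.sup R.arity := fun p => Finset.le_sup (Finset.mem_univ p)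
  -- `γ = 2` ensures that `1` is among the numbers, and that the logarithm is not `0`
  refine ⟨.C 2, programSize (Nat.card R.Pred) (Finset.univ.sup R.arity) .X, 1,
    fun C Sg q hSg => ?_⟩
  have hs : StickyJoin Sg := hSg.elim Sticky.stickyJoin id
  simp only [eval_programSize, Polynomial.eval_C]
  constructor
  · obtain ⟨P, h1, h2, h3, h4⟩ := exists_rewriting numBuiltins hw Sg q hs
    exact ⟨P, h1, h2, h3, fun N hN D =>
      h4 Sum.inl_injective D.facts (D.numerical_interp (one_le_two.trans hN))⟩
  · obtain ⟨P, h1, h2, h3, h4⟩ := exists_rewriting boolBuiltins hw Sg q hs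
    have hlog : Nat.log 2 2 = 1 := Nat.log_eq_iff (Or.inl Nat.one_ne_zero) |>.2 (by norm_num)
    refine ⟨P, h1, h2, by rwa [hlog, mul_one, one_mul], fun D z o hz ho h => ?_⟩
    exact h4 Function.injective_id D.facts (D.plain_interp hz ho h)
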